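/- Let $k$ be an algebraically closed field, let $\prec$ be a fixed linear order on the set $k$, and let $n\ge 0$. A matrix algebra $\Lambda\subset k^{n\times n}$ is a subspace that is closed under multiplication and contains $I$; $\Lambda^*$ is the set of its nonsingular matrices, and $M\sim_\Lambda N$ means that $S^{-1}MS=N$ for some $S\in\Lambda^*$. **Reduced algebras.** $\Lambda$ is a *reduced matrix algebra* if there are a partition $n=n_1+\dots+n_t$ ($n_i\ge 0$), an equivalence relation $\sim$ on $T=\{1,\dots,t\}$ with $n_i=n_j$ whenever $i\sim j$, and, for each pair of classes $\mathcal I,\mathcal J\in T/{\sim}$, a finite system of linear equations $\sum_{\mathcal I\ni i<j\in\mathcal J}c^{(u)}_{ij}x_{ij}=0$ ($1\le u\le q_{\mathcal I\mathcal J}$, $c^{(u)}_{ij}\in k$), such that $\Lambda$ consists of all upper block-triangular matrices $S=[S_{ij}]$, $S_{ij}\in k^{n_i\times n_j}$, with $S_{ii}=S_{jj}$ whenever $i\sim j$ and $\sum_{\mathcal I\ni i<j\in\mathcal J}c^{(u)}_{ij}S_{ij}=0$ for all $\mathcal I,\mathcal J,u$. **Weyr matrices.** A *Weyr matrix* is a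 matrix $W_{1}\oplus\dots\oplus W_{s}$ in which $W_{i}$ has the diagonal blocks $\lambda_iI_{m_{i1}},\dots,\lambda_iI_{m_{i\kappa_i}}$, the blocks $\begin{bmatrix}I\\0\end{bmatrix}$ of size $m_{ij}\times m_{i,j+1}$ immediately above the diagonal, and zeros elsewhere, where $\kappa_i\ge 1$, $m_{i1}\ge\dots\ge m_{i\kappa_i}\ge 1$ and $\lambda_1\prec\dots\prec\lambda_s$. **Belitskiĭ's algorithm.** Let $M\in k^{n\times n}$ and let $\Lambda$ be reduced, with data as above. Partition $M$ into blocks $M_{ij}\in k^{n_i\times n_j}$, ordered by $M_{t1}<M_{t2}<\dots<M_{tt}<M_{t-1,1}<\dots<M_{t-1,t}<\cdots$. A block is *stable* if it is the same in $M$ and in $S^{-1}MS$ for every $S\in\Lambda^*$. If all blocks are stable, the algorithm stops. Otherwise let $M_{lr}$ be the first nonstable block, $l\in\mathcal I$, $r\in\mathcal J$ (all blocks before it are $0$ or scalar), and consider the equality $$M_{l1}S_{1r}+\dots+M_{l,r-1}S_{r-1,r}=S_{l,l+1}M_{l+1,r}+\dots+S_{lt}M_{tr}.\tag{$*$}$$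 Replace $M$ by $M'=S^{-1}MS$, where $S\in\Lambda^*$ is chosen so that: * Case I: if the equations $\sum_{\mathcal I\ni i<j\in\mathcal J}c^{(u)}_{ij}S_{ij}=0$ ($1\le u\le q_{\mathcal I\mathcal J}$) do not imply $(*)$, then all $S_{ii}=I$ and $M'_{lr}=0$; * Case II: if they imply $(*)$ and $l\not\sim r$, then $M'_{lr}=\begin{bmatrix}0&I\\0&0\end{bmatrix}$ with an identity block of some size $d\ge 0$; * Case III: if they imply $(*)$ and $l\sim r$, then $M'_{lr}$ is a Weyr matrix. Replace $\Lambda$ by $\Lambda'=\{X\in\Lambda \mid (XM')_{lr}=(M'X)_{lr}\}$, and repeat the construction with the pair $(M',\Lambda')$. If the algorithm, started at $(M,\Lambda)$, stops at $(M^\infty,\Lambda^\infty)$, then $M^\infty$ is its output, called the *$\Lambda$-canonical form* of $M$. **Theorem.** Let $\Lambda\subset k^{n\times n}$ be a reduced matrix algebra. For every $M\in k^{n\times n}$ the algorithm can be carried out (as long as it has not stopped, a further step is possible), it stops after finitely many steps, and its output $M^\infty$ does not depend on the choices made. Moreover: 1. $M\sim_\Lambda M^\infty$ for every $M\in k^{n\times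 n}$; 2. for all $M,N\in k^{n\times n}$, $M\sim_\Lambda N$ if and only if $M^\infty=N^\infty$. Consequently, each class of $\Lambda$-similar matrices contains exactly one matrix that is the $\Lambda$-canonical form of some matrix. -/

import Mathlib

/-- Two `n × n` matrices are `Λ`-similar if `S⁻¹ M S = N` for some nonsingular `S ∈ Λ`. -/
def LambdaSimilar {k : Type*} [Field k] {n : ℕ} (Λ : Subalgebra k (Matrix (Fin n) (Fin n) k))
    (M N : Matrix (Fin n) (Fin n) k) : Prop :=
  ∃ S ∈ Λ, IsUnit S ∧ S⁻¹ * M * S = N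

/-- The data of a reduced `n̲ × n̲` algebra of `n × n` matrices: a partition `n̲ = (n₁, …, n_t)` of
the index set `Fin n` into `t` consecutive (possibly empty) strips, an equivalence relation on the
set of strips that relates only strips of equal size, and, for each pair of equivalence classes,
a finite system of homogeneous linear equations. -/
structure ReducedData (k : Type*) (n : ℕ) where
  /-- The number of strips. -/
  t : ℕ
  /-- The strip that contains a given row or column index. -/
  blk : Fin n → Fin t
  blk_mono : Monotone blk
  /-- The equivalence relation on strips. -/
  sim : Setoid (Fin t)
  size_eq : ∀ i j : Fin t, sim i j →
    (Finset.univ.filter fun p => blk p = i).card = (Finset.univ.filter fun p => blk p = j).card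
  /-- The number of equations for a pair of classes. -/
  numEq : Quotient sim → Quotient sim → ℕ
  /-- The coefficients `c_{ij}^{(u)}`; only those with `i ∈ I`, `j ∈ J`, `i < j` are used. -/
  coeff : (I J : Quotient sim) → Fin (numEq I J) → Fin t → Fin t → k

namespace ReducedData

variable {k : Type*} {n : ℕ}

/-- The size `n_i` of the `i`-th strip. -/
def size (D : ReducedData k n) (i : Fin D.t) : ℕ :=
  (Finset.univ.filter fun p => D.blk p = i).card

/-- The position of an index inside its strip: `0, …, n_i - 1`. -/
def pos (D : ReducedData k n) (p : Fin n) : ℕ :=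
  (Finset.univ.filter fun q => D.blk q = D.blk p ∧ q < p).card

/-- The equivalence class of a strip. -/
def cls (D : ReducedData k n) (i : Fin D.t) : Quotient D.sim := Quotient.mk D.sim i

/-- The block `A_{ij}` of a matrix. -/
def block (D : ReducedData k n) (A : Matrix (Fin n) (Fin n) k) (i j : Fin D.t) :
    Matrix {p : Fin n // D.blk p = i} {q : Fin n // D.blk q = j} k :=
  A.submatrix Subtype.val Subtype.val

open Classical in
/-- The off-diagonal blocks of `S` satisfy the equations
`∑_{I ∋ i < j ∈ J} c_{ij}^{(u)} S_{ij} = 0`, `u = 1, …, q_{IJ}`, of the pair `(I, J)`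
(written entry by entry: `a`, `b` is the position inside the blocks). -/
def SatisfiesEqs [Field k] (D : ReducedData k n) (I J : Quotient D.sim)
    (S : Matrix (Fin n) (Fin n) k) : Prop :=
  ∀ (u : Fin (D.numEq I J)) (a b : ℕ),
    (∑ p : Fin n, ∑ q : Fin n,
      if D.cls (D.blk p) = I ∧ D.cls (D.blk q) = J ∧ D.blk p < D.blk q ∧ D.pos p = a ∧ D.pos q = b
      then D.coeff I J u (D.blk p) (D.blk q) * S p q else 0) = 0

/-- `Λ` is the reduced algebra with the data `D`: it consists of all upper block-triangular
matrices with `S_{ii} = S_{jj}` whenever `i ∼ j` whose off-diagonal blocks satisfy all the systems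
of equations. -/
def Presents [Field k] (D : ReducedData k n) (Λ : Subalgebra k (Matrix (Fin n) (Fin n) k)) : Prop :=
  ∀ S : Matrix (Fin n) (Fin n) k, S ∈ Λ ↔
    (∀ p q, D.blk q < D.blk p → S p q = 0) ∧
    (∀ p q p' q', D.blk p = D.blk q → D.blk p' = D.blk q' → D.sim (D.blk p) (D.blk p') →
      D.pos p = D.pos p' → D.pos q = D.pos q' → S p q = S p' q') ∧
    (∀ I J : Quotient D.sim, D.SatisfiesEqs I J S)

/-- The block `M_{ij}` is stable: `Λ`-similarity transformations of `M` do not change it. -/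
def Stable [Field k] (D : ReducedData k n) (Λ : Subalgebra k (Matrix (Fin n) (Fin n) k))
    (M : Matrix (Fin n) (Fin n) k) (i j : Fin D.t) : Prop :=
  ∀ S ∈ Λ, IsUnit S → D.block (S⁻¹ * M * S) i j = D.block M i j

/-- The ordering of blocks `M_{t1} < M_{t2} < … < M_{tt} < M_{t-1,1} < … < M_{t-1,t} < …`. -/
def Before (D : ReducedData k n) (i j i' j' : Fin D.t) : Prop :=
  i' < i ∨ (i = i' ∧ j < j')

/-- `M_{lr}` is the first nonstable block of `M`. -/
def FirstNonstable [Field k] (D : ReducedData k n) (Λ : Subalgebra k (Matrix (Fin n) (Fin n) k))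
    (M : Matrix (Fin n) (Fin n) k) (l r : Fin D.t) : Prop :=
  ¬ D.Stable Λ M l r ∧ ∀ i j, D.Before i j l r → D.Stable Λ M i j

/-- The equations of the pair `(I, J)`, where `l ∈ I` and `r ∈ J`, imply the equality
`M_{l1} S_{1r} + ⋯ + M_{l,r-1} S_{r-1,r} = S_{l,l+1} M_{l+1,r} + ⋯ + S_{lt} M_{tr}`
(when `M_{lr}` is the first nonstable block, every block of `M` that occurs here is stable, and
hence is `0` or a scalar matrix `a I`). -/
def NoAddition [Field k] (D : ReducedData k n) (M : Matrix (Fin n) (Fin n) k) (l r : Fin D.t) :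
    Prop :=
  ∀ S : Matrix (Fin n) (Fin n) k, D.SatisfiesEqs (D.cls l) (D.cls r) S →
    ∀ p q : Fin n, D.blk p = l → D.blk q = r →
      (∑ s ∈ Finset.univ.filter (fun s => D.blk s < r), M p s * S s q) =
        ∑ s ∈ Finset.univ.filter (fun s => l < D.blk s), S p s * M s q

/-- The `(l, r)` block of `A` has the form `[0 I; 0 0]`, with an identity matrix of some size
`d ≥ 0` in the upper right corner. -/
def IsCornerBlock [Field k] (D : ReducedData k n) (A : Matrix (Fin n) (Fin n) k) (l r : Fin D.t) :
    Prop :=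
  ∃ d : ℕ, d ≤ D.size l ∧ d ≤ D.size r ∧ ∀ p q : Fin n, D.blk p = l → D.blk q = r →
    A p q = if D.pos p < d ∧ D.pos q = D.size r - d + D.pos p then 1 else 0

end ReducedData

/-- `Λ` is a reduced matrix algebra. -/
def IsReducedAlgebra {k : Type*} [Field k] {n : ℕ}
    (Λ : Subalgebra k (Matrix (Fin n) (Fin n) k)) : Prop :=
  ∃ D : ReducedData k n, D.Presents Λ

/-- The matrix `W_{λ}` with `κ × κ` blocks: the diagonal blocks are `λ I_{m₁}, …, λ I_{m_κ}`, the
blocks next above the diagonal are `[I; 0]` (of size `m_j × m_{j+1}`), the others are zero. -/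
def weyrCell {k : Type*} [Field k] (lam : k) {κ : ℕ} (m : Fin κ → ℕ) :
    Matrix (Σₗ j : Fin κ, Fin (m j)) (Σₗ j : Fin κ, Fin (m j)) k :=
  Matrix.of fun x y =>
    if x = y then lam
    else if ((ofLex x).1 : ℕ) + 1 = (ofLex y).1 ∧ ((ofLex x).2 : ℕ) = (ofLex y).2 then 1
    else 0

/-- `W` is a Weyr matrix `W_{λ₁} ⊕ ⋯ ⊕ W_{λ_r}`, `λ₁ ≺ ⋯ ≺ λ_r`, with
`m_{i1} ≥ ⋯ ≥ m_{iκ_i} > 0` for each `i`. The rows and the columns of `W` are indexed by finite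
linear orders, which are identified with the block index set in the order-preserving way. -/
def IsWeyr {k : Type*} [Field k] [LinearOrder k] {α β : Type*} [LinearOrder α] [LinearOrder β]
    (W : Matrix α β k) : Prop :=
  ∃ (r : ℕ) (lam : Fin r → k) (κ : Fin r → ℕ) (m : (i : Fin r) → Fin (κ i) → ℕ)
    (e : α ≃o Σₗ i : Fin r, Σₗ j : Fin (κ i), Fin (m i j))
    (f : β ≃o Σₗ i : Fin r, Σₗ j : Fin (κ i), Fin (m i j)),
    StrictMono lam ∧ (∀ i, 0 < κ i) ∧ (∀ i, Antitone (m i)) ∧ (∀ i j, 0 < m i j) ∧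
    ∀ x y, W x y =
      Matrix.blockDiagonal' (fun i => weyrCell (lam i) (m i)) (ofLex (e x)) (ofLex (f y))

/-- A step `(M, Λ) ↦ (M', Λ')` of Belitskii's algorithm. The first nonstable block `M_{lr}` is
reduced by a transformation `M' = S⁻¹ M S`, `S ∈ Λ*`, as follows.
Case I (there is a nonzero admissible addition to `M_{lr}`): `M'_{lr} = 0`, and the diagonal blocks
of `S` are identity matrices.
Case II (no addition, `l ≁ r`): `M'_{lr} = [0 I; 0 0]`.
Case III (no addition, `l ∼ r`): `M'_{lr}` is a Weyr matrix.
Then `Λ'` consists of all `X ∈ Λ` for which `X M'` and `M' X` have equal `(l, r)` blocks. -/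
def BelitskiiStep {k : Type*} [Field k] [LinearOrder k] {n : ℕ}
    (s s' : Matrix (Fin n) (Fin n) k × Subalgebra k (Matrix (Fin n) (Fin n) k)) : Prop :=
  ∃ D : ReducedData k n, D.Presents s.2 ∧ ∃ l r : Fin D.t, D.FirstNonstable s.2 s.1 l r ∧
    (∃ S ∈ s.2, IsUnit S ∧ s'.1 = S⁻¹ * s.1 * S ∧
      ((¬ D.NoAddition s.1 l r ∧ (∀ p q, D.blk p = D.blk q → S p q = if p = q then 1 else 0) ∧
          D.block s'.1 l r = 0) ∨
        (D.NoAddition s.1 l r ∧ ¬ D.sim l r ∧ D.IsCornerBlock s'.1 l r) ∨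
        (D.NoAddition s.1 l r ∧ D.sim l r ∧ IsWeyr (D.block s'.1 l r)))) ∧
    ∀ X, X ∈ s'.2 ↔ X ∈ s.2 ∧ D.block (X * s'.1) l r = D.block (s'.1 * X) l r

/-- The algorithm stops at `(M, Λ)`: all blocks of `M` are stable, that is, `M` is `Λ`-similar
only to itself. -/
def BelitskiiStops {k : Type*} [Field k] {n : ℕ}
    (s : Matrix (Fin n) (Fin n) k × Subalgebra k (Matrix (Fin n) (Fin n) k)) : Prop :=
  ∀ S ∈ s.2, IsUnit S → S⁻¹ * s.1 * S = s.1

/-- `C` is an output `M^∞` of Belitskii's algorithm applied to `(M, Λ)`: a finite sequence of steps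
leads from `(M, Λ)` to some `(C, Λ^∞)`, at which the algorithm stops. -/
def IsBelitskiiOutput {k : Type*} [Field k] [LinearOrder k] {n : ℕ}
    (Λ : Subalgebra k (Matrix (Fin n) (Fin n) k)) (M C : Matrix (Fin n) (Fin n) k) : Prop :=
  ∃ Λ' : Subalgebra k (Matrix (Fin n) (Fin n) k),
    Relation.ReflTransGen BelitskiiStep (M, Λ) (C, Λ') ∧ BelitskiiStops (C, Λ')

/-! Let M_lr be the first nonstable block. The blocks before it are 0 or scalar, so S in Λ* acts on
M_lr only through the diagonal blocks S_ll, S_rr and through the additions compared in (*). If (*)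
is not forced, some addition is nonzero; block-diagonal matrices of Λ move it to every place of the
block, and M_lr can be made 0. If (*) is forced, M_lr turns into S_ll⁻¹ M_lr S_rr: an equivalence
with independent factors when l ≁ r, a similarity when l ∼ r. The rank form and the Weyr form are
complete invariants of these two actions.

Uniqueness rests on one observation. Stability on a set of places closed downwards and to the left
means that XM and MX agree there for all X in Λ (`Presents.commOn_iff`). Steps from Λ-similar M and
N treat the same block and produce M' and N' that agree up to and including it. Hence both define
the same Λ', and every T in Λ with T N' = M' T lies in Λ', so M' and N' are Λ'-similar
(`StepAt.similar`). Since Λ' is strictly smaller than Λ, its dimension bounds the number of steps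
and carries the induction; where the algorithm stops, similar matrices are equal.

The process can go on because Λ' is again reduced. In Cases II and III its diagonal blocks preserve
the normal form just obtained, which forces a finer triangular shape with further equal diagonal
blocks. `IsFrame.isReducedAlgebra` shows that such a shape, together with all block-diagonal
matrices of that shape, already makes an algebra reduced. This is why the Weyr form is used: with
rows ordered by eigenvalue, level and decreasing chain length, the matrices that commute with it are
block triangular.

The data of a reduced algebra are not unique, but the nonempty strips and the twins are
(`Presents.agree`), so steps made with different data can be compared. -/

namespace ReducedData

/-! ### Positions inside strips, and twins. -/

section Positions

variable {k : Type*} {n : ℕ} {D : ReducedData k n}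

theorem pos_lt_pos_iff {p q : Fin n} (h : D.blk p = D.blk q) : D.pos p < D.pos q ↔ p < q := by
  have key : ∀ {p q : Fin n}, D.blk p = D.blk q → p < q → D.pos p < D.pos q := by
    intro p q h hpq
    refine Finset.card_lt_card (Finset.ssubset_iff_of_subset ?_ |>.2 ⟨p, ?_, ?_⟩)
    · intro s hs
      simp only [Finset.mem_filter, Finset.mem_univ, true_and] at hs ⊢
      exact ⟨hs.1.trans h, hs.2.trans hpq⟩
    · simp [h, hpq]
    · simp
  refine ⟨fun hlt => ?_, key h⟩
  by_contra hn
  rcases (not_lt.1 hn).lt_or_eq with h' | h'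
  · exact absurd (key h.symm h') (by omega)
  · subst h'; omega

theorem eq_of_pos_eq {p q : Fin n} (h : D.blk p = D.blk q) (hpos : D.pos p = D.pos q) : p = q := by
  rcases lt_trichotomy p q with h' | h' | h'
  · have := (pos_lt_pos_iff h).2 h'; omega
  · exact h'
  · have := (pos_lt_pos_iff h.symm).2 h'; omega

theorem pos_lt_size (D : ReducedData k n) (p : Fin n) : D.pos p < D.size (D.blk p) := by
  refine Finset.card_lt_card (Finset.ssubset_iff_of_subset ?_ |>.2 ⟨p, ?_, ?_⟩)
  · intro s hs
    simp only [Finset.mem_filter, Finset.mem_univ, true_and] at hs ⊢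
    exact hs.1
  · simp
  · simp

theorem exists_pos {i : Fin D.t} {a : ℕ} (h : a < D.size i) : ∃ p, D.blk p = i ∧ D.pos p = a := by
  have himg : (Finset.univ.filter fun p => D.blk p = i).image D.pos = Finset.range (D.size i) := by
    refine Finset.eq_of_subset_of_card_le ?_ ?_
    · intro b hb
      simp only [Finset.mem_image, Finset.mem_filter, Finset.mem_univ, true_and] at hb
      obtain ⟨p, hp, rfl⟩ := hb
      rw [Finset.mem_range, ← hp]
      exact D.pos_lt_size p
    · rw [Finset.card_range, Finset.card_image_of_injOn]
      · rfl
      · intro p hp q hq hpq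
        simp only [Finset.coe_filter, Finset.mem_univ, true_and, Set.mem_ofPred_eq] at hp hq
        exact eq_of_pos_eq (hp.trans hq.symm) hpq
  have := Finset.mem_range.2 h
  rw [← himg] at this
  simpa using this

theorem size_eq_of_sim {i j : Fin D.t} (h : D.sim i j) : D.size i = D.size j := D.size_eq i j h

theorem exists_pos_eq (p : Fin n) {i : Fin D.t} (h : D.sim (D.blk p) i) :
    ∃ q, D.blk q = i ∧ D.pos q = D.pos p :=
  exists_pos (by rw [← size_eq_of_sim h]; exact D.pos_lt_size p)

theorem sum_strip {M : Type*} [AddCommMonoid M] (i : Fin D.t) (g : ℕ → M) :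
    ∑ s ∈ Finset.univ.filter (fun s => D.blk s = i), g (D.pos s) =
      ∑ a ∈ Finset.range (D.size i), g a := by
  refine Finset.sum_nbij D.pos ?_ ?_ ?_ ?_
  · intro s hs
    simp only [Finset.mem_filter, Finset.mem_univ, true_and] at hs
    rw [Finset.mem_range, ← hs]
    exact D.pos_lt_size s
  · intro p hp q hq hpq
    simp only [Finset.coe_filter, Finset.mem_univ, true_and, Set.mem_ofPred_eq] at hp hq
    exact eq_of_pos_eq (hp.trans hq.symm) hpq
  · intro a ha
    obtain ⟨p, hp, hpa⟩ := exists_pos (Finset.mem_range.1 (Finset.mem_coe.1 ha))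
    exact ⟨p, by simpa using hp, hpa⟩
  · intros; rfl

/-- Two indices are twins if they have equal positions in equivalent strips. -/
def Twin (D : ReducedData k n) (p q : Fin n) : Prop :=
  D.sim (D.blk p) (D.blk q) ∧ D.pos p = D.pos q

theorem Twin.refl (p : Fin n) : D.Twin p p := ⟨D.sim.refl _, rfl⟩

theorem Twin.symm {p q : Fin n} (h : D.Twin p q) : D.Twin q p := ⟨D.sim.symm h.1, h.2.symm⟩

theorem Twin.trans {p q r : Fin n} (h : D.Twin p q) (h' : D.Twin q r) : D.Twin p r :=
  ⟨D.sim.trans h.1 h'.1, h.2.trans h'.2⟩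

theorem Twin.eq {p q : Fin n} (h : D.Twin p q) (hb : D.blk p = D.blk q) : p = q :=
  eq_of_pos_eq hb h.2

end Positions

/-! ### Block-diagonal matrices and matrix units in a reduced algebra. -/

section Algebra

variable {k : Type*} [Field k] {n : ℕ} {D : ReducedData k n}
  {Λ : Subalgebra k (Matrix (Fin n) (Fin n) k)}

theorem Presents.tri (hD : D.Presents Λ) {S : Matrix (Fin n) (Fin n) k} (hS : S ∈ Λ) {p q : Fin n}
    (h : D.blk q < D.blk p) : S p q = 0 := ((hD S).1 hS).1 p q h

theorem Presents.eq_of_twin (hD : D.Presents Λ) {S : Matrix (Fin n) (Fin n) k} (hS : S ∈ Λ)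
    {p q p' q' : Fin n} (h : D.blk p = D.blk q) (h' : D.blk p' = D.blk q') (hp : D.Twin p p')
    (hq : D.pos q = D.pos q') : S p q = S p' q' :=
  ((hD S).1 hS).2.1 p q p' q' h h' hp.1 hp.2 hq

/-- A block-diagonal matrix with equal blocks on equivalent strips belongs to `Λ`. -/
theorem Presents.mem_of_blockDiag (hD : D.Presents Λ) {S : Matrix (Fin n) (Fin n) k}
    (h0 : ∀ p q, D.blk p ≠ D.blk q → S p q = 0)
    (h1 : ∀ p q p' q', D.blk p = D.blk q → D.blk p' = D.blk q' → D.Twin p p' → D.Twin q q' →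
      S p q = S p' q') : S ∈ Λ := by
  refine (hD S).2 ⟨fun p q h => h0 p q h.ne', ?_, ?_⟩
  · intro p q p' q' hpq hpq' hs hp hq
    exact h1 p q p' q' hpq hpq' ⟨hs, hp⟩ ⟨by rwa [← hpq, ← hpq'], hq⟩
  · intro I J u a b
    refine Finset.sum_eq_zero fun p _ => Finset.sum_eq_zero fun q _ => ?_
    split_ifs with h
    · rw [h0 p q h.2.2.1.ne, mul_zero]
    · rfl

open Classical in
/-- The block-diagonal matrix whose diagonal blocks at the strips equivalent to `l` are equal to
`G` and whose other diagonal blocks are zero. -/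
noncomputable def inflate (D : ReducedData k n) (l : Fin D.t) (G : ℕ → ℕ → k) :
    Matrix (Fin n) (Fin n) k :=
  Matrix.of fun p q => if D.blk p = D.blk q ∧ D.sim (D.blk p) l then G (D.pos p) (D.pos q) else 0

open Classical in
theorem inflate_apply (l : Fin D.t) (G : ℕ → ℕ → k) (p q : Fin n) : D.inflate l G p q =
    if D.blk p = D.blk q ∧ D.sim (D.blk p) l then G (D.pos p) (D.pos q) else 0 := rfl

theorem Presents.inflate_mem (hD : D.Presents Λ) (l : Fin D.t) (G : ℕ → ℕ → k) :
    D.inflate l G ∈ Λ := by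
  classical
  refine hD.mem_of_blockDiag (fun p q h => if_neg fun h' => h h'.1) fun p q p' q' h h' hp hq => ?_
  rw [inflate_apply, inflate_apply, hp.2, hq.2]
  have : D.sim (D.blk p) l ↔ D.sim (D.blk p') l :=
    ⟨fun x => D.sim.trans (D.sim.symm hp.1) x, fun x => D.sim.trans hp.1 x⟩
  simp only [h, h', true_and]
  rw [← h, ← h']
  simp only [this]

theorem inflate_mul (l : Fin D.t) (G H : ℕ → ℕ → k) :
    D.inflate l G * D.inflate l H =
      D.inflate l fun a b => ∑ c ∈ Finset.range (D.size l), G a c * H c b := by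
  classical
  ext p q
  rw [Matrix.mul_apply, inflate_apply]
  by_cases h : D.blk p = D.blk q ∧ D.sim (D.blk p) l
  · rw [if_pos h, ← size_eq_of_sim h.2, ← sum_strip, Finset.sum_filter]
    refine Finset.sum_congr rfl fun s _ => ?_
    rw [inflate_apply, inflate_apply]
    by_cases hs : D.blk s = D.blk p
    · rw [if_pos ⟨hs.symm, h.2⟩, if_pos ⟨hs.trans h.1, hs ▸ h.2⟩, if_pos hs]
    · rw [if_neg hs, if_neg fun x => hs x.1.symm, zero_mul]
  · rw [if_neg h]
    refine Finset.sum_eq_zero fun s _ => ?_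
    rw [inflate_apply, inflate_apply]
    by_cases hs : D.blk p = D.blk s ∧ D.sim (D.blk p) l
    · rw [if_neg (c := D.blk s = D.blk q ∧ _) fun x => h ⟨hs.1.trans x.1, hs.2⟩, mul_zero]
    · rw [if_neg hs, zero_mul]

open Classical in
/-- The matrix unit of `Λ` that has entries `1` at the twins of `(p, q)`; it is meaningful if
`p` and `q` lie in the same strip. -/
noncomputable def unit (D : ReducedData k n) (p q : Fin n) : Matrix (Fin n) (Fin n) k :=
  D.inflate (D.blk p) fun a b => if a = D.pos p ∧ b = D.pos q then 1 else 0

theorem Presents.unit_mem (hD : D.Presents Λ) (p q : Fin n) : D.unit p q ∈ Λ :=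
  hD.inflate_mem _ _

open Classical in
theorem unit_apply {p q : Fin n} (h : D.blk p = D.blk q) (u v : Fin n) : D.unit p q u v =
    if D.blk u = D.blk v ∧ D.Twin u p ∧ D.Twin v q then 1 else 0 := by
  rw [unit, inflate_apply, ← ite_and]
  refine if_congr ⟨fun x => ?_, fun x => ?_⟩ rfl rfl
  · exact ⟨x.1.1, ⟨x.1.2, x.2.1⟩, by rw [← x.1.1, ← h]; exact x.1.2, x.2.2⟩
  · exact ⟨⟨x.1, x.2.1.1⟩, x.2.1.2, x.2.2.2⟩

theorem unit_mul_apply {p q : Fin n} (h : D.blk p = D.blk q) (A : Matrix (Fin n) (Fin n) k)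
    {u v q' : Fin n} (hu : D.Twin u p) (hq : D.Twin q' q) (hb : D.blk q' = D.blk u) :
    (D.unit p q * A) u v = A q' v := by
  classical
  rw [Matrix.mul_apply, Finset.sum_eq_single q']
  · rw [unit_apply h, if_pos ⟨hb.symm, hu, hq⟩, one_mul]
  · intro s _ hs
    rw [unit_apply h, if_neg, zero_mul]
    rintro ⟨h1, -, h3⟩
    exact hs ((h3.trans hq.symm).eq (h1.symm.trans hb.symm))
  · simp

theorem unit_mul_apply_of_not {p q : Fin n} (h : D.blk p = D.blk q)
    (A : Matrix (Fin n) (Fin n) k) {u v : Fin n} (hu : ¬ D.Twin u p) :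
    (D.unit p q * A) u v = 0 := by
  classical
  rw [Matrix.mul_apply]
  refine Finset.sum_eq_zero fun s _ => ?_
  rw [unit_apply h, if_neg fun x => hu x.2.1, zero_mul]

theorem mul_unit_apply {p q : Fin n} (h : D.blk p = D.blk q) (A : Matrix (Fin n) (Fin n) k)
    {u v p' : Fin n} (hv : D.Twin v q) (hp : D.Twin p' p) (hb : D.blk p' = D.blk v) :
    (A * D.unit p q) u v = A u p' := by
  classical
  rw [Matrix.mul_apply, Finset.sum_eq_single p']
  · rw [unit_apply h, if_pos ⟨hb, hp, hv⟩, mul_one]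
  · intro s _ hs
    rw [unit_apply h, if_neg, mul_zero]
    rintro ⟨h1, h2, -⟩
    exact hs ((h2.trans hp.symm).eq (h1.trans hb.symm))
  · simp

theorem mul_unit_apply_of_not {p q : Fin n} (h : D.blk p = D.blk q)
    (A : Matrix (Fin n) (Fin n) k) {u v : Fin n} (hv : ¬ D.Twin v q) :
    (A * D.unit p q) u v = 0 := by
  classical
  rw [Matrix.mul_apply]
  refine Finset.sum_eq_zero fun s _ => ?_
  rw [unit_apply h, if_neg fun x => hv x.2.2, mul_zero]

open Classical in
/-- The block `S_{ij}` with its rows and columns numbered by positions. -/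
noncomputable def posBlock (D : ReducedData k n) (S : Matrix (Fin n) (Fin n) k) (i j : Fin D.t)
    (a b : ℕ) : k :=
  ∑ p, ∑ q, if D.blk p = i ∧ D.pos p = a ∧ D.blk q = j ∧ D.pos q = b then S p q else 0

/-- A strip and a position determine an index, so at most one term of the double sum survives.
Numbering by positions turns blocks at different strips into functions of natural numbers, which can
be compared and multiplied without identifying index types. -/
theorem posBlock_pos (S : Matrix (Fin n) (Fin n) k) {i j : Fin D.t} {p q : Fin n}
    (hp : D.blk p = i) (hq : D.blk q = j) : D.posBlock S i j (D.pos p) (D.pos q) = S p q := by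
  classical
  rw [posBlock, Finset.sum_eq_single p, Finset.sum_eq_single q, if_pos ⟨hp, rfl, hq, rfl⟩]
  · intro s _ hs
    exact if_neg fun h => hs (eq_of_pos_eq (h.2.2.1.trans hq.symm) h.2.2.2)
  · simp
  · intro s _ hs
    exact Finset.sum_eq_zero fun _ _ =>
      if_neg fun h => hs (eq_of_pos_eq (h.1.trans hp.symm) h.2.1)
  · simp

theorem Presents.posBlock_eq (hD : D.Presents Λ) {S : Matrix (Fin n) (Fin n) k} (hS : S ∈ Λ)
    {i j : Fin D.t} (h : D.sim i j) {a b : ℕ} (ha : a < D.size i) (hb : b < D.size i) :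
    D.posBlock S i i a b = D.posBlock S j j a b := by
  obtain ⟨p, hp, rfl⟩ := exists_pos ha
  obtain ⟨q, hq, rfl⟩ := exists_pos hb
  obtain ⟨p', hp', hpp⟩ := D.exists_pos_eq p (hp.symm ▸ h)
  obtain ⟨q', hq', hqq⟩ := D.exists_pos_eq q (hq.symm ▸ h)
  rw [posBlock_pos S hp hq, ← hpp, ← hqq, posBlock_pos S hp' hq']
  exact hD.eq_of_twin hS (hp.trans hq.symm) (hp'.trans hq'.symm)
    ⟨by rw [hp, hp']; exact h, hpp.symm⟩ hqq.symm

theorem sum_strip_mul (A B : Matrix (Fin n) (Fin n) k) {p q : Fin n} (j : Fin D.t) :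
    ∑ s ∈ Finset.univ.filter (fun s => D.blk s = j), A p s * B s q =
      ∑ c ∈ Finset.range (D.size j), D.posBlock A (D.blk p) j (D.pos p) c *
        D.posBlock B j (D.blk q) c (D.pos q) := by
  rw [← sum_strip]
  refine Finset.sum_congr rfl fun s hs => ?_
  simp only [Finset.mem_filter, Finset.mem_univ, true_and] at hs
  rw [posBlock_pos A rfl hs, posBlock_pos B hs rfl]

end Algebra

end ReducedData

/-! ### Frames: a criterion for an algebra to be reduced. -/

section Frame

variable {k : Type*} {n : ℕ}

/-- A set of arrays is recovered from the linear equations with coefficients that vanish on it. -/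
theorem exists_equations [Field k] {t : ℕ} (V : Submodule k (Fin t → Fin t → k)) :
    ∃ (m : ℕ) (c : Fin m → Fin t → Fin t → k), ∀ v, v ∈ V ↔ ∀ u, ∑ i, ∑ j, c u i j * v i j = 0 := by
  -- The equations are generators of the annihilator of `V`; a coefficient is the value of the
  -- functional at a standard basis array. In finite dimension `V` is recovered from its
  -- annihilator.
  obtain ⟨m, f, hf⟩ := Submodule.fg_iff_exists_fin_generating_family.1
    (IsNoetherian.noetherian V.dualAnnihilator)
  have hsum : ∀ (g : Module.Dual k (Fin t → Fin t → k)) v,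
      ∑ i, ∑ j, g (Pi.single i (Pi.single j 1)) * v i j = g v := by
    intro g v
    have hv : v = ∑ i, ∑ j, v i j • (Pi.single i (Pi.single j 1) : Fin t → Fin t → k) := by
      funext a b
      simp only [Finset.sum_apply, Pi.smul_apply, smul_eq_mul]
      rw [Finset.sum_eq_single a, Finset.sum_eq_single b]
      · simp
      · intro c _ hc; simp [Pi.single_eq_of_ne hc.symm]
      · simp
      · intro c _ hc
        exact Finset.sum_eq_zero fun d _ => by simp [Pi.single_eq_of_ne hc.symm]
      · simp
    conv_rhs => rw [hv]
    simp only [map_sum, map_smul, smul_eq_mul, mul_comm]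
  refine ⟨m, fun u i j => f u (Pi.single i (Pi.single j 1)), fun v => ?_⟩
  simp only [hsum]
  constructor
  · intro hv u
    have : f u ∈ V.dualAnnihilator := hf ▸ Submodule.subset_span ⟨u, rfl⟩
    exact (Submodule.mem_dualAnnihilator _).1 this v hv
  · intro h
    refine (Subspace.forall_mem_dualAnnihilator_apply_eq_zero_iff V v).1 fun g hg => ?_
    rw [← hf] at hg
    induction hg using Submodule.span_induction with
    | mem x hx => obtain ⟨u, rfl⟩ := hx; exact h u
    | zero => rfl
    | add x y _ _ hx hy => rw [LinearMap.add_apply, hx, hy, add_zero]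
    | smul a x _ hx => rw [LinearMap.smul_apply, hx, smul_zero]

/-- A frame: a decomposition of `Fin n` into strips by a monotone map `b`, together with a
colouring `key` that is injective on strips and matches strips that share a colour. -/
structure IsFrame {L K : Type*} [LinearOrder L] (b : Fin n → L) (key : Fin n → K) : Prop where
  mono : Monotone b
  inj : ∀ p q, b p = b q → key p = key q → p = q
  transport : ∀ p q p', b p = b q → key p = key p' →
    ∃ q', b q' = b p' ∧ key q' = key q ∧ (q < p → q' < p')

namespace IsFrame

variable {t : ℕ} {K : Type*} {b : Fin n → Fin t} {key : Fin n → K}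

/-- Two strips are equivalent if they share a colour. -/
def setoid (h : IsFrame b key) : Setoid (Fin t) where
  r i j := i = j ∨ ∃ p q, b p = i ∧ b q = j ∧ key p = key q
  iseqv := by
    refine ⟨fun i => Or.inl rfl, ?_, ?_⟩
    · rintro i j (rfl | ⟨p, q, hp, hq, hpq⟩)
      · exact Or.inl rfl
      · exact Or.inr ⟨q, p, hq, hp, hpq.symm⟩
    · rintro i j l (rfl | ⟨p, q, rfl, rfl, hpq⟩) (rfl | ⟨p', q', hp', rfl, hpq'⟩)
      · exact Or.inl rfl
      · exact Or.inr ⟨p', q', hp', rfl, hpq'⟩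
      · exact Or.inr ⟨p, q, rfl, rfl, hpq⟩
      · obtain ⟨r, hr, hr', -⟩ := h.transport q p' p hp'.symm hpq.symm
        exact Or.inr ⟨r, q', hr, rfl, hr'.trans hpq'⟩

/-- `transport` sends the strip of `p` into that of `q` and keeps colours, which tell apart the
indices of one strip; so it is injective. -/
theorem card_strip_le (h : IsFrame b key) {p q : Fin n} (hpq : key p = key q) :
    (Finset.univ.filter fun s => b s = b p).card ≤ (Finset.univ.filter fun s => b s = b q).card := by
  have := fun s (hs : b s = b p) => h.transport p s q hs.symm hpq
  choose f hf using this
  refine Finset.card_le_card_of_injOn (fun s => if hs : b s = b p then f s hs else s) ?_ ?_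
  · intro s hs
    have hs : b s = b p := by simpa using hs
    simpa [hs] using (hf s hs).1
  · intro s hs s' hs' hss
    have hs : b s = b p := by simpa using hs
    have hs' : b s' = b p := by simpa using hs'
    simp only [hs, hs', dif_pos] at hss
    refine h.inj s s' (hs.trans hs'.symm) ?_
    rw [← (hf s hs).2.1, ← (hf s' hs').2.1, hss]

/-- The order clause of `transport` keeps indices below `p` below `q`. Applied in both directions,
this gives indices of equal colour equal positions. -/
theorem card_below_le (h : IsFrame b key) {p q : Fin n} (hpq : key p = key q) :
    (Finset.univ.filter fun s => b s = b p ∧ s < p).card ≤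
      (Finset.univ.filter fun s => b s = b q ∧ s < q).card := by
  have := fun s (hs : b s = b p) => h.transport p s q hs.symm hpq
  choose f hf using this
  refine Finset.card_le_card_of_injOn (fun s => if hs : b s = b p then f s hs else s) ?_ ?_
  · intro s hs
    have hs : b s = b p ∧ s < p := by simpa using hs
    simpa [hs.1] using And.intro (hf s hs.1).1 ((hf s hs.1).2.2 hs.2)
  · intro s hs s' hs' hss
    have hs : b s = b p ∧ s < p := by simpa using hs
    have hs' : b s' = b p ∧ s' < p := by simpa using hs'
    simp only [hs.1, hs'.1, dif_pos] at hss
    refine h.inj s s' (hs.1.trans hs'.1.symm) ?_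
    rw [← (hf s hs.1).2.1, ← (hf s' hs'.1).2.1, hss]

/-- The reduced data with the strips of a frame and given equations. -/
def data (h : IsFrame b key) (numEq : Quotient h.setoid → Quotient h.setoid → ℕ)
    (coeff : (I J : Quotient h.setoid) → Fin (numEq I J) → Fin t → Fin t → k) :
    ReducedData k n where
  t := t
  blk := b
  blk_mono := h.mono
  sim := h.setoid
  size_eq := by
    rintro i j (rfl | ⟨p, q, rfl, rfl, hpq⟩)
    · rfl
    · exact le_antisymm (h.card_strip_le hpq) (h.card_strip_le hpq.symm)
  numEq := numEq
  coeff := coeff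

/-- Transport preserves positions, and a strip has one index in each position; so twins of the
resulting data are the same thing as equal colours. -/
theorem twin_iff (h : IsFrame b key) (numEq : Quotient h.setoid → Quotient h.setoid → ℕ)
    (coeff : (I J : Quotient h.setoid) → Fin (numEq I J) → Fin t → Fin t → k) (p q : Fin n) :
    (h.data numEq coeff).Twin p q ↔ key p = key q := by
  have hpos : ∀ p q, key p = key q → (h.data numEq coeff).pos p = (h.data numEq coeff).pos q :=
    fun p q hpq => le_antisymm (h.card_below_le hpq) (h.card_below_le hpq.symm)
  constructor
  · rintro ⟨hs | ⟨u, v, hu, hv, huv⟩, hp⟩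
    · exact congrArg key (ReducedData.eq_of_pos_eq hs hp)
    · obtain ⟨p', h1, h2, -⟩ := h.transport u p v hu huv
      rw [← h2]
      refine congrArg key (ReducedData.eq_of_pos_eq (D := h.data numEq coeff) (h1.trans hv) ?_)
      rw [hpos _ _ h2, hp]
  · exact fun hpq => ⟨Or.inr ⟨p, q, rfl, rfl, hpq⟩, hpos p q hpq⟩

variable [Field k]

open Classical in
/-- The entries of a matrix over the pair of colours of `p`, `q`, as an array indexed by strips. -/
noncomputable def slice (_ : IsFrame b key) (S : Matrix (Fin n) (Fin n) k) (p q : Fin n) :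
    Fin t → Fin t → k := fun i j =>
  ∑ p', ∑ q', if key p' = key p ∧ key q' = key q ∧ b p' = i ∧ b q' = j ∧ i < j then S p' q' else 0

open Classical in
/-- The matrix with a given slice over the pair of colours of `p`, `q`. -/
noncomputable def place (_ : IsFrame b key) (p q : Fin n) :
    (Fin t → Fin t → k) →ₗ[k] Matrix (Fin n) (Fin n) k where
  toFun v := Matrix.of fun p' q' =>
    if key p' = key p ∧ key q' = key q ∧ b p' < b q' then v (b p') (b q') else 0
  map_add' v w := by
    ext p' q'
    simp only [Matrix.of_apply, Matrix.add_apply, Pi.add_apply]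
    split_ifs <;> simp
  map_smul' a v := by
    ext p' q'
    simp only [Matrix.of_apply, Matrix.smul_apply, Pi.smul_apply, RingHom.id_apply]
    split_ifs <;> simp

open Classical in
theorem place_apply (h : IsFrame b key) (p q : Fin n) (v : Fin t → Fin t → k) (p' q' : Fin n) :
    h.place p q v p' q' =
      if key p' = key p ∧ key q' = key q ∧ b p' < b q' then v (b p') (b q') else 0 := rfl

theorem slice_apply (h : IsFrame b key) (S : Matrix (Fin n) (Fin n) k) {p q p' q' : Fin n}
    (hp : key p' = key p) (hq : key q' = key q) (hlt : b p' < b q') :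
    h.slice S p q (b p') (b q') = S p' q' := by
  classical
  rw [slice, Finset.sum_eq_single p', Finset.sum_eq_single q', if_pos ⟨hp, hq, rfl, rfl, hlt⟩]
  · intro s _ hs
    exact if_neg fun x => hs (h.inj _ _ x.2.2.2.1 (x.2.1.trans hq.symm))
  · simp
  · intro s _ hs
    exact Finset.sum_eq_zero fun _ _ =>
      if_neg fun x => hs (h.inj _ _ x.2.2.1 (x.1.trans hp.symm))
  · simp

/-- An equation of `SatisfiesEqs`, read at one pair of positions, thereby becomes a linear equation
on a slice. -/
theorem sum_coeff_mul_slice (h : IsFrame b key) (c : Fin t → Fin t → k)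
    (S : Matrix (Fin n) (Fin n) k) (p q : Fin n) [∀ p' q', Decidable (key p' = key p ∧ key q' = key q ∧ b p' < b q')] :
    ∑ i, ∑ j, c i j * h.slice S p q i j = ∑ p', ∑ q',
      if key p' = key p ∧ key q' = key q ∧ b p' < b q' then c (b p') (b q') * S p' q' else 0 := by
  classical
  simp only [slice, Finset.mul_sum]
  have e1 : ∀ i : Fin t, (∑ j, ∑ p', ∑ q', c i j * (if key p' = key p ∧ key q' = key q ∧ b p' = i ∧
      b q' = j ∧ i < j then S p' q' else 0)) = ∑ p', ∑ q', ∑ j, c i j * (if key p' = key p ∧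
      key q' = key q ∧ b p' = i ∧ b q' = j ∧ i < j then S p' q' else 0) := fun i => by
    rw [Finset.sum_comm]
    exact Finset.sum_congr rfl fun p' _ => Finset.sum_comm
  simp only [e1]
  rw [Finset.sum_comm]
  refine Finset.sum_congr rfl fun p' _ => ?_
  rw [Finset.sum_comm]
  refine Finset.sum_congr rfl fun q' _ => ?_
  rw [Finset.sum_eq_single (b p'), Finset.sum_eq_single (b q')]
  · by_cases hh : key p' = key p ∧ key q' = key q ∧ b p' < b q'
    · rw [if_pos hh, if_pos ⟨hh.1, hh.2.1, rfl, rfl, hh.2.2⟩]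
    · rw [if_neg hh, if_neg fun x => hh ⟨x.1, x.2.1, x.2.2.2.2⟩, mul_zero]
  · intro j _ hj
    rw [if_neg fun x => hj x.2.2.2.1.symm, mul_zero]
  · simp
  · intro i _ hi
    exact Finset.sum_eq_zero fun j _ => by rw [if_neg fun x => hi x.2.2.1.symm, mul_zero]
  · simp

end IsFrame

/-- An algebra that respects a frame: its matrices are upper block-triangular with equal diagonal
blocks at matching strips, and it contains all block-diagonal matrices of this form. -/
structure IsFrame.Carries [Field k] {L K : Type*} [LinearOrder L] (b : Fin n → L) (key : Fin n → K)
    (Λ : Subalgebra k (Matrix (Fin n) (Fin n) k)) : Prop where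
  tri : ∀ S ∈ Λ, ∀ p q, b q < b p → S p q = 0
  const : ∀ S ∈ Λ, ∀ p q p' q', b p = b q → b p' = b q' → key p = key p' → key q = key q' →
    S p q = S p' q'
  mem : ∀ S : Matrix (Fin n) (Fin n) k, (∀ p q, b p ≠ b q → S p q = 0) →
    (∀ p q p' q', b p = b q → b p' = b q' → key p = key p' → key q = key q' → S p q = S p' q') →
    S ∈ Λ

namespace IsFrame

variable [Field k] {t : ℕ} {K : Type*} {b : Fin n → Fin t} {key : Fin n → K}
  {Λ : Subalgebra k (Matrix (Fin n) (Fin n) k)}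

open Classical in
/-- The part of a matrix above the diagonal blocks. -/
noncomputable def strict (b : Fin n → Fin t) (S : Matrix (Fin n) (Fin n) k) :
    Matrix (Fin n) (Fin n) k :=
  Matrix.of fun p q => if b p < b q then S p q else 0

theorem Carries.diag_mem (hΛ : Carries b key Λ) {S : Matrix (Fin n) (Fin n) k}
    (hc : ∀ p q p' q', b p = b q → b p' = b q' → key p = key p' → key q = key q' →
      S p q = S p' q') :
    (Matrix.of fun p q => if b p = b q then S p q else 0) ∈ Λ := by
  refine hΛ.mem _ (fun p q hpq => if_neg hpq) fun p q p' q' h1 h2 h3 h4 => ?_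
  rw [Matrix.of_apply, Matrix.of_apply, if_pos h1, if_pos h2, hc p q p' q' h1 h2 h3 h4]

theorem eq_diag_add_strict {S : Matrix (Fin n) (Fin n) k} (ht : ∀ p q, b q < b p → S p q = 0) :
    S = (Matrix.of fun p q => if b p = b q then S p q else 0) + strict b S := by
  ext p q
  rw [Matrix.add_apply, strict, Matrix.of_apply, Matrix.of_apply]
  rcases lt_trichotomy (b p) (b q) with h | h | h
  · rw [if_neg h.ne, if_pos h, zero_add]
  · rw [if_pos h, if_neg h.not_lt, add_zero]
  · rw [if_neg h.ne', if_neg h.not_gt, ht p q h, add_zero]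

theorem Carries.strict_mem (hΛ : Carries b key Λ) {S : Matrix (Fin n) (Fin n) k} (hS : S ∈ Λ) :
    strict b S ∈ Λ := by
  have := Λ.sub_mem hS (hΛ.diag_mem (hΛ.const S hS))
  rwa [sub_eq_of_eq_add' (eq_diag_add_strict (hΛ.tri S hS))] at this

/-- Multiplication on both sides by the block-diagonal matrix units `P` isolates the entries over
one pair of colours and moves them to another pair without leaving their strips. This is why one
system of equations can serve all positions of a pair of classes. -/
theorem Carries.place_slice_mem (h : IsFrame b key) (hΛ : Carries b key Λ)
    {S : Matrix (Fin n) (Fin n) k} (hS : S ∈ Λ) (p₀ q₀ p₁ q₁ : Fin n) :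
    h.place p₀ q₀ (h.slice S p₁ q₁) ∈ Λ := by
  classical
  let P : Fin n → Fin n → Matrix (Fin n) (Fin n) k := fun u v => Matrix.of fun p q =>
    if b p = b q ∧ key p = key u ∧ key q = key v then 1 else 0
  have hP : ∀ u v, P u v ∈ Λ := fun u v => by
    refine hΛ.mem _ (fun p q hpq => if_neg fun x => hpq x.1) fun p q p' q' h1 h2 h3 h4 => ?_
    simp only [P, Matrix.of_apply, h1, h2, h3, h4, true_and]
  have hmem := Λ.mul_mem (Λ.mul_mem (hP p₀ p₁) (hΛ.strict_mem hS)) (hP q₁ q₀)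
  convert hmem
  ext p q
  rw [place_apply, Matrix.mul_apply]
  simp only [Matrix.mul_apply, Finset.sum_mul]
  rw [Finset.sum_comm]
  by_cases hpq : key p = key p₀ ∧ key q = key q₀ ∧ b p < b q
  · rw [if_pos hpq, slice]
    refine Finset.sum_congr rfl fun p' _ => Finset.sum_congr rfl fun q' _ => ?_
    simp only [P, Matrix.of_apply, strict, hpq.1, hpq.2.1, true_and, and_true]
    by_cases hh : key p' = key p₁ ∧ key q' = key q₁ ∧ b p' = b p ∧ b q' = b q ∧ b p < b q
    · rw [if_pos hh, if_pos ⟨hh.2.2.1.symm, hh.1⟩, if_pos (by rw [hh.2.2.1, hh.2.2.2.1]; exact hpq.2.2),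
        if_pos ⟨hh.2.2.2.1, hh.2.1⟩, one_mul, mul_one]
    · rw [if_neg hh]
      symm
      by_cases h1 : b p = b p' ∧ key p' = key p₁
      · rw [if_neg (c := b q' = b q ∧ _) fun x => hh ⟨h1.2, x.2, h1.1.symm, x.1, hpq.2.2⟩, mul_zero]
      · rw [if_neg h1, zero_mul, zero_mul]
  · rw [if_neg hpq]
    symm
    refine Finset.sum_eq_zero fun p' _ => Finset.sum_eq_zero fun q' _ => ?_
    simp only [P, Matrix.of_apply, strict]
    by_cases h1 : b p = b p' ∧ key p = key p₀ ∧ key p' = key p₁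
    · by_cases h2 : b q' = b q ∧ key q' = key q₁ ∧ key q = key q₀
      · rw [if_neg (c := b p' < b q') fun x => hpq ⟨h1.2.1, h2.2.2, by rwa [h1.1, ← h2.1]⟩]
        simp
      · rw [if_neg h2, mul_zero]
    · rw [if_neg h1, zero_mul, zero_mul]

theorem strict_mem_of_slice (h : IsFrame b key) {S : Matrix (Fin n) (Fin n) k}
    (hS : ∀ p₀ q₀, h.place p₀ q₀ (h.slice S p₀ q₀) ∈ Λ) : strict b S ∈ Λ := by
  classical
  -- `ρ` chooses one representative of each colour, so that every pair of colours occurs once in the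
  -- sum below.
  obtain ⟨ρ, hρ⟩ : ∃ ρ : Fin n → Fin n, ∀ p q, key p = key q ↔ key q = key (ρ p) ∧ ρ p = ρ q := by
    have hex : ∀ x : Set.range key, ∃ p, key p = x := fun x => x.2
    choose f hf using hex
    refine ⟨fun p => f ⟨key p, p, rfl⟩, fun p q => ⟨fun hpq => ⟨?_, ?_⟩, fun hpq => ?_⟩⟩
    · exact ((hf _).trans hpq).symm
    · simp only [hpq]
    · rw [hpq.1, hf]
  have key_rep : ∀ p, key p = key (ρ p) := fun p => ((hρ p p).1 rfl).1
  have hsum : strict b S = ∑ p₀ ∈ Finset.univ.image ρ, ∑ q₀ ∈ Finset.univ.image ρ,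
      h.place p₀ q₀ (h.slice S p₀ q₀) := by
    ext p q
    have hrep : ∀ p, ∀ p₀ ∈ Finset.univ.image ρ, p₀ ≠ ρ p → key p ≠ key p₀ := by
      intro p p₀ hp₀ hne hk
      simp only [Finset.mem_image, Finset.mem_univ, true_and] at hp₀
      obtain ⟨p₁, rfl⟩ := hp₀
      rw [← key_rep] at hk
      exact hne ((hρ p p₁).1 hk).2.symm
    simp only [Matrix.sum_apply]
    rw [Finset.sum_eq_single (ρ p), Finset.sum_eq_single (ρ q)]
    · rw [place_apply, strict, Matrix.of_apply]
      simp only [← key_rep, true_and]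
      split_ifs with hlt
      · rw [h.slice_apply S (key_rep p) (key_rep q) hlt]
      · rfl
    · intro q₀ hq₀ hne
      rw [place_apply, if_neg fun x => hrep q q₀ hq₀ hne x.2.1]
    · simp
    · intro p₀ hp₀ hne
      refine Finset.sum_eq_zero fun q₀ _ => ?_
      rw [place_apply, if_neg fun x => hrep p p₀ hp₀ hne x.1]
    · simp
  rw [hsum]
  exact Λ.sum_mem fun p₀ _ => Λ.sum_mem fun q₀ _ => hS p₀ q₀

/-- For each pair of classes the equations are those of the span of all slices of matrices of Λ,
over all positions. Conversely, a matrix that satisfies them is its block-diagonal part, which lies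
in Λ by `mem`, plus a sum of placed slices, each of which lies in Λ by `place_slice_mem`. -/
theorem isReducedAlgebra_of_fin (h : IsFrame b key) (hΛ : Carries b key Λ) :
    IsReducedAlgebra Λ := by
  classical
  let V : Quotient h.setoid → Quotient h.setoid → Submodule k (Fin t → Fin t → k) := fun I J =>
    Submodule.span k {v | ∃ S ∈ Λ, ∃ p q : Fin n, Quotient.mk h.setoid (b p) = I ∧
      Quotient.mk h.setoid (b q) = J ∧ v = h.slice S p q}
  choose m c hc using fun I J => exists_equations (V I J)
  let D := h.data m c
  have hV : ∀ (p₀ q₀ : Fin n) v, v ∈ V (Quotient.mk h.setoid (b p₀)) (Quotient.mk h.setoid (b q₀)) →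
      h.place p₀ q₀ v ∈ Λ := by
    intro p₀ q₀ v hv
    induction hv using Submodule.span_induction with
    | mem x hx =>
      obtain ⟨S, hS, p, q, -, -, rfl⟩ := hx
      exact hΛ.place_slice_mem h hS p₀ q₀ p q
    | zero => rw [map_zero]; exact Λ.zero_mem
    | add x y _ _ hx hy => rw [map_add]; exact Λ.add_mem hx hy
    | smul a x _ hx => rw [map_smul]; exact Λ.smul_mem hx a
  have hcond : ∀ (p₀ q₀ p q : Fin n),
      (D.cls (D.blk p) = D.cls (D.blk p₀) ∧ D.cls (D.blk q) = D.cls (D.blk q₀) ∧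
        D.blk p < D.blk q ∧ D.pos p = D.pos p₀ ∧ D.pos q = D.pos q₀) ↔
      (key p = key p₀ ∧ key q = key q₀ ∧ b p < b q) := by
    intro p₀ q₀ p q
    rw [← h.twin_iff m c p p₀, ← h.twin_iff m c q q₀]
    constructor
    · rintro ⟨h1, h2, h3, h4, h5⟩
      exact ⟨⟨Quotient.exact h1, h4⟩, ⟨Quotient.exact h2, h5⟩, h3⟩
    · rintro ⟨h1, h2, h3⟩
      exact ⟨Quotient.sound h1.1, Quotient.sound h2.1, h3, h1.2, h2.2⟩
  refine ⟨D, fun S => ⟨fun hS => ⟨hΛ.tri S hS, ?_, ?_⟩, ?_⟩⟩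
  · intro p q p' q' hpq hpq' hs hp hq
    refine hΛ.const S hS p q p' q' hpq hpq' ((h.twin_iff m c p p').1 ⟨hs, hp⟩)
      ((h.twin_iff m c q q').1 ⟨?_, hq⟩)
    change D.sim (D.blk q) (D.blk q')
    rw [show D.blk q = D.blk p from hpq.symm, show D.blk q' = D.blk p' from hpq'.symm]
    exact hs
  · intro I J u a a'
    by_cases hex : ∃ p₀ q₀ : Fin n, D.cls (D.blk p₀) = I ∧ D.cls (D.blk q₀) = J ∧ D.pos p₀ = a ∧
        D.pos q₀ = a'
    · obtain ⟨p₀, q₀, rfl, rfl, rfl, rfl⟩ := hex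
      simp only [hcond]
      change Fin (m _ _) at u
      have := (hc _ _ (h.slice S p₀ q₀)).1
        (Submodule.subset_span ⟨S, hS, p₀, q₀, rfl, rfl, rfl⟩) u
      rw [h.sum_coeff_mul_slice] at this
      exact this
    · refine Finset.sum_eq_zero fun p _ => Finset.sum_eq_zero fun q _ => if_neg fun x => hex ?_
      exact ⟨p, q, x.1, x.2.1, x.2.2.2.1, x.2.2.2.2⟩
  · rintro ⟨h1, h2, h3⟩
    rw [eq_diag_add_strict (b := b) h1]
    refine Λ.add_mem (hΛ.diag_mem ?_) (strict_mem_of_slice h fun p₀ q₀ => hV _ _ _ ?_)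
    · intro p q p' q' hpq hpq' hp hq
      exact h2 p q p' q' hpq hpq' ((h.twin_iff m c p p').2 hp).1 ((h.twin_iff m c p p').2 hp).2
        ((h.twin_iff m c q q').2 hq).2
    · refine (hc _ _ _).2 fun u => ?_
      rw [h.sum_coeff_mul_slice]
      have := h3 (D.cls (D.blk p₀)) (D.cls (D.blk q₀)) u (D.pos p₀) (D.pos q₀)
      simp only [hcond] at this
      exact this

end IsFrame

variable [Field k] {L K : Type*} [LinearOrder L] {b : Fin n → L} {key : Fin n → K}
  {Λ : Subalgebra k (Matrix (Fin n) (Fin n) k)}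

/-- Only the order of the nonempty strips matters: a strip is renumbered by the count of indices in
lower strips. The freedom in `L` allows lexicographic refinements of strips. -/
theorem IsFrame.isReducedAlgebra (h : IsFrame b key) (hΛ : IsFrame.Carries b key Λ) :
    IsReducedAlgebra Λ := by
  have hlt : ∀ p, (Finset.univ.filter fun q => b q < b p).card < n := fun p => by
    conv_rhs => rw [← Finset.card_fin n]
    exact Finset.card_lt_card ((Finset.ssubset_iff_of_subset (Finset.filter_subset _ _)).2
      ⟨p, Finset.mem_univ p, by simp⟩)
  let b' : Fin n → Fin n := fun p => ⟨(Finset.univ.filter fun q => b q < b p).card, hlt p⟩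
  have hb : ∀ p q, b p < b q → b' p < b' q := by
    intro p q hpq
    change (Finset.univ.filter fun s => b s < b p).card < (Finset.univ.filter fun s => b s < b q).card
    refine Finset.card_lt_card ((Finset.ssubset_iff_of_subset fun s hs => ?_).2 ⟨p, ?_, ?_⟩)
    · simp only [Finset.mem_filter, Finset.mem_univ, true_and] at hs ⊢
      exact hs.trans hpq
    · simpa using hpq
    · simp
  have heq : ∀ p q, b' p = b' q ↔ b p = b q := by
    intro p q
    refine ⟨fun hpq => ?_, fun hpq => by simp only [b', hpq]⟩
    rcases lt_trichotomy (b p) (b q) with h' | h' | h'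
    · exact absurd hpq (hb p q h').ne
    · exact h'
    · exact absurd hpq (hb q p h').ne'
  have hlt' : ∀ p q, b' p < b' q → b p < b q := by
    intro p q hpq
    rcases lt_trichotomy (b p) (b q) with h' | h' | h'
    · exact h'
    · exact absurd ((heq p q).2 h') hpq.ne
    · exact absurd (hb q p h') hpq.not_gt
  have h' : IsFrame b' key := by
    refine ⟨fun p q hpq => ?_, fun p q hpq hk => h.inj p q ((heq p q).1 hpq) hk, ?_⟩
    · rcases (h.mono hpq).lt_or_eq with h1 | h1
      · exact (hb p q h1).le
      · exact ((heq p q).2 h1).le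
    · intro p q p' hpq hk
      obtain ⟨q', h1, h2⟩ := h.transport p q p' ((heq p q).1 hpq) hk
      exact ⟨q', (heq _ _).2 h1, h2⟩
  refine h'.isReducedAlgebra_of_fin ⟨fun S hS p q hpq => hΛ.tri S hS p q (hlt' q p hpq), ?_, ?_⟩
  · intro S hS p q p' q' h1 h2
    exact hΛ.const S hS p q p' q' ((heq _ _).1 h1) ((heq _ _).1 h2)
  · intro S h0 h1
    refine hΛ.mem S (fun p q hpq => h0 p q (mt (heq _ _).1 hpq)) fun p q p' q' h2 h3 => ?_
    exact h1 p q p' q' ((heq _ _).2 h2) ((heq _ _).2 h3)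

end Frame

/-! ### Stability as a linear condition on the algebra. -/

theorem Subalgebra.matrix_inv_mem {k : Type*} [Field k] {n : ℕ}
    (Λ : Subalgebra k (Matrix (Fin n) (Fin n) k)) {S : Matrix (Fin n) (Fin n) k} (hS : S ∈ Λ)
    (hu : IsUnit S) : S⁻¹ ∈ Λ := by
  -- Left multiplication by `S` is injective on the finite-dimensional space Λ, hence onto, and
  -- reaches 1.
  have hinj : Function.Injective (LinearMap.mulLeft k (⟨S, hS⟩ : Λ)) := by
    intro x y hxy
    have : S * (x : Matrix (Fin n) (Fin n) k) = S * y := congrArg Subtype.val hxy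
    exact Subtype.ext (hu.mul_left_cancel this)
  obtain ⟨T, hT⟩ := LinearMap.surjective_of_injective hinj 1
  have hT' : S * (T : Matrix (Fin n) (Fin n) k) = 1 := congrArg Subtype.val hT
  rw [Matrix.inv_eq_right_inv hT']
  exact T.2

/-- It suffices that `c` avoids the finitely many eigenvalues of `-X`. This extends conditions on
the nonsingular matrices of Λ to all of Λ. -/
theorem Matrix.exists_isUnit_add_smul_one {k : Type*} [Field k] [Infinite k] {n : ℕ}
    (X : Matrix (Fin n) (Fin n) k) : ∃ c : k, IsUnit (X + c • (1 : Matrix (Fin n) (Fin n) k)) := by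
  classical
  obtain ⟨c, hc⟩ := Infinite.exists_notMem_finset (-X).charpoly.roots.toFinset
  refine ⟨c, ?_⟩
  rw [Multiset.mem_toFinset, Polynomial.mem_roots (Matrix.charpoly_monic _).ne_zero,
    Polynomial.IsRoot, Matrix.eval_charpoly, sub_neg_eq_add, add_comm] at hc
  rw [Matrix.isUnit_iff_isUnit_det, isUnit_iff_ne_zero]
  rwa [Matrix.scalar_apply, ← Matrix.smul_one_eq_diagonal] at hc

namespace ReducedData

section Places

variable {k : Type*} {n : ℕ} {D : ReducedData k n}

/-- A set of places that contains with each place all those in lower or more left blocks. -/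
def IsLower (D : ReducedData k n) (Q : Fin n → Fin n → Prop) : Prop :=
  ∀ p q p' q', Q p q → D.blk p ≤ D.blk p' → D.blk q' ≤ D.blk q → Q p' q'

/-- The places in the blocks up to `(l, r)`. -/
def Upto (D : ReducedData k n) (l r : Fin D.t) (p q : Fin n) : Prop :=
  l < D.blk p ∨ (D.blk p = l ∧ D.blk q ≤ r)

/-- The places in the blocks before `(l, r)`. -/
def Earlier (D : ReducedData k n) (l r : Fin D.t) (p q : Fin n) : Prop :=
  l < D.blk p ∨ (D.blk p = l ∧ D.blk q < r)

theorem isLower_upto (l r : Fin D.t) : D.IsLower (D.Upto l r) := by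
  rintro p q p' q' (h | ⟨rfl, h⟩) h1 h2
  · exact Or.inl (h.trans_le h1)
  · rcases h1.lt_or_eq with h1 | h1
    · exact Or.inl h1
    · exact Or.inr ⟨h1.symm, h2.trans h⟩

theorem isLower_earlier (l r : Fin D.t) : D.IsLower (D.Earlier l r) := by
  rintro p q p' q' (h | ⟨rfl, h⟩) h1 h2
  · exact Or.inl (h.trans_le h1)
  · rcases h1.lt_or_eq with h1 | h1
    · exact Or.inl h1
    · exact Or.inr ⟨h1.symm, h2.trans_lt h⟩

theorem upto_iff {l r : Fin D.t} {p q : Fin n} :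
    D.Upto l r p q ↔ D.Earlier l r p q ∨ (D.blk p = l ∧ D.blk q = r) := by
  unfold Upto Earlier
  rw [le_iff_lt_or_eq]
  tauto

end Places

variable {k : Type*} [Field k] {n : ℕ} {D : ReducedData k n}
  {Λ : Subalgebra k (Matrix (Fin n) (Fin n) k)}

/-- `X M` and `M X` have equal entries on `Q` for every `X ∈ Λ`. -/
def CommOn (Λ : Subalgebra k (Matrix (Fin n) (Fin n) k)) (M : Matrix (Fin n) (Fin n) k)
    (Q : Fin n → Fin n → Prop) : Prop :=
  ∀ X ∈ Λ, ∀ p q, Q p q → (X * M) p q = (M * X) p q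

/-- As `X` is upper block-triangular, an entry of `X * A` involves only entries of `A` in the same
column and in the same or lower strips. The next lemma is the mirror statement for columns. -/
theorem Presents.mul_apply_congr (hD : D.Presents Λ) {Q : Fin n → Fin n → Prop} (hQ : D.IsLower Q)
    {X A B : Matrix (Fin n) (Fin n) k} (hX : X ∈ Λ) (h : ∀ p q, Q p q → A p q = B p q)
    {p q : Fin n} (hpq : Q p q) : (X * A) p q = (X * B) p q := by
  rw [Matrix.mul_apply, Matrix.mul_apply]
  refine Finset.sum_congr rfl fun s _ => ?_
  by_cases hs : D.blk s < D.blk p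
  · rw [hD.tri hX hs, zero_mul, zero_mul]
  · rw [h s q (hQ p q s q hpq (not_lt.1 hs) le_rfl)]

theorem Presents.apply_mul_congr (hD : D.Presents Λ) {Q : Fin n → Fin n → Prop} (hQ : D.IsLower Q)
    {X A B : Matrix (Fin n) (Fin n) k} (hX : X ∈ Λ) (h : ∀ p q, Q p q → A p q = B p q)
    {p q : Fin n} (hpq : Q p q) : (A * X) p q = (B * X) p q := by
  rw [Matrix.mul_apply, Matrix.mul_apply]
  refine Finset.sum_congr rfl fun s _ => ?_
  by_cases hs : D.blk q < D.blk s
  · rw [hD.tri hX hs, mul_zero, mul_zero]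
  · rw [h p s (hQ p q p s hpq le_rfl (not_lt.1 hs))]

/-- Commutation on a lower set of places means stability of the entries there. -/
theorem Presents.commOn_iff [Infinite k] (hD : D.Presents Λ) {Q : Fin n → Fin n → Prop}
    (hQ : D.IsLower Q) (M : Matrix (Fin n) (Fin n) k) :
    CommOn Λ M Q ↔ ∀ S ∈ Λ, IsUnit S → ∀ p q, Q p q → (S⁻¹ * M * S) p q = M p q := by
  constructor
  · intro h S hS hu p q hpq
    -- In S⁻¹ (M S) the factor M S may be replaced on `Q` by S M.
    rw [mul_assoc, hD.mul_apply_congr hQ (Λ.matrix_inv_mem hS hu)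
      (fun p q hpq => (h S hS p q hpq).symm) hpq, ← mul_assoc,
      Matrix.nonsing_inv_mul _ ((Matrix.isUnit_iff_isUnit_det _).1 hu), one_mul]
  · intro h X hX p q hpq
    -- `X` plus a suitable scalar matrix is nonsingular in Λ, and scalar matrices commute with `M`.
    obtain ⟨c, hc⟩ := X.exists_isUnit_add_smul_one
    have hmem : X + c • (1 : Matrix (Fin n) (Fin n) k) ∈ Λ :=
      Λ.add_mem hX (Λ.smul_mem Λ.one_mem c)
    have := hD.mul_apply_congr hQ hmem (h _ hmem hc) hpq
    rw [← mul_assoc, ← mul_assoc, Matrix.mul_nonsing_inv _ ((Matrix.isUnit_iff_isUnit_det _).1 hc),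
      one_mul] at this
    simpa [add_mul, mul_add] using this.symm

theorem CommOn.conj [Infinite k] (hD : D.Presents Λ) {Q : Fin n → Fin n → Prop} (hQ : D.IsLower Q)
    {M : Matrix (Fin n) (Fin n) k} (h : CommOn Λ M Q) {S : Matrix (Fin n) (Fin n) k} (hS : S ∈ Λ)
    (hu : IsUnit S) : CommOn Λ (S⁻¹ * M * S) Q := by
  rw [hD.commOn_iff hQ] at h ⊢
  intro T hT huT p q hpq
  rw [h S hS hu p q hpq, ← h (S * T) (Λ.mul_mem hS hT) (hu.mul huT) p q hpq, Matrix.mul_inv_rev]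
  simp only [mul_assoc]

/-- This form mentions Λ linearly and the strips only through their order, so it can be carried over
to other data and to similar matrices. -/
theorem Presents.firstNonstable_iff [Infinite k] (hD : D.Presents Λ)
    {M : Matrix (Fin n) (Fin n) k} {l r : Fin D.t} :
    D.FirstNonstable Λ M l r ↔
      CommOn Λ M (D.Earlier l r) ∧ ¬ CommOn Λ M (D.Upto l r) := by
  have h1 : (∀ i j, D.Before i j l r → D.Stable Λ M i j) ↔ CommOn Λ M (D.Earlier l r) := by
    rw [hD.commOn_iff (isLower_earlier l r)]
    constructor
    · intro h S hS hu p q hpq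
      exact congrFun (congrFun (h (D.blk p) (D.blk q) hpq S hS hu) ⟨p, rfl⟩) ⟨q, rfl⟩
    · intro h i j hij S hS hu
      ext ⟨p, rfl⟩ ⟨q, rfl⟩
      exact h S hS hu p q hij
  rw [FirstNonstable, and_comm, h1]
  refine and_congr_right fun hE => not_congr ?_
  rw [hD.commOn_iff (isLower_upto l r)]
  constructor
  · intro h S hS hu p q hpq
    rcases upto_iff.1 hpq with hpq | ⟨rfl, rfl⟩
    · exact (hD.commOn_iff (isLower_earlier l r) M).1 hE S hS hu p q hpq
    · exact congrFun (congrFun (h S hS hu) ⟨p, rfl⟩) ⟨q, rfl⟩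
  · intro h S hS hu
    ext ⟨p, rfl⟩ ⟨q, rfl⟩
    exact h S hS hu p q (Or.inr ⟨rfl, le_rfl⟩)

theorem exists_firstNonstable {M : Matrix (Fin n) (Fin n) k} (h : ¬ BelitskiiStops (M, Λ)) :
    ∃ l r, D.FirstNonstable Λ M l r := by
  classical
  have hex : ∃ x : Fin D.t × Fin D.t, ¬ D.Stable Λ M x.1 x.2 := by
    by_contra hn
    push Not at hn
    refine h fun S hS hu => Matrix.ext fun p q => ?_
    exact congrFun (congrFun (hn (D.blk p, D.blk q) S hS hu) ⟨p, rfl⟩) ⟨q, rfl⟩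
  -- The order of blocks is lexicographic with the rows reversed, hence `OrderDual`.
  obtain ⟨x, hx, hmin⟩ := (Finset.univ.filter fun x : Fin D.t × Fin D.t =>
    ¬ D.Stable Λ M x.1 x.2).exists_min_image (fun x => toLex (OrderDual.toDual x.1, x.2))
    (by obtain ⟨x, hx⟩ := hex; exact ⟨x, by simpa using hx⟩)
  refine ⟨x.1, x.2, by simpa using hx, fun i j hij => ?_⟩
  by_contra hn
  refine absurd (hmin (i, j) (by simpa using hn)) (not_le.2 ?_)
  rw [Prod.Lex.toLex_lt_toLex]
  rcases hij with hij | ⟨rfl, hij⟩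
  · exact Or.inl hij
  · exact Or.inr ⟨rfl, hij⟩

/-- The matrices of `Λ` that commute with `M` on a lower set of places form an algebra. -/
def Presents.commSubalgebra (hD : D.Presents Λ) {Q : Fin n → Fin n → Prop} (hQ : D.IsLower Q)
    (M : Matrix (Fin n) (Fin n) k) : Subalgebra k (Matrix (Fin n) (Fin n) k) where
  carrier := {X | X ∈ Λ ∧ ∀ p q, Q p q → (X * M) p q = (M * X) p q}
  mul_mem' := by
    rintro X Y ⟨hX, hX'⟩ ⟨hY, hY'⟩
    refine ⟨Λ.mul_mem hX hY, fun p q hpq => ?_⟩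
    rw [mul_assoc, hD.mul_apply_congr hQ hX hY' hpq, ← mul_assoc,
      hD.apply_mul_congr hQ hY hX' hpq, mul_assoc]
  add_mem' := by
    rintro X Y ⟨hX, hX'⟩ ⟨hY, hY'⟩
    refine ⟨Λ.add_mem hX hY, fun p q hpq => ?_⟩
    rw [add_mul, mul_add, Matrix.add_apply, Matrix.add_apply, hX' p q hpq, hY' p q hpq]
  algebraMap_mem' := by
    intro c
    refine ⟨Λ.algebraMap_mem c, fun p q _ => ?_⟩
    rw [Algebra.commutes]

theorem Presents.mem_commSubalgebra (hD : D.Presents Λ) {Q : Fin n → Fin n → Prop}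
    (hQ : D.IsLower Q) {M X : Matrix (Fin n) (Fin n) k} :
    X ∈ hD.commSubalgebra hQ M ↔ X ∈ Λ ∧ ∀ p q, Q p q → (X * M) p q = (M * X) p q := Iff.rfl

/-- The blocks of `M` at stable places are zero or scalar, qualitatively: a nonzero entry occurs
only at a pair of twins. -/
theorem CommOn.eq_zero_of_not_twin (hD : D.Presents Λ) {M : Matrix (Fin n) (Fin n) k}
    {Q : Fin n → Fin n → Prop} (h : CommOn Λ M Q) {p q : Fin n} (hpq : Q p q)
    (ht : ¬ D.Twin p q) : M p q = 0 := by
  -- Commutation with the idempotent of the twin class of `p`: on the left it fixes row `p`, on the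
  -- right it kills column `q`.
  have := h _ (hD.unit_mem p p) p q hpq
  rwa [unit_mul_apply rfl M (Twin.refl p) (Twin.refl p) rfl,
    mul_unit_apply_of_not rfl M fun x => ht x.symm] at this

/-- In (*) the stable entries of `M` vanish off twins, so only entries of `S` over the classes of
`l` and `r` contribute, and the other systems of equations are irrelevant. The right-hand side
depends on Λ and the strips but not on the chosen equations. -/
theorem Presents.noAddition_iff (hD : D.Presents Λ) {M : Matrix (Fin n) (Fin n) k} {l r : Fin D.t}
    (hE : CommOn Λ M (D.Earlier l r)) :
    D.NoAddition M l r ↔ ∀ S ∈ Λ, (∀ p q, D.blk p = D.blk q → S p q = 0) →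
      ∀ p q, D.blk p = l → D.blk q = r → (M * S) p q = (S * M) p q := by
  classical
  constructor
  · intro h S hS h0 p q hp hq
    have := h S (((hD S).1 hS).2.2 _ _) p q hp hq
    rw [Finset.sum_filter, Finset.sum_filter] at this
    rw [Matrix.mul_apply, Matrix.mul_apply]
    convert this using 2 with s _ s _
    · split_ifs with hs
      · rfl
      · rcases (not_lt.1 hs).lt_or_eq with h' | h'
        · rw [hD.tri hS (hq ▸ h'), mul_zero]
        · rw [h0 s q (h'.symm.trans hq.symm), mul_zero]
    · split_ifs with hs
      · rfl
      · rcases (not_lt.1 hs).lt_or_eq with h' | h'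
        · rw [hD.tri hS (hp ▸ h'), zero_mul]
        · rw [h0 p s (hp.trans h'.symm), zero_mul]
  · intro h S hS p q hp hq
    -- The part of `S` over the two classes; it satisfies every other system trivially and hence
    -- lies in Λ.
    let S' : Matrix (Fin n) (Fin n) k := Matrix.of fun u v =>
      if D.cls (D.blk u) = D.cls l ∧ D.cls (D.blk v) = D.cls r ∧ D.blk u < D.blk v then S u v else 0
    have hS'0 : ∀ u v, ¬ D.blk u < D.blk v → S' u v = 0 := fun u v huv => if_neg fun x => huv x.2.2
    have hS' : S' ∈ Λ := by
      refine (hD S').2 ⟨fun u v huv => hS'0 u v huv.not_gt, ?_, ?_⟩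
      · intro u v u' v' h1 h2 _ _ _
        rw [hS'0 u v (by simp [h1]), hS'0 u' v' (by simp [h2])]
      · intro I J w a b
        by_cases hIJ : I = D.cls l ∧ J = D.cls r
        · obtain ⟨rfl, rfl⟩ := hIJ
          refine (Finset.sum_congr rfl fun u _ => Finset.sum_congr rfl fun v _ => ?_).trans
            (hS w a b)
          split_ifs with hc
          · rw [show S' u v = S u v from if_pos ⟨hc.1, hc.2.1, hc.2.2.1⟩]
          · rfl
        · refine Finset.sum_eq_zero fun u _ => Finset.sum_eq_zero fun v _ => ?_
          split_ifs with hc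
          · rw [show S' u v = 0 from if_neg fun x => hIJ ⟨hc.1 ▸ x.1, hc.2.1 ▸ x.2.1⟩, mul_zero]
          · rfl
    have := h S' hS' (fun u v huv => hS'0 u v (by simp [huv])) p q hp hq
    rw [Matrix.mul_apply, Matrix.mul_apply] at this
    rw [Finset.sum_filter, Finset.sum_filter]
    convert this using 2 with s _ s _
    · split_ifs with hs
      · by_cases ht : D.Twin p s
        · congr 1
          refine (if_pos ⟨?_, by rw [hq], by rwa [hq]⟩).symm
          exact Quotient.sound (D.sim.symm (hp ▸ ht.1))
        · rw [hE.eq_zero_of_not_twin hD (Or.inr ⟨hp, hs⟩) ht, zero_mul, zero_mul]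
      · rw [hS'0 s q (by rwa [hq]), mul_zero]
    · split_ifs with hs
      · by_cases ht : D.Twin s q
        · congr 1
          refine (if_pos ⟨by rw [hp], ?_, by rwa [hp]⟩).symm
          exact Quotient.sound (hq ▸ ht.1)
        · rw [hE.eq_zero_of_not_twin hD (Or.inl hs) ht, mul_zero, mul_zero]
      · rw [hS'0 p s (by rwa [hp]), zero_mul]

end ReducedData

/-- The columns of `T` in `A'` live on the rows in `A`, so the identity matrix of size `A'.card`
factors through a space of dimension `A.card`; compare ranks. Both the rank form and the Weyr form
get their uniqueness from this count. -/
theorem card_le_card_of_support {k : Type*} [Field k] {s s' : ℕ} {T U : ℕ → ℕ → k}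
    (hUT : ∀ b < s', ∀ b' < s', ∑ a ∈ Finset.range s, U b a * T a b' = if b = b' then 1 else 0)
    {A A' : Finset ℕ} (hA : A ⊆ Finset.range s) (hA' : A' ⊆ Finset.range s')
    (h : ∀ b ∈ A', ∀ a < s, a ∉ A → T a b = 0) : A'.card ≤ A.card := by
  classical
  let Um : Matrix A' A k := Matrix.of fun b a => U b a
  let Tm : Matrix A A' k := Matrix.of fun a b => T a b
  have h1 : Um * Tm = 1 := by
    ext ⟨b, hb⟩ ⟨b', hb'⟩
    have := hUT b (Finset.mem_range.1 (hA' hb)) b' (Finset.mem_range.1 (hA' hb'))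
    rw [← Finset.sum_subset hA, ← Finset.sum_coe_sort] at this
    · simpa [Um, Tm, Matrix.mul_apply, Matrix.one_apply] using this
    · intro a ha ha'
      rw [h b' hb' a (Finset.mem_range.1 ha) ha', mul_zero]
  have h2 : (1 : Matrix A' A' k).rank ≤ A.card := by
    rw [← h1]
    exact (Matrix.rank_mul_le_right _ _).trans
      ((Matrix.rank_le_card_height Tm).trans (Fintype.card_coe A).le)
  rwa [Matrix.rank_one, Fintype.card_coe] at h2

/-! ### Weyr matrices as labelled rows, and the matrices intertwining them. -/

section Weyr

variable {k : Type*}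

/-- A numbering by `0, …, s - 1` of the rows of a Weyr matrix whose `j`-th diagonal block with
eigenvalue `c` has size `μ c j`: the row `a` has the place `ix a` in the block with eigenvalue
`ev a` and number `lv a`. -/
structure IsWeyrLabelling [LinearOrder k] (s : ℕ) (μ : k → ℕ → ℕ) (ev : ℕ → k) (lv ix : ℕ → ℕ) :
    Prop where
  anti : ∀ c, Antitone (μ c)
  lt : ∀ a b, a < b → b < s →
    ev a < ev b ∨ (ev a = ev b ∧ (lv a < lv b ∨ (lv a = lv b ∧ ix a < ix b)))
  mem_iff : ∀ c j i, i < μ c j ↔ ∃ a < s, ev a = c ∧ lv a = j ∧ ix a = i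

open Classical in
/-- The entries of the Weyr matrix with a given numbering of rows. -/
noncomputable def weyrEntry [Field k] (ev : ℕ → k) (lv ix : ℕ → ℕ) (a b : ℕ) : k :=
  if a = b then ev a else if ev a = ev b ∧ lv a + 1 = lv b ∧ ix a = ix b then 1 else 0

/-- The values of a function on rows, as a function of the labels. -/
noncomputable def labelSum [Field k] (s : ℕ) (ev : ℕ → k) (lv ix : ℕ → ℕ) (g : ℕ → k) (c : k)
    (j i : ℕ) : k :=
  open Classical in ∑ a ∈ Finset.range s, if ev a = c ∧ lv a = j ∧ ix a = i then g a else 0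

section

variable [Field k] {s : ℕ}

/-- The off-diagonal ones join a row to the row with the same eigenvalue and place in the next
level. A product with a Weyr matrix is therefore an eigenvalue term plus one shifted value, which
`labelSum` makes zero when the shifted label does not exist. -/
theorem sum_weyrEntry_mul (ev : ℕ → k) (lv ix : ℕ → ℕ) (g : ℕ → k)
    {a : ℕ} (ha : a < s) : ∑ b ∈ Finset.range s, weyrEntry ev lv ix a b * g b =
      ev a * g a + labelSum s ev lv ix g (ev a) (lv a + 1) (ix a) := by
  classical
  have : ev a * g a = ∑ b ∈ Finset.range s, if b = a then ev a * g b else 0 := by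
    rw [Finset.sum_ite_eq', if_pos (Finset.mem_range.2 ha)]
  rw [this, labelSum, ← Finset.sum_add_distrib]
  refine Finset.sum_congr rfl fun b _ => ?_
  unfold weyrEntry
  by_cases hab : a = b
  · subst hab; simp
  · rw [if_neg hab, if_neg (Ne.symm hab), zero_add]
    by_cases hc : ev a = ev b ∧ lv a + 1 = lv b ∧ ix a = ix b
    · rw [if_pos hc, if_pos ⟨hc.1.symm, hc.2.1.symm, hc.2.2.symm⟩, one_mul]
    · rw [if_neg hc, if_neg fun x => hc ⟨x.1.symm, x.2.1.symm, x.2.2.symm⟩, zero_mul]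

theorem sum_mul_weyrEntry (ev : ℕ → k) (lv ix : ℕ → ℕ) (g : ℕ → k)
    {b : ℕ} (hb : b < s) : ∑ a ∈ Finset.range s, g a * weyrEntry ev lv ix a b =
      g b * ev b + if lv b = 0 then 0 else labelSum s ev lv ix g (ev b) (lv b - 1) (ix b) := by
  classical
  have h1 : g b * ev b = ∑ a ∈ Finset.range s, if a = b then g a * ev a else 0 := by
    rw [Finset.sum_ite_eq', if_pos (Finset.mem_range.2 hb)]
  have h2 : (if lv b = 0 then 0 else labelSum s ev lv ix g (ev b) (lv b - 1) (ix b)) =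
      ∑ a ∈ Finset.range s, if ev a = ev b ∧ lv a + 1 = lv b ∧ ix a = ix b then g a else 0 := by
    split_ifs with h0
    · exact (Finset.sum_eq_zero fun a _ => if_neg fun x => by omega).symm
    · refine Finset.sum_congr rfl fun a _ => if_congr ?_ rfl rfl
      exact and_congr_right fun _ => and_congr_left fun _ => by omega
  rw [h1, h2, ← Finset.sum_add_distrib]
  refine Finset.sum_congr rfl fun a _ => ?_
  unfold weyrEntry
  by_cases hab : a = b
  · subst hab; simp
  · rw [if_neg hab, if_neg hab, zero_add, mul_ite, mul_one, mul_zero]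

end

namespace IsWeyrLabelling

section

variable [LinearOrder k] {s : ℕ} {μ : k → ℕ → ℕ} {ev : ℕ → k} {lv ix : ℕ → ℕ}

theorem inj (h : IsWeyrLabelling s μ ev lv ix) {a b : ℕ} (ha : a < s) (hb : b < s)
    (h1 : ev a = ev b) (h2 : lv a = lv b) (h3 : ix a = ix b) : a = b := by
  by_contra hne
  rcases lt_or_gt_of_ne hne with hlt | hlt
  · rcases h.lt a b hlt hb with h' | ⟨-, h' | ⟨-, h'⟩⟩
    · exact h'.ne h1
    · omega
    · omega
  · rcases h.lt b a hlt ha with h' | ⟨-, h' | ⟨-, h'⟩⟩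
    · exact h'.ne h1.symm
    · omega
    · omega

theorem mem (h : IsWeyrLabelling s μ ev lv ix) {a : ℕ} (ha : a < s) : ix a < μ (ev a) (lv a) :=
  (h.mem_iff _ _ _).2 ⟨a, ha, rfl, rfl, rfl⟩

/-- The lengths of the Jordan chains. -/
theorem exists_len (h : IsWeyrLabelling s μ ev lv ix) :
    ∃ ℓ : k → ℕ → ℕ, ∀ c i j, i < μ c j ↔ j < ℓ c i := by
  classical
  have hex : ∀ c i, ∃ j, ¬ i < μ c j := by
    intro c i
    -- The sum of all levels exceeds no less than each level, so one more is beyond every row.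
    refine ⟨∑ a ∈ Finset.range s, lv a + 1, fun hlt => ?_⟩
    obtain ⟨a, ha, -, h2, -⟩ := (h.mem_iff _ _ _).1 hlt
    have := Finset.single_le_sum (f := lv) (fun _ _ => Nat.zero_le _) (Finset.mem_range.2 ha)
    omega
  -- Since the sizes decrease, the levels that have a place `i` form an initial segment; `ℓ c` is
  -- the partition conjugate to `μ c`.
  refine ⟨fun c i => Nat.find (hex c i), fun c i j => ?_⟩
  rw [Nat.lt_find_iff]
  constructor
  · intro hj m hm
    rw [not_not]
    exact hj.trans_le (h.anti c hm)
  · exact fun hj => not_not.1 (hj j le_rfl)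

variable [Field k]

theorem labelSum_apply (h : IsWeyrLabelling s μ ev lv ix) (g : ℕ → k) {a : ℕ} (ha : a < s) :
    labelSum s ev lv ix g (ev a) (lv a) (ix a) = g a := by
  classical
  rw [labelSum, Finset.sum_eq_single a]
  · simp
  · intro b hb hne
    exact if_neg fun x => hne (h.inj (Finset.mem_range.1 hb) ha x.1 x.2.1 x.2.2)
  · exact fun hn => absurd (Finset.mem_range.2 ha) hn

theorem labelSum_eq_zero (h : IsWeyrLabelling s μ ev lv ix) (g : ℕ → k) {c : k} {j i : ℕ}
    (hi : ¬ i < μ c j) : labelSum s ev lv ix g c j i = 0 :=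
  Finset.sum_eq_zero fun a ha =>
    if_neg fun x => hi ((h.mem_iff c j i).2 ⟨a, Finset.mem_range.1 ha, x⟩)

end

/-- The recursion for the entries of an intertwining matrix has only the zero solution if the
eigenvalues differ. -/
theorem recursion_eq_zero [Field k] {c c' : k} (hne : c ≠ c') {L L' : ℕ} {u : ℕ → ℕ → k}
    (h1 : ∀ j j', L ≤ j → u j j' = 0) (h2 : ∀ j j', L' ≤ j' → u j j' = 0)
    (he : ∀ j j', j < L → j' < L' →
      c * u j j' + u (j + 1) j' = u j j' * c' + if j' = 0 then 0 else u j (j' - 1)) (j j' : ℕ) :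
    u j j' = 0 := by
  -- The relation expresses (c - c') u j j' by the neighbours in row j + 1 and in column j' - 1. So
  -- the outer induction is on j', the inner one runs downwards in j, with `d` bounding the distance
  -- to `L`.
  have key : ∀ j', ∀ d j, L ≤ j + d → u j j' = 0 := by
    intro j'
    induction j' with
    | zero =>
      intro d
      induction d with
      | zero => exact fun j hj => h1 j _ hj
      | succ d ih =>
        intro j hj
        by_cases hj' : L ≤ j
        · exact h1 j _ hj'
        by_cases hL : L' ≤ 0
        · exact h2 _ _ hL
        have := he j 0 (by omega) (by omega)
        rw [ih (j + 1) (by omega), if_pos rfl, add_zero, add_zero, mul_comm, ← sub_eq_zero,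
          ← mul_sub] at this
        exact (mul_eq_zero.1 this).resolve_right (sub_ne_zero.2 hne)
    | succ j' ihj =>
      intro d
      induction d with
      | zero => exact fun j hj => h1 j _ hj
      | succ d ih =>
        intro j hj
        by_cases hj' : L ≤ j
        · exact h1 j _ hj'
        by_cases hL : L' ≤ j' + 1
        · exact h2 _ _ hL
        have := he j (j' + 1) (by omega) (by omega)
        rw [ih (j + 1) (by omega), if_neg (Nat.succ_ne_zero _), Nat.add_sub_cancel,
          ihj (d + 1) j hj, add_zero, add_zero, mul_comm, ← sub_eq_zero, ← mul_sub] at this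
        exact (mul_eq_zero.1 this).resolve_right (sub_ne_zero.2 hne)
  exact key j' L j (Nat.le_add_left _ _)

section Recursion

variable [Field k] {c : k} {L L' : ℕ} {u : ℕ → ℕ → k}
  (h1 : ∀ j j', L ≤ j → u j j' = 0)
  (he : ∀ j j', j < L → j' < L' →
    c * u j j' + u (j + 1) j' = u j j' * c + if j' = 0 then 0 else u j (j' - 1))

include he in
-- For a single eigenvalue the scalar terms cancel, and what is left says that the array is constant
-- along diagonals.
theorem recursion_shift {j j' : ℕ} (hj : j < L) (hj' : j' + 1 < L') :
    u (j + 1) (j' + 1) = u j j' := by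
  have := he j (j' + 1) hj hj'
  rw [if_neg (Nat.succ_ne_zero _), Nat.add_sub_cancel, mul_comm] at this
  exact add_left_cancel this

include h1 he in
-- A diagonal below the main one meets column 0 in a positive row, where the relation for j' = 0
-- leaves only zero.
theorem recursion_below {j j' : ℕ} (hlt : j' < j) (hj' : j' < L') : u j j' = 0 := by
  induction j' generalizing j with
  | zero =>
    obtain ⟨j, rfl⟩ := Nat.exists_eq_add_of_lt hlt
    by_cases hj : L ≤ 0 + j + 1
    · exact h1 _ _ hj
    · have := he (0 + j) 0 (by omega) hj'
      rw [if_pos rfl, mul_comm] at this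
      exact add_left_cancel this
  | succ j' ih =>
    obtain ⟨j, rfl⟩ : ∃ i, j = i + 1 := ⟨j - 1, by omega⟩
    by_cases hj : L ≤ j + 1
    · exact h1 _ _ hj
    · rw [recursion_shift he (by omega) hj']
      exact ih (by omega) (by omega)

include he in
theorem recursion_diag {j : ℕ} (hj : j ≤ L) (hj' : j < L') : u j j = u 0 0 := by
  induction j with
  | zero => rfl
  | succ j ih => rw [recursion_shift he (by omega) hj', ih (by omega) (by omega)]

end Recursion

section Intertwine

variable [LinearOrder k] [Field k] {s s' : ℕ} {μ μ' : k → ℕ → ℕ} {ev ev' : ℕ → k}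
  {lv ix lv' ix' : ℕ → ℕ} {T : ℕ → ℕ → k} {ℓ ℓ' : k → ℕ → ℕ}

/-- `T` intertwines two Weyr matrices. -/
def Intertwines (s s' : ℕ) (ev ev' : ℕ → k) (lv ix lv' ix' : ℕ → ℕ) (T : ℕ → ℕ → k) : Prop :=
  ∀ a < s, ∀ b < s', ∑ c ∈ Finset.range s, weyrEntry ev lv ix a c * T c b =
    ∑ c ∈ Finset.range s', T a c * weyrEntry ev' lv' ix' c b

/-- The entries of an intertwining matrix as a function of the labels satisfy the recursion. -/
theorem Intertwines.exists_array (hT : Intertwines s s' ev ev' lv ix lv' ix' T)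
    (h : IsWeyrLabelling s μ ev lv ix) (h' : IsWeyrLabelling s' μ' ev' lv' ix')
    (hℓ : ∀ c i j, i < μ c j ↔ j < ℓ c i) (hℓ' : ∀ c i j, i < μ' c j ↔ j < ℓ' c i)
    (c c' : k) (i i' : ℕ) : ∃ u : ℕ → ℕ → k,
      (∀ a < s, ∀ b < s', ev a = c → ev' b = c' → ix a = i → ix' b = i' →
        u (lv a) (lv' b) = T a b) ∧
      (∀ j j', ℓ c i ≤ j → u j j' = 0) ∧ (∀ j j', ℓ' c' i' ≤ j' → u j j' = 0) ∧
      (∀ j j', j < ℓ c i → j' < ℓ' c' i' →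
        c * u j j' + u (j + 1) j' = u j j' * c' + if j' = 0 then 0 else u j (j' - 1)) := by
  -- Entries at labels without a row are set to zero; this gives the boundary values of the
  -- recursion.
  refine ⟨fun j j' => labelSum s' ev' lv' ix' (fun b => labelSum s ev lv ix (fun a => T a b) c j i)
    c' j' i', ?_, ?_, ?_, ?_⟩
  · rintro a ha b hb rfl rfl rfl rfl
    dsimp only
    rw [h'.labelSum_apply _ hb, h.labelSum_apply _ ha]
  · intro j j' hj
    refine Finset.sum_eq_zero fun b _ => ?_
    dsimp only
    rw [h.labelSum_eq_zero _ (fun x => ((hℓ _ _ _).1 x).not_ge hj), ite_self]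
  · intro j j' hj
    exact h'.labelSum_eq_zero _ (by rw [hℓ']; omega)
  · intro j j' hj hj'
    obtain ⟨a, ha, rfl, rfl, rfl⟩ := (h.mem_iff _ _ _).1 ((hℓ c i j).2 hj)
    obtain ⟨b, hb, rfl, rfl, rfl⟩ := (h'.mem_iff _ _ _).1 ((hℓ' c' i' j').2 hj')
    have := hT a ha b hb
    rw [sum_weyrEntry_mul ev lv ix _ ha, sum_mul_weyrEntry ev' lv' ix' _ hb] at this
    simp only [h'.labelSum_apply _ hb, h.labelSum_apply _ ha]
    exact this

variable (hT : Intertwines s s' ev ev' lv ix lv' ix' T)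
  (h : IsWeyrLabelling s μ ev lv ix) (h' : IsWeyrLabelling s' μ' ev' lv' ix')

include hT h h'

/-- This and the next three lemmas give the shape of an intertwining matrix: for rows ordered by
eigenvalue, level and decreasing chain length it is block upper triangular, and its diagonal blocks
do not change with the level. -/
theorem Intertwines.eq_zero_of_ev_ne {a b : ℕ} (ha : a < s) (hb : b < s') (hne : ev a ≠ ev' b) :
    T a b = 0 := by
  obtain ⟨ℓ, hℓ⟩ := h.exists_len
  obtain ⟨ℓ', hℓ'⟩ := h'.exists_len
  obtain ⟨u, h0, h1, h2, he⟩ := hT.exists_array h h' hℓ hℓ' (ev a) (ev' b) (ix a) (ix' b)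
  rw [← h0 a ha b hb rfl rfl rfl rfl]
  exact recursion_eq_zero hne h1 h2 he _ _

theorem Intertwines.eq_zero_of_lv_lt {a b : ℕ} (ha : a < s) (hb : b < s') (hlt : lv' b < lv a) :
    T a b = 0 := by
  by_cases hne : ev a = ev' b
  · obtain ⟨ℓ, hℓ⟩ := h.exists_len
    obtain ⟨ℓ', hℓ'⟩ := h'.exists_len
    obtain ⟨u, h0, h1, h2, he⟩ := hT.exists_array h h' hℓ hℓ' (ev a) (ev a) (ix a) (ix' b)
    rw [← h0 a ha b hb rfl hne.symm rfl rfl]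
    refine recursion_below h1 he hlt ((hℓ' _ _ _).1 ?_)
    rw [hne]
    exact h'.mem hb
  · exact hT.eq_zero_of_ev_ne h h' ha hb hne

/-- Within one level the entry moves along the main diagonal of the array until the chain of `a` has
ended while that of `b` still continues; there the array is zero. -/
theorem Intertwines.eq_zero_of_len_lt (hℓ : ∀ c i j, i < μ c j ↔ j < ℓ c i)
    (hℓ' : ∀ c i j, i < μ' c j ↔ j < ℓ' c i) {a b : ℕ} (ha : a < s) (hb : b < s')
    (hlv : lv a = lv' b) (hlt : ℓ (ev a) (ix a) < ℓ' (ev' b) (ix' b)) : T a b = 0 := by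
  by_cases hne : ev a = ev' b
  · obtain ⟨u, h0, h1, h2, he⟩ := hT.exists_array h h' hℓ hℓ' (ev a) (ev a) (ix a) (ix' b)
    rw [← hne] at hlt
    have hla := (hℓ _ _ _).1 (h.mem ha)
    rw [← h0 a ha b hb rfl hne.symm rfl rfl, ← hlv, recursion_diag he hla.le (hla.trans hlt),
      ← recursion_diag he le_rfl hlt]
    exact h1 _ _ le_rfl
  · exact hT.eq_zero_of_ev_ne h h' ha hb hne

/-- For a fixed pair of chains, both entries lie on the main diagonal of the same array. -/
theorem Intertwines.eq_of_lv_eq {a b a₂ b₂ : ℕ} (ha : a < s) (hb : b < s') (ha₂ : a₂ < s)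
    (hb₂ : b₂ < s') (h1 : lv a = lv' b) (h2 : lv a₂ = lv' b₂) (hev : ev a = ev a₂)
    (hix : ix a = ix a₂) (hev' : ev' b = ev' b₂) (hix' : ix' b = ix' b₂) : T a b = T a₂ b₂ := by
  by_cases hne : ev a = ev' b
  · obtain ⟨ℓ, hℓ⟩ := h.exists_len
    obtain ⟨ℓ', hℓ'⟩ := h'.exists_len
    obtain ⟨u, h0, -, -, he⟩ := hT.exists_array h h' hℓ hℓ' (ev a) (ev a) (ix a) (ix' b)
    rw [← h0 a ha b hb rfl hne.symm rfl rfl,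
      ← h0 a₂ ha₂ b₂ hb₂ hev.symm (hev'.symm.trans hne.symm) hix.symm hix'.symm, ← h1, ← h2,
      recursion_diag he (j := lv a), recursion_diag he (j := lv a₂)]
    · have := h.mem ha₂
      rw [← hev, ← hix] at this
      exact ((hℓ _ _ _).1 this).le
    · have := h'.mem hb₂
      rw [← hev', ← hix', ← h2, ← hne] at this
      exact (hℓ' _ _ _).1 this
    · exact ((hℓ _ _ _).1 (h.mem ha)).le
    · have := h'.mem hb
      rw [← h1, ← hne] at this
      exact (hℓ' _ _ _).1 this
  · rw [hT.eq_zero_of_ev_ne h h' ha hb hne,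
      hT.eq_zero_of_ev_ne h h' ha₂ hb₂ fun x => hne (hev.trans (x.trans hev'.symm))]

end Intertwine

section Uniqueness

variable [LinearOrder k] {s s' : ℕ} {μ μ' : k → ℕ → ℕ} {ev ev' : ℕ → k}
  {lv ix lv' ix' : ℕ → ℕ}

theorem card_lv_eq (h : IsWeyrLabelling s μ ev lv ix) (c : k) (j : ℕ) :
    ((Finset.range s).filter fun a => ev a = c ∧ lv a = j).card = μ c j := by
  rw [← Finset.card_range (μ c j)]
  refine Finset.card_nbij ix ?_ ?_ ?_
  · intro a ha
    obtain ⟨ha', rfl, rfl⟩ := Finset.mem_filter.1 ha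
    exact Finset.mem_range.2 (h.mem (Finset.mem_range.1 ha'))
  · intro a ha b hb hab
    simp only [Finset.coe_filter, Finset.mem_range, Set.mem_ofPred_eq] at ha hb
    exact h.inj ha.1 hb.1 (ha.2.1.trans hb.2.1.symm) (ha.2.2.trans hb.2.2.symm) hab
  · intro i hi
    obtain ⟨a, ha, h1, h2, h3⟩ := (h.mem_iff c j i).1 (Finset.mem_range.1 (Finset.mem_coe.1 hi))
    exact ⟨a, by simp [ha, h1, h2], h3⟩

theorem card_lv_lt (h : IsWeyrLabelling s μ ev lv ix) (c : k) (j : ℕ) :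
    ((Finset.range s).filter fun a => ev a = c ∧ lv a < j).card = ∑ i ∈ Finset.range j, μ c i := by
  induction j with
  | zero => simp
  | succ j ih =>
    rw [Finset.sum_range_succ, ← ih, ← h.card_lv_eq, ← Finset.card_union_of_disjoint]
    · congr 1
      ext a
      simp only [Finset.mem_filter, Finset.mem_range, Finset.mem_union]
      constructor
      · rintro ⟨h1, h2, h3⟩
        rcases (Nat.lt_succ_iff.1 h3).lt_or_eq with h4 | h4
        · exact Or.inl ⟨h1, h2, h4⟩
        · exact Or.inr ⟨h1, h2, h4⟩
      · rintro (⟨h1, h2, h3⟩ | ⟨h1, h2, h3⟩)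
        · exact ⟨h1, h2, by omega⟩
        · exact ⟨h1, h2, by omega⟩
    · refine Finset.disjoint_filter.2 fun a _ h1 h2 => by omega

/-- The labelling is determined by the block sizes. -/
theorem unique (h : IsWeyrLabelling s μ ev lv ix) (h' : IsWeyrLabelling s μ ev' lv' ix') :
    ∀ a < s, ev a = ev' a ∧ lv a = lv' a ∧ ix a = ix' a := by
  -- Labels increase lexicographically with the row, and `μ` determines their set; an increasing
  -- enumeration of a set is unique.
  let f : Fin s → k ×ₗ ℕ ×ₗ ℕ := fun a => toLex (ev a, toLex (lv a, ix a))
  let f' : Fin s → k ×ₗ ℕ ×ₗ ℕ := fun a => toLex (ev' a, toLex (lv' a, ix' a))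
  have hf : StrictMono f := fun a b hab => by
    simpa only [f, Prod.Lex.toLex_lt_toLex] using h.lt a b hab b.2
  have hf' : StrictMono f' := fun a b hab => by
    simpa only [f', Prod.Lex.toLex_lt_toLex] using h'.lt a b hab b.2
  have key : ∀ {g g' : Fin s → k ×ₗ ℕ ×ₗ ℕ}, (∀ x, x ∈ Set.range g ↔ x ∈ Set.range g') →
      Set.range g = Set.range g' := fun hx => Set.ext hx
  have hr : Set.range f = Set.range f' := by
    have hx : ∀ {ev : ℕ → k} {lv ix : ℕ → ℕ}, IsWeyrLabelling s μ ev lv ix → ∀ c j i,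
        (toLex (c, toLex (j, i)) : k ×ₗ ℕ ×ₗ ℕ) ∈
          Set.range (fun a : Fin s => (toLex (ev a, toLex (lv a, ix a)) : k ×ₗ ℕ ×ₗ ℕ)) ↔
        i < μ c j := by
      intro ev lv ix h c j i
      rw [h.mem_iff]
      constructor
      · rintro ⟨a, ha⟩
        have h1 := congrArg ofLex ha
        simp only [ofLex_toLex, Prod.mk.injEq, toLex_inj] at h1
        exact ⟨a, a.2, h1⟩
      · rintro ⟨a, ha, rfl, rfl, rfl⟩
        exact ⟨⟨a, ha⟩, rfl⟩
    ext x
    exact (hx h (ofLex x).1 (ofLex (ofLex x).2).1 (ofLex (ofLex x).2).2).trans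
      (hx h' (ofLex x).1 (ofLex (ofLex x).2).1 (ofLex (ofLex x).2).2).symm
  have hff : f = f' := (hf.range_inj hf').1 hr
  intro a ha
  have h1 := congrArg ofLex (congrFun hff ⟨a, ha⟩)
  simpa only [f, f', ofLex_toLex, Prod.mk.injEq, toLex_inj] using h1

variable [Field k] {T U : ℕ → ℕ → k}

/-- Columns of `T` with eigenvalue `c` and level below `j` are supported on rows of the same kind,
and `T` has a left inverse, so `card_le_card_of_support` bounds their number. -/
theorem sum_le_of_intertwines (h : IsWeyrLabelling s μ ev lv ix)
    (h' : IsWeyrLabelling s' μ' ev' lv' ix') (hT : Intertwines s s' ev ev' lv ix lv' ix' T)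
    (hUT : ∀ b < s', ∀ b' < s', ∑ a ∈ Finset.range s, U b a * T a b' = if b = b' then 1 else 0)
    (c : k) (j : ℕ) : ∑ i ∈ Finset.range j, μ' c i ≤ ∑ i ∈ Finset.range j, μ c i := by
  rw [← h.card_lv_lt, ← h'.card_lv_lt]
  refine card_le_card_of_support hUT (Finset.filter_subset _ _) (Finset.filter_subset _ _) ?_
  intro b hb a ha hna
  simp only [Finset.mem_filter, Finset.mem_range] at hb hna
  obtain ⟨hb, rfl, hlt⟩ := hb
  by_cases hne : ev a = ev' b
  · exact hT.eq_zero_of_lv_lt h h' ha hb (hlt.trans_le (not_lt.1 fun x => hna ⟨ha, hne, x⟩))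
  · exact hT.eq_zero_of_ev_ne h h' ha hb hne

/-- Similar Weyr matrices are equal. -/
theorem weyrEntry_eq (h : IsWeyrLabelling s μ ev lv ix)
    (h' : IsWeyrLabelling s μ' ev' lv' ix') (hT : Intertwines s s ev ev' lv ix lv' ix' T)
    (hU : Intertwines s s ev' ev lv' ix' lv ix U)
    (hUT : ∀ b < s, ∀ b' < s, ∑ a ∈ Finset.range s, U b a * T a b' = if b = b' then 1 else 0)
    (hTU : ∀ b < s, ∀ b' < s, ∑ a ∈ Finset.range s, T b a * U a b' = if b = b' then 1 else 0) :
    ∀ a < s, ∀ b < s, weyrEntry ev lv ix a b = weyrEntry ev' lv' ix' a b := by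
  have hsum : ∀ c j, ∑ i ∈ Finset.range j, μ c i = ∑ i ∈ Finset.range j, μ' c i := fun c j =>
    le_antisymm (sum_le_of_intertwines h' h hU hTU c j) (sum_le_of_intertwines h h' hT hUT c j)
  have hμ : μ = μ' := by
    funext c j
    have h1 := hsum c j
    have h2 := hsum c (j + 1)
    rw [Finset.sum_range_succ, Finset.sum_range_succ] at h2
    omega
  subst hμ
  have := h.unique h'
  intro a ha b hb
  obtain ⟨h1, h2, h3⟩ := this a ha
  obtain ⟨h4, h5, h6⟩ := this b hb
  unfold weyrEntry
  rw [h1, h2, h3, h4, h5, h6]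

end Uniqueness

end IsWeyrLabelling

end Weyr

/-! ### Bases of Jordan chains. -/

section ChainBasis

open Polynomial

variable {k : Type*} [Field k]

/-- A cyclic module with one eigenvalue has a basis in which the operator is a Jordan block. -/
theorem exists_basis_quotient_pow (c : k) (e : ℕ) :
    ∃ b : Module.Basis (Fin e) k (k[X] ⧸ Ideal.span {(X - C c) ^ e}), ∀ j : Fin e,
      (X : k[X]) • b j = c • b j + if h : (j : ℕ) = 0 then 0 else b ⟨j - 1, by omega⟩ := by
  let v : ℕ → k[X] ⧸ Ideal.span {(X - C c) ^ e} := fun j => Ideal.Quotient.mk _ ((X - C c) ^ j)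
  have hv : ∀ j, e ≤ j → v j = 0 := fun j hj => by
    rw [Ideal.Quotient.eq_zero_iff_mem, Ideal.mem_span_singleton]
    exact pow_dvd_pow _ hj
  have hX : ∀ j, (X : k[X]) • v j = c • v j + v (j + 1) := fun j => by
    have h1 : (X : k[X]) * (X - C c) ^ j = C c * (X - C c) ^ j + (X - C c) ^ (j + 1) := by ring
    have h2 : (X : k[X]) • v j = Ideal.Quotient.mk _ (X * (X - C c) ^ j) := rfl
    have h3 : c • v j = Ideal.Quotient.mk _ (C c * (X - C c) ^ j) := by
      rw [← smul_eq_C_mul]; rfl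
    rw [h2, h3, h1, map_add]
  -- The powers span by Taylor expansion at `c`. They are numbered backwards so that multiplication
  -- by X - c lowers the index.
  have hspan : ⊤ ≤ Submodule.span k (Set.range fun j : Fin e => v (e - 1 - j)) := by
    intro x _
    obtain ⟨p, rfl⟩ := Ideal.Quotient.mk_surjective x
    rw [← sum_taylor_eq p c, Polynomial.sum, map_sum]
    refine Submodule.sum_mem _ fun j _ => ?_
    have : Ideal.Quotient.mk (Ideal.span {(X - C c) ^ e}) (C ((taylor c p).coeff j) *
        (X - C c) ^ j) = (taylor c p).coeff j • v j := by
      rw [← smul_eq_C_mul]; rfl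
    rw [this]
    refine Submodule.smul_mem _ _ ?_
    by_cases hj : e ≤ j
    · rw [hv j hj]; exact Submodule.zero_mem _
    · refine Submodule.subset_span ⟨⟨e - 1 - j, by omega⟩, ?_⟩
      change v (e - 1 - (e - 1 - j)) = v j
      congr 1; omega
  have hcard : Fintype.card (Fin e) =
      Module.finrank k (k[X] ⧸ Ideal.span {(X - C c) ^ e}) := by
    rw [finrank_quotient_span_eq_natDegree, natDegree_pow, natDegree_X_sub_C, Fintype.card_fin,
      mul_one]
  refine ⟨basisOfTopLeSpanOfCardEqFinrank _ hspan hcard, fun j => ?_⟩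
  have hb : ∀ j : Fin e, basisOfTopLeSpanOfCardEqFinrank _ hspan hcard j = v (e - 1 - j) := fun j =>
    congrFun (coe_basisOfTopLeSpanOfCardEqFinrank _ hspan hcard) j
  rw [hb, hX]
  congr 1
  split_ifs with h
  · exact hv _ (by omega)
  · rw [hb]
    change v _ = v (e - 1 - (j - 1 : ℕ))
    congr 1; omega

/-- An operator over an algebraically closed field has a basis of Jordan chains. -/
theorem exists_chain_basis [IsAlgClosed k] {V : Type*} [AddCommGroup V] [Module k V]
    [FiniteDimensional k V] (f : V →ₗ[k] V) :
    ∃ (m : ℕ) (c : Fin m → k) (e : Fin m → ℕ) (b : Module.Basis (Σ i, Fin (e i)) k V),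
      ∀ i (j : Fin (e i)), f (b ⟨i, j⟩) = c i • b ⟨i, j⟩ +
        if h : (j : ℕ) = 0 then 0 else b ⟨i, j - 1, by omega⟩ := by
  classical
  -- The structure theorem for the torsion k[X]-module defined by `f`; over an algebraically closed
  -- field the primes are linear up to a unit.
  obtain ⟨ι, _, p, hp, e, ⟨φ⟩⟩ := Module.equiv_directSum_of_isTorsion
    (Module.AEval.isTorsion_of_finiteDimensional k V f)
  have hroot : ∀ i, ∃ c, Ideal.span {p i ^ e i} = Ideal.span {(X - C c) ^ e i} := by
    intro i
    obtain ⟨c, hc⟩ := IsAlgClosed.exists_root (p i) (degree_pos_of_irreducible (hp i)).ne'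
    refine ⟨c, Ideal.span_singleton_eq_span_singleton.2 (Associated.pow_pow ?_)⟩
    exact ((irreducible_X_sub_C c).associated_of_dvd (hp i) (dvd_iff_isRoot.2 hc)).symm
  choose c hc using hroot
  have hbasis : ∀ i, ∃ b : Module.Basis (Fin (e i)) k (k[X] ⧸ Ideal.span {p i ^ e i}), ∀ j,
      (X : k[X]) • b j = c i • b j + if h : (j : ℕ) = 0 then 0 else b ⟨j - 1, by omega⟩ := by
    intro i
    rw [hc i]
    exact exists_basis_quotient_pow (c i) (e i)
  choose b hb using hbasis
  let ψ := φ.trans (DirectSum.linearEquivFunOnFintype k[X] ι _)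
  let B : Module.Basis (Σ i, Fin (e i)) k V :=
    (Pi.basis b).map ((ψ.restrictScalars k).symm.trans (Module.AEval'.of f).symm)
  have hB : ∀ i j, B ⟨i, j⟩ = (Module.AEval'.of f).symm (ψ.symm (Pi.single i (b i j))) := by
    intro i j
    simp only [B, Module.Basis.map_apply, Pi.basis_apply]
    rfl
  have hact : ∀ y, f ((Module.AEval'.of f).symm (ψ.symm y)) =
      (Module.AEval'.of f).symm (ψ.symm ((X : k[X]) • y)) := by
    intro y
    rw [map_smul, LinearEquiv.eq_symm_apply]
    rw [← Module.AEval'.X_smul_of, LinearEquiv.apply_symm_apply]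
  have hsm : ∀ (a : k) y, (Module.AEval'.of f).symm (ψ.symm (a • y)) =
      a • (Module.AEval'.of f).symm (ψ.symm y) := by
    intro a y
    rw [← map_smul]
    congr 1
    exact (ψ.restrictScalars k).symm.map_smul a y
  have hfB : ∀ i (j : Fin (e i)), f (B ⟨i, j⟩) = c i • B ⟨i, j⟩ +
        if h : (j : ℕ) = 0 then 0 else B ⟨i, j - 1, by omega⟩ := by
    intro i j
    rw [hB, hact, ← Pi.single_smul, hb, Pi.single_add, map_add, map_add, Pi.single_smul, hsm]
    congr 1
    split_ifs with h
    · rw [Pi.single_zero, map_zero, map_zero]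
    · rw [hB]
  let ε := Fintype.equivFin ι
  refine ⟨Fintype.card ι, fun i => c (ε.symm i), fun i => e (ε.symm i),
    B.reindex (Equiv.sigmaCongrLeft (β := fun i => Fin (e i)) ε.symm).symm, fun i j => ?_⟩
  simp only [Module.Basis.reindex_apply, Equiv.symm_symm]
  exact hfB (ε.symm i) j

end ChainBasis

/-! ### Weyr matrices translated into row labels. -/

section WeyrForm

variable {k : Type*}

/-- The index set of a Weyr matrix. -/
abbrev WeyrIndex {r : ℕ} {κ : Fin r → ℕ} (m : (i : Fin r) → Fin (κ i) → ℕ) :=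
  Σₗ i : Fin r, Σₗ j : Fin (κ i), Fin (m i j)

namespace WeyrIndex

variable {r : ℕ} {κ : Fin r → ℕ} {m : (i : Fin r) → Fin (κ i) → ℕ}

/-- The number of the cell. -/
def cell (x : WeyrIndex m) : Fin r := (ofLex x).1

/-- The number of the diagonal block inside the cell. -/
def lv (x : WeyrIndex m) : Fin (κ x.cell) := (ofLex (ofLex x).2).1

/-- The position in the diagonal block. -/
def ix (x : WeyrIndex m) : Fin (m x.cell x.lv) := (ofLex (ofLex x).2).2

/-- The index with a given place. -/
def of (i : Fin r) (j : Fin (κ i)) (a : Fin (m i j)) : WeyrIndex m := toLex ⟨i, toLex ⟨j, a⟩⟩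

theorem ext {x y : WeyrIndex m} (h1 : x.cell = y.cell) (h2 : (x.lv : ℕ) = y.lv)
    (h3 : (x.ix : ℕ) = y.ix) : x = y := by
  obtain ⟨i, j, a⟩ := x
  obtain ⟨i', j', a'⟩ := y
  change i = i' at h1
  subst h1
  have h2 : j = j' := Fin.ext h2
  subst h2
  have h3 : a = a' := Fin.ext h3
  subst h3
  rfl

theorem lt_imp [LinearOrder k] {lam : Fin r → k} (hlam : StrictMono lam) {x y : WeyrIndex m}
    (h : x < y) : lam x.cell < lam y.cell ∨ (lam x.cell = lam y.cell ∧ ((x.lv : ℕ) < y.lv ∨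
      ((x.lv : ℕ) = y.lv ∧ (x.ix : ℕ) < y.ix))) := by
  obtain ⟨i, j, a⟩ := x
  obtain ⟨i', j', a'⟩ := y
  rcases Sigma.Lex.lt_def.1 h with h | ⟨h1, h2⟩
  · exact Or.inl (hlam h)
  · change i = i' at h1
    subst h1
    refine Or.inr ⟨rfl, ?_⟩
    rcases Sigma.Lex.lt_def.1 h2 with h | ⟨h1, h2⟩
    · exact Or.inl h
    · change j = j' at h1
      subst h1
      exact Or.inr ⟨rfl, h2⟩

theorem blockDiagonal'_weyrCell_apply [Field k] [LinearOrder k] {lam : Fin r → k}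
    (hlam : Function.Injective lam) (x y : WeyrIndex m) :
    Matrix.blockDiagonal' (fun i => weyrCell (lam i) (m i)) (ofLex x) (ofLex y) =
      if x = y then lam x.cell else if lam x.cell = lam y.cell ∧ (x.lv : ℕ) + 1 = y.lv ∧
        (x.ix : ℕ) = y.ix then 1 else 0 := by
  rw [Matrix.blockDiagonal'_apply]
  by_cases hi : x.cell = y.cell
  · obtain ⟨i, x⟩ := x
    obtain ⟨i', y⟩ := y
    change i = i' at hi
    subst hi
    refine (dif_pos rfl).trans ?_
    change weyrCell (lam i) (m i) x y = _
    rw [weyrCell, Matrix.of_apply]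
    by_cases hxy : x = y
    · exact (if_pos hxy).trans (if_pos (congrArg (Sigma.mk i) hxy)).symm
    · refine (if_neg hxy).trans (Eq.trans ?_ (if_neg ?_).symm)
      · exact if_congr (and_iff_right rfl).symm rfl rfl
      · exact fun h => hxy (eq_of_heq (Sigma.mk.inj h).2)
  · refine (dif_neg hi).trans ?_
    rw [if_neg, if_neg]
    · exact fun h => hi (hlam h.1)
    · exact fun h => hi (congrArg cell h)

end WeyrIndex

/-- A Weyr matrix in terms of a numbering of its rows. -/
theorem isWeyr_iff [Field k] [LinearOrder k] {α β : Type*} [LinearOrder α] [LinearOrder β] {s : ℕ} (oα : Fin s ≃o α)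
    (oβ : Fin s ≃o β) (W : Matrix α β k) :
    IsWeyr W ↔ ∃ μ ev lv ix, IsWeyrLabelling s μ ev lv ix ∧
      ∀ a b : Fin s, W (oα a) (oβ b) = weyrEntry ev lv ix a b := by
  classical
  constructor
  · rintro ⟨r, lam, κ, m, e, f, hlam, hκ, hanti, hpos, hW⟩
    -- An order isomorphism from `Fin s` to a given linear order is unique, so rows and columns
    -- receive the same labels.
    have hef : oα.trans e = oβ.trans f := Subsingleton.elim _ _
    let o : Fin s ≃o WeyrIndex m := oα.trans e
    let ev : ℕ → k := fun a => if h : a < s then lam (o ⟨a, h⟩).cell else 0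
    let lv : ℕ → ℕ := fun a => if h : a < s then (o ⟨a, h⟩).lv else 0
    let ix : ℕ → ℕ := fun a => if h : a < s then (o ⟨a, h⟩).ix else 0
    have hev : ∀ a : Fin s, ev a = lam (o a).cell := fun a => dif_pos a.2
    have hlv : ∀ a : Fin s, lv a = (o a).lv := fun a => dif_pos a.2
    have hix : ∀ a : Fin s, ix a = (o a).ix := fun a => dif_pos a.2
    -- Block sizes extended by zero to scalars that are not eigenvalues and to levels past the last.
    let μ : k → ℕ → ℕ := fun c j => ∑ i : Fin r, ∑ j' : Fin (κ i),
      if lam i = c ∧ (j' : ℕ) = j then m i j' else 0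
    have hμ : ∀ i j, μ (lam i) j = if h : j < κ i then m i ⟨j, h⟩ else 0 := by
      intro i j
      simp only [μ]
      rw [Finset.sum_eq_single i]
      · split_ifs with h
        · rw [Finset.sum_eq_single ⟨j, h⟩]
          · simp
          · intro j' _ hj'
            exact if_neg fun x => hj' (Fin.ext x.2)
          · simp
        · exact Finset.sum_eq_zero fun j' _ => if_neg fun ⟨_, hj⟩ => h (hj ▸ j'.2)
      · intro i' _ hi'
        exact Finset.sum_eq_zero fun _ _ => if_neg fun x => hi' (hlam.injective x.1)
      · simp
    have hμ0 : ∀ c j, (¬ ∃ i, lam i = c) → μ c j = 0 := fun c j h =>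
      Finset.sum_eq_zero fun i _ => Finset.sum_eq_zero fun _ _ => if_neg fun x => h ⟨i, x.1⟩
    refine ⟨μ, ev, lv, ix, ⟨?_, ?_, ?_⟩, ?_⟩
    · intro c j j' hj
      by_cases hc : ∃ i, lam i = c
      · obtain ⟨i, rfl⟩ := hc
        rw [hμ, hμ]
        by_cases h : j' < κ i
        · rw [dif_pos h, dif_pos (hj.trans_lt h)]
          exact hanti i hj
        · rw [dif_neg h]
          exact Nat.zero_le _
      · rw [hμ0 c j' hc]
        exact Nat.zero_le _
    · intro a b hab hb
      have := WeyrIndex.lt_imp hlam (o.strictMono (show (⟨a, hab.trans hb⟩ : Fin s) < ⟨b, hb⟩ from hab))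
      rw [← hev, ← hlv, ← hix, ← hev, ← hlv, ← hix] at this
      exact this
    · intro c j i
      constructor
      · intro hi
        by_cases hc : ∃ i, lam i = c
        · obtain ⟨u, rfl⟩ := hc
          rw [hμ] at hi
          split_ifs at hi with hj
          · refine ⟨o.symm (WeyrIndex.of u ⟨j, hj⟩ ⟨i, hi⟩), Fin.is_lt _, ?_⟩
            rw [hev, hlv, hix, OrderIso.apply_symm_apply]
            exact ⟨rfl, rfl, rfl⟩
          · omega
        · rw [hμ0 c j hc] at hi
          omega
      · rintro ⟨a, ha, rfl, rfl, rfl⟩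
        have h1 := hev ⟨a, ha⟩
        have h2 := hlv ⟨a, ha⟩
        have h3 := hix ⟨a, ha⟩
        dsimp only at h1 h2 h3
        rw [h1, h2, h3, hμ, dif_pos (Fin.is_lt _)]
        exact Fin.is_lt _
    · intro a b
      rw [hW, WeyrIndex.blockDiagonal'_weyrCell_apply hlam.injective]
      have h1 : e (oα a) = o a := rfl
      have h2 : f (oβ b) = o b := by
        change (oβ.trans f) b = _
        rw [← hef]
      rw [h1, h2, ← hev, ← hev, ← hlv, ← hlv, ← hix, ← hix, weyrEntry]
      simp only [EmbeddingLike.apply_eq_iff_eq, Fin.ext_iff]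
      split_ifs <;> rfl
  · rintro ⟨μ, ev, lv, ix, h, hW⟩
    obtain ⟨ℓ, hℓ⟩ := h.exists_len
    let E := (Finset.range s).image ev
    let lam : Fin E.card → k := E.orderEmbOfFin rfl
    have hlam : StrictMono lam := (E.orderEmbOfFin rfl).strictMono
    have hmemE : ∀ i, ∃ a < s, ev a = lam i := fun i => by
      obtain ⟨a, ha, hai⟩ := Finset.mem_image.1 (E.orderEmbOfFin_mem rfl i)
      exact ⟨a, Finset.mem_range.1 ha, hai⟩
    have hsurj : ∀ a < s, ∃ i, lam i = ev a := fun a ha => by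
      have : ev a ∈ Set.range lam := by
        simp only [lam, Finset.range_orderEmbOfFin]
        exact Finset.mem_coe.2 (Finset.mem_image_of_mem ev (Finset.mem_range.2 ha))
      exact this
    have hlen : ∀ a < s, lv a < ℓ (ev a) 0 := fun a ha =>
      (hℓ _ _ _).1 ((Nat.zero_le _).trans_lt (h.mem ha))
    -- The number of levels is the length of the first chain, which is the longest one.
    let κ : Fin E.card → ℕ := fun i => ℓ (lam i) 0
    let m : (i : Fin E.card) → Fin (κ i) → ℕ := fun i j => μ (lam i) j
    have hg : ∀ x : WeyrIndex m, ∃ a : Fin s,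
        ev a = lam x.cell ∧ lv a = x.lv ∧ ix a = x.ix := fun x => by
      obtain ⟨a, ha, h'⟩ := (h.mem_iff (lam x.cell) x.lv x.ix).1 x.ix.2
      exact ⟨⟨a, ha⟩, h'⟩
    choose g hg1 hg2 hg3 using hg
    have hgm : StrictMono g := by
      intro x y hxy
      have := WeyrIndex.lt_imp hlam hxy
      rw [← hg1, ← hg2, ← hg3, ← hg1, ← hg2, ← hg3] at this
      by_contra hn
      rcases (not_lt.1 hn).lt_or_eq with hlt | heq
      · rcases h.lt _ _ hlt (g x).2 with h1 | ⟨h1, h2 | ⟨h2, h3⟩⟩ <;>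
          rcases this with h1' | ⟨h1', h2' | ⟨h2', h3'⟩⟩
        · exact lt_asymm h1 h1'
        · exact h1.ne h1'.symm
        · exact h1.ne h1'.symm
        · exact h1'.ne h1.symm
        · omega
        · omega
        · exact h1'.ne h1.symm
        · omega
        · omega
      · rw [heq] at this
        rcases this with h1' | ⟨h1', h2' | ⟨h2', h3'⟩⟩
        · exact lt_irrefl _ h1'
        · omega
        · omega
    have hgs : Function.Surjective g := by
      intro a
      obtain ⟨i, hi⟩ := hsurj a a.2
      have hj : lv a < κ i := by
        simp only [κ, hi]
        exact hlen a a.2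
      have ha : ix a < m i ⟨lv a, hj⟩ := by
        simp only [m, hi]
        exact h.mem a.2
      refine ⟨WeyrIndex.of i ⟨lv a, hj⟩ ⟨ix a, ha⟩, Fin.ext (h.inj (Fin.is_lt _) a.2 ?_ ?_ ?_)⟩
      · rw [hg1]; exact hi
      · rw [hg2]; rfl
      · rw [hg3]; rfl
    let o := hgm.orderIsoOfSurjective g hgs
    have ho : ∀ a, g (o.symm a) = a := fun a => o.apply_symm_apply a
    refine ⟨E.card, lam, κ, m, oα.symm.trans o.symm, oβ.symm.trans o.symm, hlam, ?_, ?_, ?_, ?_⟩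
    · intro i
      obtain ⟨a, ha, hai⟩ := hmemE i
      simp only [κ, ← hai]
      exact (Nat.zero_le _).trans_lt (hlen a ha)
    · intro i j j' hj
      exact h.anti (lam i) hj
    · intro i j
      exact (hℓ _ _ _).2 j.2
    · intro x y
      obtain ⟨a, rfl⟩ := oα.surjective x
      obtain ⟨b, rfl⟩ := oβ.surjective y
      have e1 : (oα.symm.trans o.symm) (oα a) = o.symm a := by simp
      have e2 : (oβ.symm.trans o.symm) (oβ b) = o.symm b := by simp
      rw [hW, e1, e2, WeyrIndex.blockDiagonal'_weyrCell_apply hlam.injective]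
      have h1 : ∀ a, lam (o.symm a).cell = ev a := fun a => by rw [← hg1, ho]
      have h2 : ∀ a, ((o.symm a).lv : ℕ) = lv a := fun a => by rw [← hg2, ho]
      have h3 : ∀ a, ((o.symm a).ix : ℕ) = ix a := fun a => by rw [← hg3, ho]
      rw [h1, h1, h2, h2, h3, h3, weyrEntry]
      simp only [EmbeddingLike.apply_eq_iff_eq, Fin.ext_iff]
      split_ifs <;> rfl

end WeyrForm

/-! ### Existence of the Weyr form. -/

section WeyrExistence

variable {k : Type*} [LinearOrder k]

/-- The number of a chain among those with the same eigenvalue, in the order of decreasing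
lengths. -/
def chainRank {m : ℕ} (c : Fin m → k) (e : Fin m → ℕ) (i : Fin m) : ℕ :=
  (Finset.univ.filter fun i' => c i' = c i ∧ (e i < e i' ∨ (e i' = e i ∧ i' < i))).card

/-- The number of chains with a given eigenvalue that are longer than `j`. -/
def chainCount {m : ℕ} (c : Fin m → k) (e : Fin m → ℕ) (x : k) (j : ℕ) : ℕ :=
  (Finset.univ.filter fun i => c i = x ∧ j < e i).card

section

variable {m : ℕ} {c : Fin m → k} {e : Fin m → ℕ}

/-- Ranks follow decreasing length, so the chains longer than `j` occupy an initial segment of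
ranks. Thus the rank of a chain can serve as its place in every level that it reaches. -/
theorem chainRank_lt_chainCount_iff {i : Fin m} {j : ℕ} :
    chainRank c e i < chainCount c e (c i) j ↔ j < e i := by
  constructor
  · intro h
    by_contra hj
    refine h.not_ge (Finset.card_le_card fun i' hi' => ?_)
    simp only [Finset.mem_filter, Finset.mem_univ, true_and] at hi' ⊢
    exact ⟨hi'.1, Or.inl (by omega)⟩
  · intro hj
    refine Finset.card_lt_card ((Finset.ssubset_iff_of_subset fun i' hi' => ?_).2 ⟨i, ?_, ?_⟩)
    · simp only [Finset.mem_filter, Finset.mem_univ, true_and] at hi' ⊢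
      exact ⟨hi'.1, by omega⟩
    · simpa using hj
    · simp

theorem chainRank_injective {i i' : Fin m} (hc : c i = c i')
    (h : chainRank c e i = chainRank c e i') : i = i' := by
  have key : ∀ {i i' : Fin m}, c i = c i' → (e i' < e i ∨ (e i = e i' ∧ i < i')) →
      chainRank c e i < chainRank c e i' := by
    intro i i' hc hlt
    refine Finset.card_lt_card ((Finset.ssubset_iff_of_subset fun x hx => ?_).2 ⟨i, ?_, ?_⟩)
    · simp only [Finset.mem_filter, Finset.mem_univ, true_and] at hx ⊢
      refine ⟨hx.1.trans hc, ?_⟩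
      rcases hx.2 with h1 | ⟨h1, h2⟩ <;> rcases hlt with h3 | ⟨h3, h4⟩
      · exact Or.inl (by omega)
      · exact Or.inl (by omega)
      · exact Or.inl (by omega)
      · exact Or.inr ⟨by omega, h2.trans h4⟩
    · simp only [Finset.mem_filter, Finset.mem_univ, true_and]
      exact ⟨hc, hlt⟩
    · simp
  by_contra hne
  rcases lt_trichotomy (e i) (e i') with h1 | h1 | h1
  · exact (key hc.symm (Or.inl h1)).ne' h
  · rcases lt_or_gt_of_ne hne with h2 | h2
    · exact (key hc (Or.inr ⟨h1, h2⟩)).ne h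
    · exact (key hc.symm (Or.inr ⟨h1.symm, h2⟩)).ne' h
  · exact (key hc (Or.inl h1)).ne h

theorem exists_chainRank_eq {x : k} {j a : ℕ} (h : a < chainCount c e x j) :
    ∃ i, c i = x ∧ chainRank c e i = a := by
  have himg : (Finset.univ.filter fun i => c i = x).image (chainRank c e) =
      Finset.range (Finset.univ.filter fun i => c i = x).card := by
    refine Finset.eq_of_subset_of_card_le ?_ ?_
    · intro b hb
      obtain ⟨i, hi, rfl⟩ := Finset.mem_image.1 hb
      obtain rfl := (Finset.mem_filter.1 hi).2
      refine Finset.mem_range.2 (Finset.card_lt_card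
        ((Finset.ssubset_iff_of_subset fun x hx => ?_).2 ⟨i, by simp, by simp⟩))
      simp only [Finset.mem_filter, Finset.mem_univ, true_and] at hx ⊢
      exact hx.1
    · rw [Finset.card_range, Finset.card_image_of_injOn]
      intro i hi i' hi' hii
      exact chainRank_injective ((Finset.mem_filter.1 (Finset.mem_coe.1 hi)).2.trans
        (Finset.mem_filter.1 (Finset.mem_coe.1 hi')).2.symm) hii
  have ha : a ∈ Finset.range (Finset.univ.filter fun i => c i = x).card := by
    refine Finset.mem_range.2 (h.trans_le (Finset.card_le_card fun i hi => ?_))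
    simp only [Finset.mem_filter, Finset.mem_univ, true_and] at hi ⊢
    exact hi.1
  rw [← himg] at ha
  simpa using ha

/-- Jordan chains can be arranged as the rows of a Weyr matrix. -/
theorem exists_weyrLabelling_of_chains [Zero k] {s : ℕ}
    (hs : Fintype.card (Σ i, Fin (e i)) = s) :
    ∃ (ev : ℕ → k) (lv ix : ℕ → ℕ) (σ : Fin s ≃ Σ i, Fin (e i)),
      IsWeyrLabelling s (chainCount c e) ev lv ix ∧
      ∀ a : Fin s, ev a = c (σ a).1 ∧ lv a = (σ a).2 ∧ ix a = chainRank c e (σ a).1 := by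
  classical
  -- Chain vectors are sorted by eigenvalue, depth in the chain and rank of the chain; this regroups
  -- the Jordan form level by level.
  let lab : (Σ i, Fin (e i)) → k ×ₗ ℕ ×ₗ ℕ := fun x =>
    toLex (c x.1, toLex ((x.2 : ℕ), chainRank c e x.1))
  have hinj : Function.Injective lab := by
    rintro ⟨i, j⟩ ⟨i', j'⟩ h
    have h1 := congrArg ofLex h
    simp only [lab, ofLex_toLex, Prod.mk.injEq, toLex_inj] at h1
    obtain rfl := chainRank_injective h1.1 h1.2.2
    rw [Fin.ext h1.2.1]
  let Y := Finset.univ.image lab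
  have hY : Y.card = s := by rw [Finset.card_image_of_injective _ hinj, Finset.card_univ, hs]
  let o := Y.orderEmbOfFin hY
  have ho : ∀ a, ∃ x, lab x = o a := fun a => by
    obtain ⟨x, -, hx⟩ := Finset.mem_image.1 (Y.orderEmbOfFin_mem hY a)
    exact ⟨x, hx⟩
  choose f hf using ho
  have hbij : Function.Bijective f := by
    rw [Fintype.bijective_iff_injective_and_card]
    refine ⟨fun a b hab => o.injective ?_, by rw [hs, Fintype.card_fin]⟩
    rw [← hf, ← hf, hab]
  let σ := Equiv.ofBijective f hbij
  refine ⟨fun a => if h : a < s then c (f ⟨a, h⟩).1 else 0,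
    fun a => if h : a < s then (f ⟨a, h⟩).2 else 0,
    fun a => if h : a < s then chainRank c e (f ⟨a, h⟩).1 else 0, σ, ⟨?_, ?_, ?_⟩, ?_⟩
  · intro x j j' hj
    refine Finset.card_le_card fun i hi => ?_
    simp only [Finset.mem_filter, Finset.mem_univ, true_and] at hi ⊢
    exact ⟨hi.1, by omega⟩
  · intro a b hab hb
    have : o ⟨a, hab.trans hb⟩ < o ⟨b, hb⟩ := o.strictMono hab
    rw [← hf, ← hf] at this
    simp only [lab, Prod.Lex.toLex_lt_toLex] at this
    simpa only [dif_pos hb, dif_pos (hab.trans hb)] using this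
  · intro x j a
    constructor
    · intro ha
      obtain ⟨i, rfl, rfl⟩ := exists_chainRank_eq ha
      have hj := chainRank_lt_chainCount_iff.1 ha
      refine ⟨σ.symm ⟨i, j, hj⟩, Fin.is_lt _, ?_⟩
      have : f (σ.symm ⟨i, j, hj⟩) = ⟨i, j, hj⟩ := σ.apply_symm_apply _
      simp only [Fin.is_lt, dif_pos, Fin.eta, this]
      exact ⟨trivial, congrArg (fun x => (x.2 : ℕ)) this, trivial⟩
    · rintro ⟨b, hb, rfl, rfl, rfl⟩
      simp only [dif_pos hb]
      exact chainRank_lt_chainCount_iff.2 (Fin.is_lt _)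
  · intro a
    simp only [Fin.is_lt, dif_pos, Fin.eta]
    exact ⟨rfl, rfl, rfl⟩

end

open Matrix in
/-- Every square matrix over an algebraically closed field is similar to a Weyr matrix. -/
theorem exists_weyr_form [Field k] [IsAlgClosed k] {s : ℕ} (A : Matrix (Fin s) (Fin s) k) :
    ∃ μ ev lv ix, IsWeyrLabelling s μ ev lv ix ∧ ∃ G : Matrix (Fin s) (Fin s) k, IsUnit G ∧
      A * G = G * Matrix.of fun a b : Fin s => weyrEntry ev lv ix a b := by
  obtain ⟨m, c, e, b, hb⟩ := exists_chain_basis (Matrix.toLin' A)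
  have hcard : Fintype.card (Σ i, Fin (e i)) = s := by
    rw [← Module.finrank_eq_card_basis b, Module.finrank_fin_fun]
  obtain ⟨ev, lv, ix, σ, h, hσ⟩ := exists_weyrLabelling_of_chains (c := c) hcard
  -- The columns of the transforming matrix are the chain vectors in the order of their labels.
  let b' := b.reindex σ.symm
  have hb' : ∀ a, b' a = b (σ a) := fun a => by simp [b']
  refine ⟨_, ev, lv, ix, h, (Pi.basisFun k (Fin s)).toMatrix b', ?_, ?_⟩
  · let := (Pi.basisFun k (Fin s)).invertibleToMatrix b'
    exact isUnit_of_invertible _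
  · have hG : ∀ y a, (Pi.basisFun k (Fin s)).toMatrix b' y a = b (σ a) y := fun y a => by
      rw [Module.Basis.toMatrix_apply, hb', Pi.basisFun_repr]
    ext y a
    have h1 : (A * (Pi.basisFun k (Fin s)).toMatrix b') y a = Matrix.toLin' A (b (σ a)) y := by
      rw [Matrix.toLin'_apply, Matrix.mul_apply, Matrix.mulVec, dotProduct]
      exact Finset.sum_congr rfl fun x _ => by rw [hG]
    let g : ℕ → k := fun x => if hx : x < s then b (σ ⟨x, hx⟩) y else 0
    have hg : ∀ x : Fin s, g x = b (σ x) y := fun x => dif_pos x.2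
    have h2 : ((Pi.basisFun k (Fin s)).toMatrix b' * Matrix.of fun a b : Fin s => weyrEntry ev lv ix a b) y a
        = ∑ x ∈ Finset.range s, g x * weyrEntry ev lv ix x a := by
      rw [Finset.sum_range, Matrix.mul_apply]
      exact Finset.sum_congr rfl fun x _ => by rw [hG, hg]; rfl
    obtain ⟨e1, e2, e3⟩ := hσ a
    rw [h1, h2, sum_mul_weyrEntry ev lv ix g a.2, hg, show b (σ a) = b ⟨(σ a).1, (σ a).2⟩ from rfl,
      hb, Pi.add_apply, Pi.smul_apply, smul_eq_mul, ← e1, mul_comm]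
    congr 1
    by_cases h0 : ((σ a).2 : ℕ) = 0
    · rw [dif_pos h0, if_pos (e2.trans h0)]
      rfl
    · rw [dif_neg h0, if_neg (fun x => h0 (e2.symm.trans x))]
      -- The preceding vector of the chain has the same eigenvalue and rank and a level smaller by
      -- one, so it is the row that `labelSum` selects.
      obtain ⟨f1, f2, f3⟩ := hσ (σ.symm ⟨(σ a).1, (σ a).2 - 1, by omega⟩)
      rw [Equiv.apply_symm_apply] at f1 f2 f3
      dsimp only at f1 f2 f3
      have key := h.labelSum_apply g (Fin.is_lt (σ.symm ⟨(σ a).1, (σ a).2 - 1, by omega⟩))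
      rw [f1, f2, f3, hg, Equiv.apply_symm_apply] at key
      rw [e1, e2, e3, key]

end WeyrExistence

/-! ### The rank form under equivalence. -/

section RankForm

variable {k : Type*} [Field k]

theorem exists_basis_of_isCompl {s a b : ℕ} {p q : Submodule k (Fin s → k)} (h : IsCompl p q)
    (bp : Module.Basis (Fin a) k p) (bq : Module.Basis (Fin b) k q) (hs : a + b = s) :
    ∃ B : Module.Basis (Fin s) k (Fin s → k),
      (∀ i : Fin a, B ⟨i, by omega⟩ = bp i) ∧ (∀ i : Fin b, B ⟨a + i, by omega⟩ = bq i) := by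
  subst hs
  refine ⟨((bp.prod bq).map (p.prodEquivOfIsCompl q h)).reindex finSumFinEquiv, ?_, ?_⟩
  · intro i
    rw [show (⟨i, by omega⟩ : Fin (a + b)) = finSumFinEquiv (Sum.inl i) from rfl]
    simp
  · intro i
    rw [show (⟨a + i, by omega⟩ : Fin (a + b)) = finSumFinEquiv (Sum.inr i) from rfl]
    simp

/-- Every matrix is equivalent to a matrix `[0 I; 0 0]`. -/
theorem exists_corner_form {s s' : ℕ} (A : Matrix (Fin s) (Fin s') k) :
    ∃ d ≤ s, d ≤ s' ∧ ∃ (P : Matrix (Fin s) (Fin s) k) (Q : Matrix (Fin s') (Fin s') k),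
      IsUnit P ∧ IsUnit Q ∧ A * Q = P * Matrix.of fun (a : Fin s) (b : Fin s') =>
        if (a : ℕ) < d ∧ (b : ℕ) = s' - d + a then (1 : k) else 0 := by
  let f := Matrix.toLin' A
  obtain ⟨C, hC⟩ := (LinearMap.ker f).exists_isCompl
  obtain ⟨R, hR⟩ := (LinearMap.range f).exists_isCompl
  let d := Module.finrank k C
  let g := f.kerComplementEquivRange hC.symm
  let bC := Module.finBasis k C
  let bK := Module.finBasis k (LinearMap.ker f)
  let bR := Module.finBasis k R
  have h1 : Module.finrank k (LinearMap.ker f) + d = s' := by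
    rw [Submodule.finrank_add_eq_of_isCompl hC, Module.finrank_fin_fun]
  have h2 : d + Module.finrank k R = s := by
    have := Submodule.finrank_add_eq_of_isCompl hR
    rwa [Module.finrank_fin_fun, ← g.finrank_eq] at this
  -- In the source the kernel comes first, in the target the images of its complement come first;
  -- the last `d` vectors go to the first `d`, which puts the identity block in the upper right
  -- corner.
  obtain ⟨BV, hV1, hV2⟩ := exists_basis_of_isCompl hC bK bC h1
  obtain ⟨BW, hW1, -⟩ := exists_basis_of_isCompl hR (bC.map g) bR h2
  refine ⟨d, by omega, by omega, (Pi.basisFun k _).toMatrix BW, (Pi.basisFun k _).toMatrix BV,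
    ?_, ?_, ?_⟩
  · let := (Pi.basisFun k (Fin s)).invertibleToMatrix BW
    exact isUnit_of_invertible _
  · let := (Pi.basisFun k (Fin s')).invertibleToMatrix BV
    exact isUnit_of_invertible _
  · ext y b
    have e1 : (A * (Pi.basisFun k (Fin s')).toMatrix BV) y b = f (BV b) y := by
      rw [Matrix.toLin'_apply, Matrix.mul_apply, Matrix.mulVec, dotProduct]
      exact Finset.sum_congr rfl fun x _ => by rw [Module.Basis.toMatrix_apply, Pi.basisFun_repr]
    rw [e1, Matrix.mul_apply]
    by_cases hb : (b : ℕ) < Module.finrank k (LinearMap.ker f)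
    · have : f (BV b) = 0 := by
        have := hV1 ⟨b, hb⟩
        rw [this]
        exact (bK ⟨b, hb⟩).2
      rw [this, Finset.sum_eq_zero]
      · rfl
      · intro a _
        rw [Matrix.of_apply, if_neg (by omega), mul_zero]
    · have hlt : (b : ℕ) - Module.finrank k (LinearMap.ker f) < d := by omega
      have hfb : f (BV b) = BW ⟨b - Module.finrank k (LinearMap.ker f), by omega⟩ := by
        have e2 := hV2 ⟨b - Module.finrank k (LinearMap.ker f), hlt⟩
        have e3 := hW1 ⟨b - Module.finrank k (LinearMap.ker f), hlt⟩
        have e4 : (⟨Module.finrank k (LinearMap.ker f) +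
            (b - Module.finrank k (LinearMap.ker f)), by omega⟩ : Fin s') = b :=
          Fin.ext (by simp only; omega)
        dsimp only at e2 e3
        rw [e4] at e2
        rw [e2, e3]
        simp [g]
      rw [hfb, Finset.sum_eq_single ⟨b - Module.finrank k (LinearMap.ker f), by omega⟩]
      · rw [Module.Basis.toMatrix_apply, Pi.basisFun_repr, Matrix.of_apply, if_pos, mul_one]
        exact ⟨hlt, by simp only; omega⟩
      · intro a _ ha
        rw [Matrix.of_apply, if_neg, mul_zero]
        rintro ⟨h3, h4⟩
        exact ha (Fin.ext (by simp only; omega))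
      · simp

end RankForm

/-! ### Reducing the first nonstable block. -/

namespace ReducedData

section Strips

variable {k : Type*} {n : ℕ} {D : ReducedData k n}

/-- The order-preserving numbering of the indices of a strip. -/
theorem exists_stripIso (i : Fin D.t) {s : ℕ} (hs : D.size i = s) :
    ∃ o : Fin s ≃o {p : Fin n // D.blk p = i}, ∀ a, D.pos (o a) = a := by
  subst hs
  let f : {p : Fin n // D.blk p = i} → Fin (D.size i) := fun p =>
    ⟨D.pos p, by have := D.pos_lt_size p; rwa [p.2] at this⟩
  have hf : StrictMono f := fun p q hpq => (pos_lt_pos_iff (p.2.trans q.2.symm)).2 hpq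
  have hs : Function.Surjective f := fun a => by
    obtain ⟨p, hp, hpa⟩ := exists_pos a.2
    exact ⟨⟨p, hp⟩, Fin.ext hpa⟩
  let o := hf.orderIsoOfSurjective f hs
  exact ⟨o.symm, fun a => congrArg Fin.val (o.apply_symm_apply a)⟩

end Strips

variable {k : Type*} [Field k] {n : ℕ} {D : ReducedData k n}
  {Λ : Subalgebra k (Matrix (Fin n) (Fin n) k)}

/-- The matrix is block-diagonal. -/
def IsBlockDiag (D : ReducedData k n) (S : Matrix (Fin n) (Fin n) k) : Prop :=
  ∀ p q, D.blk p ≠ D.blk q → S p q = 0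

theorem IsBlockDiag.posBlock_mul {S : Matrix (Fin n) (Fin n) k} (hS : D.IsBlockDiag S)
    (A : Matrix (Fin n) (Fin n) k) {i j : Fin D.t} {a b : ℕ} (ha : a < D.size i)
    (hb : b < D.size j) : D.posBlock (S * A) i j a b =
      ∑ c ∈ Finset.range (D.size i), D.posBlock S i i a c * D.posBlock A i j c b := by
  obtain ⟨p, rfl, rfl⟩ := exists_pos ha
  obtain ⟨q, rfl, rfl⟩ := exists_pos hb
  rw [posBlock_pos _ rfl rfl, ← sum_strip_mul, Matrix.mul_apply, Finset.sum_filter]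
  refine Finset.sum_congr rfl fun s _ => ?_
  split_ifs with h
  · rfl
  · rw [hS p s (Ne.symm h), zero_mul]

theorem IsBlockDiag.posBlock_mul_right {S : Matrix (Fin n) (Fin n) k} (hS : D.IsBlockDiag S)
    (A : Matrix (Fin n) (Fin n) k) {i j : Fin D.t} {a b : ℕ} (ha : a < D.size i)
    (hb : b < D.size j) : D.posBlock (A * S) i j a b =
      ∑ c ∈ Finset.range (D.size j), D.posBlock A i j a c * D.posBlock S j j c b := by
  obtain ⟨p, rfl, rfl⟩ := exists_pos ha
  obtain ⟨q, rfl, rfl⟩ := exists_pos hb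
  rw [posBlock_pos _ rfl rfl, ← sum_strip_mul, Matrix.mul_apply, Finset.sum_filter]
  refine Finset.sum_congr rfl fun s _ => ?_
  split_ifs with h
  · rfl
  · rw [hS s q h, mul_zero]

theorem IsBlockDiag.mul {S T : Matrix (Fin n) (Fin n) k} (hS : D.IsBlockDiag S)
    (hT : D.IsBlockDiag T) : D.IsBlockDiag (S * T) := by
  intro p q hpq
  rw [Matrix.mul_apply]
  refine Finset.sum_eq_zero fun s _ => ?_
  by_cases h : D.blk p = D.blk s
  · rw [hT s q (h ▸ hpq), mul_zero]
  · rw [hS p s h, zero_mul]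

theorem isBlockDiag_inflate (l : Fin D.t) (G : ℕ → ℕ → k) : D.IsBlockDiag (D.inflate l G) := by
  classical
  exact fun p q hpq => if_neg fun h => hpq h.1

theorem inflate_congr {l : Fin D.t} {G H : ℕ → ℕ → k}
    (h : ∀ a < D.size l, ∀ b < D.size l, G a b = H a b) : D.inflate l G = D.inflate l H := by
  classical
  ext p q
  rw [inflate_apply, inflate_apply]
  split_ifs with hpq
  · refine h _ ?_ _ ?_
    · rw [← size_eq_of_sim hpq.2]; exact D.pos_lt_size p
    · rw [← size_eq_of_sim hpq.2, hpq.1]; exact D.pos_lt_size q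
  · rfl

/-- Any nonsingular matrix is a diagonal block of a nonsingular block-diagonal matrix of `Λ` whose
blocks at the strips of other classes are identity matrices. -/
theorem Presents.exists_blockDiag (hD : D.Presents Λ) {l : Fin D.t} {s : ℕ} (hs : D.size l = s)
    {G : Matrix (Fin s) (Fin s) k} (hG : IsUnit G) :
    ∃ S ∈ Λ, IsUnit S ∧ D.IsBlockDiag S ∧ (∀ a b : Fin s, D.posBlock S l l a b = G a b) ∧
      ∀ p q, ¬ D.sim (D.blk p) l → S p q = if p = q then 1 else 0 := by
  classical
  subst hs
  let nat : Matrix (Fin (D.size l)) (Fin (D.size l)) k → ℕ → ℕ → k := fun A a b =>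
    if h : a < D.size l ∧ b < D.size l then A ⟨a, h.1⟩ ⟨b, h.2⟩ else 0
  have hnat : ∀ A, ∀ a b : Fin (D.size l), nat A a b = A a b := fun A a b => dif_pos ⟨a.2, b.2⟩
  have hmul : ∀ A B, D.inflate l (nat A) * D.inflate l (nat B) = D.inflate l (nat (A * B)) := by
    intro A B
    rw [inflate_mul]
    refine inflate_congr fun a ha b hb => ?_
    have := hnat (A * B) ⟨a, ha⟩ ⟨b, hb⟩
    dsimp only at this
    rw [this, Finset.sum_range, Matrix.mul_apply]
    exact Finset.sum_congr rfl fun c _ => by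
      rw [← hnat A ⟨a, ha⟩ c, ← hnat B c ⟨b, hb⟩]
  -- `A` on all strips of the class of `l`, the identity on the others. Inverse pairs go to inverse
  -- pairs.
  let S : Matrix (Fin (D.size l)) (Fin (D.size l)) k → Matrix (Fin n) (Fin n) k := fun A =>
    D.inflate l (nat A) + (1 - D.inflate l (nat 1))
  have hS : ∀ A B, A * B = 1 → S A * S B = 1 := by
    intro A B hAB
    simp only [S, add_mul, mul_add, sub_mul, mul_sub, one_mul, mul_one, hmul, hAB]
    abel
  have hSmem : S G ∈ Λ :=
    Λ.add_mem (hD.inflate_mem _ _) (Λ.sub_mem Λ.one_mem (hD.inflate_mem _ _))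
  have hdet := (Matrix.isUnit_iff_isUnit_det _).1 hG
  refine ⟨S G, hSmem, ?_, ?_, ?_, ?_⟩
  · exact ⟨⟨S G, S G⁻¹, hS _ _ (Matrix.mul_nonsing_inv _ hdet),
      hS _ _ (Matrix.nonsing_inv_mul _ hdet)⟩, rfl⟩
  · intro p q hpq
    simp only [S, Matrix.add_apply, Matrix.sub_apply, isBlockDiag_inflate l _ p q hpq,
      Matrix.one_apply_ne (fun h => hpq (congrArg D.blk h)), sub_zero, add_zero]
  · intro a b
    obtain ⟨p, hp, hpa⟩ := exists_pos a.2
    obtain ⟨q, hq, hqb⟩ := exists_pos b.2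
    rw [← hpa, ← hqb, posBlock_pos _ hp hq]
    have hc : D.blk p = D.blk q ∧ D.sim (D.blk p) l := ⟨hp.trans hq.symm, hp ▸ D.sim.refl _⟩
    simp only [S, Matrix.add_apply, Matrix.sub_apply, inflate_apply, if_pos hc, hpa, hqb, hnat]
    rw [Matrix.one_apply, Matrix.one_apply]
    have : p = q ↔ a = b := by
      constructor
      · rintro rfl
        exact Fin.ext (hpa.symm.trans hqb)
      · rintro rfl
        exact eq_of_pos_eq hc.1 (hpa.trans hqb.symm)
    simp only [this, sub_self, add_zero]
  · intro p q hp
    have hc : ¬ (D.blk p = D.blk q ∧ D.sim (D.blk p) l) := fun h => hp h.2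
    simp only [S, Matrix.add_apply, Matrix.sub_apply, inflate_apply, if_neg hc, sub_zero, zero_add,
      Matrix.one_apply]

theorem Presents.sum_upper_left (hD : D.Presents Λ) {T : Matrix (Fin n) (Fin n) k} (hT : T ∈ Λ)
    (A : Matrix (Fin n) (Fin n) k) {p q : Fin n} {l : Fin D.t} (hp : D.blk p = l) :
    (T * A) p q = ∑ s ∈ Finset.univ.filter (fun s => D.blk s = l), T p s * A s q +
      ∑ s ∈ Finset.univ.filter (fun s => l < D.blk s), T p s * A s q := by
  rw [Matrix.mul_apply, Finset.sum_filter, Finset.sum_filter, ← Finset.sum_add_distrib]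
  refine Finset.sum_congr rfl fun s _ => ?_
  rcases lt_trichotomy (D.blk s) l with h | h | h
  · rw [if_neg h.ne, if_neg h.not_gt, hD.tri hT (by rwa [hp]), zero_mul, add_zero]
  · rw [if_pos h, if_neg h.not_gt, add_zero]
  · rw [if_neg h.ne', if_pos h, zero_add]

theorem Presents.sum_upper_right (hD : D.Presents Λ) {T : Matrix (Fin n) (Fin n) k} (hT : T ∈ Λ)
    (A : Matrix (Fin n) (Fin n) k) {p q : Fin n} {r : Fin D.t} (hq : D.blk q = r) :
    (A * T) p q = ∑ s ∈ Finset.univ.filter (fun s => D.blk s = r), A p s * T s q +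
      ∑ s ∈ Finset.univ.filter (fun s => D.blk s < r), A p s * T s q := by
  rw [Matrix.mul_apply, Finset.sum_filter, Finset.sum_filter, ← Finset.sum_add_distrib]
  refine Finset.sum_congr rfl fun s _ => ?_
  rcases lt_trichotomy (D.blk s) r with h | h | h
  · rw [if_neg h.ne, if_pos h, zero_add]
  · rw [if_pos h, if_neg h.not_lt, add_zero]
  · rw [if_neg h.ne', if_neg h.not_gt, hD.tri hT (by rwa [hq]), mul_zero, add_zero]

/-- If no additions to the block `(l, r)` are possible, an intertwining matrix of `Λ` intertwines
the blocks `(l, r)` by its diagonal blocks. -/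
theorem NoAddition.posBlock_eq {M A B : Matrix (Fin n) (Fin n) k} {l r : Fin D.t}
    (hNA : D.NoAddition M l r) (hD : D.Presents Λ)
    (hA : ∀ p q, D.Earlier l r p q → A p q = M p q) (hB : ∀ p q, D.Earlier l r p q → B p q = M p q)
    {T : Matrix (Fin n) (Fin n) k} (hT : T ∈ Λ)
    (h : ∀ p q, D.blk p = l → D.blk q = r → (T * A) p q = (B * T) p q) :
    ∀ a < D.size l, ∀ b < D.size r,
      ∑ c ∈ Finset.range (D.size l), D.posBlock T l l a c * D.posBlock A l r c b =
        ∑ c ∈ Finset.range (D.size r), D.posBlock B l r a c * D.posBlock T r r c b := by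
  intro a ha b hb
  obtain ⟨p, hp, rfl⟩ := exists_pos ha
  obtain ⟨q, hq, rfl⟩ := exists_pos hb
  have h1 := h p q hp hq
  rw [hD.sum_upper_left hT A hp, hD.sum_upper_right hT B hq] at h1
  -- Since `A` and `B` agree with `M` on the earlier blocks, (*) for `T` cancels the off-diagonal
  -- terms of the two sides.
  have h2 := hNA T (((hD T).1 hT).2.2 _ _) p q hp hq
  have h3 : ∑ s ∈ Finset.univ.filter (fun s => l < D.blk s), T p s * A s q =
      ∑ s ∈ Finset.univ.filter (fun s => l < D.blk s), T p s * M s q :=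
    Finset.sum_congr rfl fun s hs => by rw [hA s q (Or.inl (Finset.mem_filter.1 hs).2)]
  have h4 : ∑ s ∈ Finset.univ.filter (fun s => D.blk s < r), B p s * T s q =
      ∑ s ∈ Finset.univ.filter (fun s => D.blk s < r), M p s * T s q :=
    Finset.sum_congr rfl fun s hs => by rw [hB p s (Or.inr ⟨hp, (Finset.mem_filter.1 hs).2⟩)]
  rw [h3, h4, ← h2] at h1
  have h5 := add_right_cancel h1
  rw [sum_strip_mul, sum_strip_mul] at h5
  subst hp hq
  exact h5

/-- The entries of `M` that occur in (*) all belong to earlier blocks. -/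
theorem noAddition_congr {M M' : Matrix (Fin n) (Fin n) k} {l r : Fin D.t}
    (h : ∀ p q, D.Earlier l r p q → M' p q = M p q) (hNA : D.NoAddition M l r) :
    D.NoAddition M' l r := by
  intro S hS p q hp hq
  refine Eq.trans (Finset.sum_congr rfl fun s hs => ?_)
    ((hNA S hS p q hp hq).trans (Finset.sum_congr rfl fun s hs => ?_))
  · rw [h p s (Or.inr ⟨hp, (Finset.mem_filter.1 hs).2⟩)]
  · rw [h s q (Or.inl (Finset.mem_filter.1 hs).2)]

/-- A nonzero admissible addition can be used to make the block `(l, r)` zero. -/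
theorem Presents.exists_addition (hD : D.Presents Λ) {M : Matrix (Fin n) (Fin n) k}
    {l r : Fin D.t} (hE : CommOn Λ M (D.Earlier l r)) (hNA : ¬ D.NoAddition M l r) :
    ∃ N ∈ Λ, (∀ p q, D.blk p = D.blk q → N p q = 0) ∧
      ∀ p q, D.blk p = l → D.blk q = r → (N * M - M * N) p q = M p q := by
  classical
  rw [hD.noAddition_iff hE] at hNA
  push Not at hNA
  obtain ⟨S, hS, hS0, p, q, hp, hq, hne⟩ := hNA
  have hunit : ∀ u v x y, D.blk u = D.blk v → D.blk x ≠ D.blk y → D.unit u v x y = 0 :=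
    fun u v x y h hxy => by rw [unit_apply h, if_neg fun z => hxy z.1]
  -- A nonzero entry of an admissible addition; it will be copied to every place of the block.
  let c := (S * M) p q - (M * S) p q
  have hc : c ≠ 0 := sub_ne_zero.2 (Ne.symm hne)
  let I := Finset.univ.filter fun u => D.blk u = l
  let J := Finset.univ.filter fun v => D.blk v = r
  -- The term for (u, v) carries the entry `c` from (p, q) to (u, v); the weights rebuild `M` on the
  -- whole block.
  let N : Matrix (Fin n) (Fin n) k := ∑ u ∈ I, ∑ v ∈ J,
    (M u v * c⁻¹) • (D.unit u p * S * D.unit q v)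
  have hu : ∀ u ∈ I, D.blk u = D.blk p := fun u hu => (Finset.mem_filter.1 hu).2.trans hp.symm
  have hv : ∀ v ∈ J, D.blk q = D.blk v := fun v hv => hq.trans (Finset.mem_filter.1 hv).2.symm
  have hterm : ∀ u ∈ I, ∀ v ∈ J, ∀ x y, D.blk x = D.blk y →
      (D.unit u p * S * D.unit q v) x y = 0 := by
    intro u hu' v hv' x y hxy
    by_cases hy : D.Twin y v
    · obtain ⟨q', hq', hqq⟩ := D.exists_pos_eq q (i := D.blk y)
        (by rw [hv v hv']; exact D.sim.symm hy.1)
      have htq : D.Twin q' q := ⟨by rw [hq', hv v hv']; exact hy.1, hqq⟩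
      rw [mul_unit_apply (hv v hv') _ hy htq hq']
      by_cases hx : D.Twin x u
      · obtain ⟨p', hp', hpp⟩ := D.exists_pos_eq p (i := D.blk x)
          (by rw [← hu u hu']; exact D.sim.symm hx.1)
        have htp : D.Twin p' p := ⟨by rw [hp', ← hu u hu']; exact hx.1, hpp⟩
        rw [unit_mul_apply (hu u hu') _ hx htp hp']
        exact hS0 _ _ (hp'.trans (hxy.trans hq'.symm))
      · exact unit_mul_apply_of_not (hu u hu') _ hx
    · exact mul_unit_apply_of_not (hv v hv') _ hy
  have hcomm : ∀ u ∈ I, ∀ v ∈ J, ∀ x y, D.blk x = l → D.blk y = r →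
      (D.unit u p * S * D.unit q v * M - M * (D.unit u p * S * D.unit q v)) x y =
        if x = u ∧ y = v then c else 0 := by
    intro u hu' v hv' x y hx hy
    -- A matrix unit of Λ commutes with `M` on the earlier blocks, and the left factor vanishes at
    -- the other places of row `x`. In `e2` the same happens for columns.
    have e1 : (D.unit u p * S * D.unit q v * M) x y = (D.unit u p * S * (M * D.unit q v)) x y := by
      rw [mul_assoc, Matrix.mul_apply, Matrix.mul_apply]
      refine Finset.sum_congr rfl fun s _ => ?_
      by_cases hs : l < D.blk s
      · rw [hE _ (hD.unit_mem q v) s y (Or.inl hs)]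
      · suffices (D.unit u p * S) x s = 0 by rw [this, zero_mul, zero_mul]
        rw [Matrix.mul_apply]
        refine Finset.sum_eq_zero fun z _ => ?_
        by_cases hz : D.blk x = D.blk z
        · rcases (not_lt.1 hs).lt_or_eq with h | h
          · rw [hD.tri hS (by rwa [← hz, hx]), mul_zero]
          · rw [hS0 z s (hz.symm.trans (hx.trans h.symm)), mul_zero]
        · rw [hunit u p x z (hu u hu') hz, zero_mul]
    have e2 : (M * (D.unit u p * S * D.unit q v)) x y = (D.unit u p * M * (S * D.unit q v)) x y := by
      rw [mul_assoc (D.unit u p) S, ← mul_assoc, Matrix.mul_apply, Matrix.mul_apply]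
      refine Finset.sum_congr rfl fun s _ => ?_
      by_cases hs : D.blk s < r
      · rw [hE _ (hD.unit_mem u p) x s (Or.inr ⟨hx, hs⟩)]
      · suffices (S * D.unit q v) s y = 0 by rw [this, mul_zero, mul_zero]
        rw [Matrix.mul_apply]
        refine Finset.sum_eq_zero fun z _ => ?_
        by_cases hz : D.blk z = D.blk y
        · rcases (not_lt.1 hs).lt_or_eq with h | h
          · rw [hD.tri hS (by rwa [hz, hy]), zero_mul]
          · rw [hS0 s z (by rw [← h, hz, hy]), zero_mul]
        · rw [hunit q v z y (hv v hv') hz, mul_zero]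
    rw [Matrix.sub_apply, e1, e2,
      show D.unit u p * S * (M * D.unit q v) = D.unit u p * (S * M * D.unit q v) by
        simp only [mul_assoc],
      show D.unit u p * M * (S * D.unit q v) = D.unit u p * (M * S * D.unit q v) by
        simp only [mul_assoc], ← Matrix.sub_apply, ← mul_sub, ← sub_mul]
    have hxu : D.blk x = D.blk u := hx.trans (Finset.mem_filter.1 hu').2.symm
    have hyv : D.blk y = D.blk v := hy.trans (Finset.mem_filter.1 hv').2.symm
    split_ifs with hxy
    · obtain ⟨rfl, rfl⟩ := hxy
      rw [unit_mul_apply (hu x hu') _ (Twin.refl x) (Twin.refl p) (hu x hu').symm,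
        mul_unit_apply (hv y hv') _ (Twin.refl y) (Twin.refl q) (hv y hv'), Matrix.sub_apply]
    · by_cases hx' : x = u
      · rw [unit_mul_apply (hu u hu') _ (hx' ▸ Twin.refl x) (Twin.refl p) (hp.trans hx.symm)]
        exact mul_unit_apply_of_not (hv v hv') _ fun ht => hxy ⟨hx', ht.eq hyv⟩
      · exact unit_mul_apply_of_not (hu u hu') _ fun ht => hx' (ht.eq hxu)
  refine ⟨N, ?_, ?_, ?_⟩
  · exact Λ.sum_mem fun u _ => Λ.sum_mem fun v _ => Λ.smul_mem
      (Λ.mul_mem (Λ.mul_mem (hD.unit_mem _ _) hS) (hD.unit_mem _ _)) _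
  · intro x y hxy
    simp only [N, Matrix.sum_apply, Matrix.smul_apply]
    exact Finset.sum_eq_zero fun u hu' => Finset.sum_eq_zero fun v hv' => by
      rw [hterm u hu' v hv' x y hxy, smul_zero]
  · intro x y hx hy
    have hN : N * M - M * N = ∑ u ∈ I, ∑ v ∈ J, (M u v * c⁻¹) •
        (D.unit u p * S * D.unit q v * M - M * (D.unit u p * S * D.unit q v)) := by
      simp only [N, Finset.sum_mul, Finset.mul_sum, smul_sub, Finset.sum_sub_distrib, smul_mul_assoc,
        mul_smul_comm]
    simp only [hN, Matrix.sum_apply, Matrix.smul_apply]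
    rw [Finset.sum_eq_single x, Finset.sum_eq_single y]
    · rw [hcomm x (by simp [I, hx]) y (by simp [J, hy]) x y hx hy, if_pos ⟨rfl, rfl⟩, smul_eq_mul,
        mul_assoc, inv_mul_cancel₀ hc, mul_one]
    · intro v hv' hvy
      rw [hcomm x (by simp [I, hx]) v hv' x y hx hy, if_neg fun h => hvy h.2.symm, smul_zero]
    · intro h; exact absurd (by simp [J, hy]) h
    · intro u hu' hux
      refine Finset.sum_eq_zero fun v hv' => ?_
      rw [hcomm u hu' v hv' x y hx hy, if_neg fun h => hux h.1.symm, smul_zero]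
    · intro h; exact absurd (by simp [I, hx]) h

end ReducedData

namespace ReducedData

section Block

variable {k : Type*} {n : ℕ} {D : ReducedData k n}

theorem block_eq_iff {A B : Matrix (Fin n) (Fin n) k} {l r : Fin D.t} :
    D.block A l r = D.block B l r ↔ ∀ p q, D.blk p = l → D.blk q = r → A p q = B p q := by
  constructor
  · rintro h p q rfl rfl
    exact congrFun (congrFun h ⟨p, rfl⟩) ⟨q, rfl⟩
  · intro h
    ext ⟨p, hp⟩ ⟨q, hq⟩
    exact h p q hp hq

end Block

variable {k : Type*} [Field k] {n : ℕ} {D : ReducedData k n}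
  {Λ : Subalgebra k (Matrix (Fin n) (Fin n) k)}

/-- On earlier blocks every matrix of Λ commutes with M' already. The condition thus extends to a
lower set, on which products by matrices of Λ are controlled. -/
theorem CommOn.mem_next_iff {M' : Matrix (Fin n) (Fin n) k} {l r : Fin D.t}
    (hE : CommOn Λ M' (D.Earlier l r)) {X : Matrix (Fin n) (Fin n) k} :
    (X ∈ Λ ∧ D.block (X * M') l r = D.block (M' * X) l r) ↔
      (X ∈ Λ ∧ ∀ p q, D.Upto l r p q → (X * M') p q = (M' * X) p q) := by
  refine and_congr_right fun hX => ?_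
  rw [block_eq_iff]
  refine ⟨fun h p q hpq => ?_, fun h p q hp hq => h p q (Or.inr ⟨hp, hq.le⟩)⟩
  rcases upto_iff.1 hpq with hpq | ⟨hp, hq⟩
  · exact hE X hX p q hpq
  · exact h p q hp hq

theorem isUnit_one_add_strict (D : ReducedData k n) {N : Matrix (Fin n) (Fin n) k}
    (h : ∀ p q, D.blk q ≤ D.blk p → N p q = 0) : IsUnit (1 + N) := by
  have htri : (1 + N).BlockTriangular id := by
    intro p q hpq
    have hpq : q < p := hpq
    rw [Matrix.add_apply, h p q (D.blk_mono hpq.le), Matrix.one_apply_ne hpq.ne', add_zero]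
  rw [Matrix.isUnit_iff_isUnit_det, Matrix.det_of_isUpperTriangular htri]
  simp [h]

theorem mul_conj {S M : Matrix (Fin n) (Fin n) k} (hS : IsUnit S) : S * (S⁻¹ * M * S) = M * S := by
  rw [mul_assoc, ← mul_assoc, Matrix.mul_nonsing_inv _ ((Matrix.isUnit_iff_isUnit_det _).1 hS),
    one_mul]

/-- Reduction of a block to which an addition is admissible. -/
theorem Presents.exists_reduce_addition [Infinite k] (hD : D.Presents Λ)
    {M : Matrix (Fin n) (Fin n) k} {l r : Fin D.t} (hE : CommOn Λ M (D.Earlier l r))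
    (hNA : ¬ D.NoAddition M l r) :
    ∃ S ∈ Λ, IsUnit S ∧ (∀ p q, D.blk p = D.blk q → S p q = if p = q then 1 else 0) ∧
      D.block (S⁻¹ * M * S) l r = 0 := by
  obtain ⟨N, hN, hN0, hNM⟩ := hD.exists_addition hE hNA
  have hNt : ∀ p q, D.blk q ≤ D.blk p → N p q = 0 := fun p q hpq => by
    rcases hpq.lt_or_eq with h | h
    · exact hD.tri hN h
    · exact hN0 p q h.symm
  have hS : 1 + N ∈ Λ := Λ.add_mem Λ.one_mem hN
  have hu : IsUnit (1 + N) := D.isUnit_one_add_strict hNt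
  refine ⟨1 + N, hS, hu, ?_, ?_⟩
  · intro p q hpq
    rw [Matrix.add_apply, hN0 p q hpq, add_zero, Matrix.one_apply]
  · ext ⟨p, hp⟩ ⟨q, hq⟩
    change ((1 + N)⁻¹ * M * (1 + N)) p q = 0
    have hagree := (hD.commOn_iff (isLower_earlier l r) M).1 hE _ hS hu
    have h1 := congrFun (congrFun (mul_conj (M := M) hu) p) q
    set M' := (1 + N)⁻¹ * M * (1 + N)
    -- `N` is strictly upper block-triangular, so it sees only lower strips of M', where M' equals
    -- `M`. Then (1 + N) M' = M (1 + N) gives M' = M - (N M - M N) = 0 on the block.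
    have h2 : (N * M') p q = (N * M) p q := by
      rw [Matrix.mul_apply, Matrix.mul_apply]
      refine Finset.sum_congr rfl fun s _ => ?_
      by_cases hs : D.blk s ≤ D.blk p
      · rw [hNt p s hs, zero_mul, zero_mul]
      · rw [hagree s q (Or.inl (hp ▸ not_le.1 hs))]
    have h3 := hNM p q hp hq
    rw [add_mul, one_mul, mul_add, mul_one, Matrix.add_apply, Matrix.add_apply, h2] at h1
    rw [Matrix.sub_apply] at h3
    linear_combination h1 - h3

theorem posBlock_conj {S M : Matrix (Fin n) (Fin n) k} (hS : D.IsBlockDiag S) (hu : IsUnit S)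
    {l r : Fin D.t} {a b : ℕ} (ha : a < D.size l) (hb : b < D.size r) :
    ∑ c ∈ Finset.range (D.size l), D.posBlock S l l a c * D.posBlock (S⁻¹ * M * S) l r c b =
      ∑ c ∈ Finset.range (D.size r), D.posBlock M l r a c * D.posBlock S r r c b := by
  rw [← hS.posBlock_mul _ ha hb, ← hS.posBlock_mul_right _ ha hb, mul_conj hu]

/-- Reduction of a block by equivalence transformations. -/
theorem Presents.exists_reduce_corner (hD : D.Presents Λ) (M : Matrix (Fin n) (Fin n) k)
    {l r : Fin D.t} (hlr : ¬ D.sim l r) :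
    ∃ S ∈ Λ, IsUnit S ∧ D.IsCornerBlock (S⁻¹ * M * S) l r := by
  let A : Matrix (Fin (D.size l)) (Fin (D.size r)) k := Matrix.of fun a b => D.posBlock M l r a b
  obtain ⟨d, hd, hd', P, Q, hP, hQ, hPQ⟩ := exists_corner_form A
  -- As l ≁ r, the diagonal blocks `P` at `l` and `Q` at `r` can be prescribed independently, each
  -- by its own factor.
  obtain ⟨S₁, hS₁, hu₁, hb₁, hl₁, ho₁⟩ := hD.exists_blockDiag (l := l) rfl hP
  obtain ⟨S₂, hS₂, hu₂, hb₂, hl₂, ho₂⟩ := hD.exists_blockDiag (l := r) rfl hQ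
  have hrl : ¬ D.sim r l := fun h => hlr (D.sim.symm h)
  have hbd := hb₁.mul hb₂
  have hSl : ∀ a b : Fin (D.size l), D.posBlock (S₁ * S₂) l l a b = P a b := by
    intro a b
    rw [hb₁.posBlock_mul _ a.2 b.2, Finset.sum_range, Finset.sum_eq_single b, hl₁]
    · obtain ⟨q, hq, hqb⟩ := exists_pos b.2
      rw [← hqb, posBlock_pos _ hq hq, ho₂ q q (by rwa [hq]), if_pos rfl, mul_one]
    · intro c _ hcb
      obtain ⟨p, hp, hpa⟩ := exists_pos c.2
      obtain ⟨q, hq, hqb⟩ := exists_pos b.2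
      rw [← hpa, ← hqb, posBlock_pos S₂ hp hq, ho₂ p q (by rwa [hp]), if_neg,
        mul_zero]
      rintro rfl
      exact hcb (Fin.ext (hpa.symm.trans hqb))
    · simp
  have hSr : ∀ a b : Fin (D.size r), D.posBlock (S₁ * S₂) r r a b = Q a b := by
    intro a b
    rw [hb₁.posBlock_mul _ a.2 b.2, Finset.sum_range, Finset.sum_eq_single a, hl₂]
    · obtain ⟨q, hq, hqb⟩ := exists_pos a.2
      rw [← hqb, posBlock_pos _ hq hq, ho₁ q q (by rwa [hq]), if_pos rfl, one_mul]
    · intro c _ hca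
      obtain ⟨p, hp, hpa⟩ := exists_pos a.2
      obtain ⟨q, hq, hqc⟩ := exists_pos c.2
      rw [← hpa, ← hqc, posBlock_pos S₁ hp hq, ho₁ p q (by rwa [hp]), if_neg, zero_mul]
      rintro rfl
      exact hca (Fin.ext (hqc.symm.trans hpa))
    · simp
  refine ⟨S₁ * S₂, Λ.mul_mem hS₁ hS₂, hu₁.mul hu₂, d, hd, hd', ?_⟩
  set M' := (S₁ * S₂)⁻¹ * M * (S₁ * S₂) with hM'
  let A' : Matrix (Fin (D.size l)) (Fin (D.size r)) k := Matrix.of fun a b => D.posBlock M' l r a b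
  have hPA : P * A' = P * Matrix.of fun (a : Fin (D.size l)) (b : Fin (D.size r)) =>
      if (a : ℕ) < d ∧ (b : ℕ) = D.size r - d + a then (1 : k) else 0 := by
    rw [← hPQ]
    ext a b
    have := posBlock_conj (M := M) hbd (hu₁.mul hu₂) a.2 b.2
    rw [Finset.sum_range, Finset.sum_range] at this
    simp only [hSl, hSr] at this
    rw [Matrix.mul_apply, Matrix.mul_apply]
    exact this
  have hA' := congrArg (P⁻¹ * ·) hPA
  simp only [← Matrix.mul_assoc, Matrix.nonsing_inv_mul _ ((Matrix.isUnit_iff_isUnit_det _).1 hP),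
    Matrix.one_mul] at hA'
  intro p q hp hq
  have hpl : D.pos p < D.size l := hp ▸ D.pos_lt_size p
  have hql : D.pos q < D.size r := hq ▸ D.pos_lt_size q
  have := congrFun (congrFun hA' ⟨D.pos p, hpl⟩) ⟨D.pos q, hql⟩
  rw [← posBlock_pos M' hp hq]
  exact this

theorem isWeyr_block_iff [LinearOrder k] {l r : Fin D.t} (hlr : D.sim l r)
    (M : Matrix (Fin n) (Fin n) k) :
    IsWeyr (D.block M l r) ↔ ∃ μ ev lv ix, IsWeyrLabelling (D.size l) μ ev lv ix ∧
      ∀ a < D.size l, ∀ b < D.size l, D.posBlock M l r a b = weyrEntry ev lv ix a b := by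
  obtain ⟨ol, hol⟩ := D.exists_stripIso l rfl
  obtain ⟨or, hor⟩ := D.exists_stripIso r (size_eq_of_sim hlr).symm
  rw [isWeyr_iff ol or]
  have key : ∀ a b : Fin (D.size l), D.block M l r (ol a) (or b) = D.posBlock M l r a b := by
    intro a b
    conv_rhs => rw [← hol, ← hor, posBlock_pos M (ol a).2 (or b).2]
    rfl
  refine exists_congr fun μ => exists_congr fun ev => exists_congr fun lv => exists_congr fun ix =>
    and_congr_right fun _ => ?_
  constructor
  · intro h a ha b hb
    rw [← h ⟨a, ha⟩ ⟨b, hb⟩, key]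
  · intro h a b
    rw [key, h a a.2 b b.2]

/-- Reduction of a block by similarity transformations. -/
theorem Presents.exists_reduce_weyr [LinearOrder k] [IsAlgClosed k] (hD : D.Presents Λ)
    (M : Matrix (Fin n) (Fin n) k) {l r : Fin D.t} (hlr : D.sim l r) :
    ∃ S ∈ Λ, IsUnit S ∧ IsWeyr (D.block (S⁻¹ * M * S) l r) := by
  let A : Matrix (Fin (D.size l)) (Fin (D.size l)) k := Matrix.of fun a b => D.posBlock M l r a b
  obtain ⟨μ, ev, lv, ix, hW, G, hG, hAG⟩ := exists_weyr_form A
  obtain ⟨S, hS, hu, hb, hl, -⟩ := hD.exists_blockDiag (l := l) rfl hG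
  refine ⟨S, hS, hu, (isWeyr_block_iff hlr _).2 ⟨μ, ev, lv, ix, hW, ?_⟩⟩
  let A' : Matrix (Fin (D.size l)) (Fin (D.size l)) k :=
    Matrix.of fun a b => D.posBlock (S⁻¹ * M * S) l r a b
  have hsz := size_eq_of_sim hlr
  have hGA : G * A' = G * Matrix.of fun a b : Fin (D.size l) => weyrEntry ev lv ix a b := by
    rw [← hAG]
    ext a b
    have := posBlock_conj (M := M) hb hu a.2 (b.2.trans_eq hsz)
    rw [← hsz, Finset.sum_range, Finset.sum_range] at this
    -- Since l ∼ r, the block at `r` is again `G`, and the transformation is a similarity.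
    have hr : ∀ c : Fin (D.size l), D.posBlock S r r c b = G c b := fun c => by
      rw [← hD.posBlock_eq hS hlr c.2 b.2, hl]
    simp only [hl, hr] at this
    rw [Matrix.mul_apply, Matrix.mul_apply]
    exact this
  have hA' := hG.mul_left_cancel hGA
  intro a ha b hb
  exact congrFun (congrFun hA' ⟨a, ha⟩) ⟨b, hb⟩

/-- If the algorithm has not stopped, a step is possible. -/
theorem Presents.exists_step [LinearOrder k] [IsAlgClosed k] (hD : D.Presents Λ)
    {M : Matrix (Fin n) (Fin n) k} (h : ¬ BelitskiiStops (M, Λ)) :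
    ∃ s', BelitskiiStep (M, Λ) s' := by
  have : Infinite k := IsAlgClosed.instInfinite
  obtain ⟨l, r, hlr⟩ := exists_firstNonstable (D := D) h
  have hE := (hD.firstNonstable_iff.1 hlr).1
  have key : ∃ S ∈ Λ, IsUnit S ∧
      ((¬ D.NoAddition M l r ∧ (∀ p q, D.blk p = D.blk q → S p q = if p = q then 1 else 0) ∧
          D.block (S⁻¹ * M * S) l r = 0) ∨
        (D.NoAddition M l r ∧ ¬ D.sim l r ∧ D.IsCornerBlock (S⁻¹ * M * S) l r) ∨
        (D.NoAddition M l r ∧ D.sim l r ∧ IsWeyr (D.block (S⁻¹ * M * S) l r))) := by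
    by_cases hNA : D.NoAddition M l r
    · by_cases hs : D.sim l r
      · obtain ⟨S, hS, hu, hW⟩ := hD.exists_reduce_weyr M hs
        exact ⟨S, hS, hu, Or.inr (Or.inr ⟨hNA, hs, hW⟩)⟩
      · obtain ⟨S, hS, hu, hW⟩ := hD.exists_reduce_corner M hs
        exact ⟨S, hS, hu, Or.inr (Or.inl ⟨hNA, hs, hW⟩)⟩
    · obtain ⟨S, hS, hu, h1, h2⟩ := hD.exists_reduce_addition hE hNA
      exact ⟨S, hS, hu, Or.inl ⟨hNA, h1, h2⟩⟩
  obtain ⟨S, hS, hu, hcase⟩ := key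
  refine ⟨(S⁻¹ * M * S, hD.commSubalgebra (isLower_upto l r) (S⁻¹ * M * S)), D, hD, l, r, hlr,
    ⟨S, hS, hu, rfl, hcase⟩, fun X => ?_⟩
  rw [(hE.conj hD (isLower_earlier l r) hS hu).mem_next_iff]
  exact hD.mem_commSubalgebra (isLower_upto l r)

end ReducedData

/-! ### The next algebra is reduced: refinements and the zero block. -/

namespace ReducedData

section Refine

variable {k : Type*} {n : ℕ} {D : ReducedData k n}

/-- The strip map of a refinement of the partition into strips. -/
def refine {L : Type*} (D : ReducedData k n) (sub : Fin n → L) (p : Fin n) : Fin D.t ×ₗ L :=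
  toLex (D.blk p, sub p)

theorem refine_eq_iff {L : Type*} {sub : Fin n → L} {p q : Fin n} :
    D.refine sub p = D.refine sub q ↔ D.blk p = D.blk q ∧ sub p = sub q := by
  rw [refine, refine, toLex_inj, Prod.mk.injEq]

theorem refine_lt_iff {L : Type*} [LinearOrder L] {sub : Fin n → L} {p q : Fin n} :
    D.refine sub p < D.refine sub q ↔ D.blk p < D.blk q ∨ D.blk p = D.blk q ∧ sub p < sub q :=
  Prod.Lex.toLex_lt_toLex

theorem refine_mono {L : Type*} [LinearOrder L] {sub : Fin n → L}
    (h : ∀ p q, D.blk p = D.blk q → D.pos p < D.pos q → sub p ≤ sub q) :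
    Monotone (D.refine sub) := by
  intro p q hpq
  rw [refine, refine, Prod.Lex.toLex_le_toLex]
  rcases (D.blk_mono hpq).lt_or_eq with hb | hb
  · exact Or.inl hb
  · refine Or.inr ⟨hb, ?_⟩
    rcases hpq.lt_or_eq with hlt | rfl
    · exact h p q hb ((pos_lt_pos_iff hb).2 hlt)
    · exact le_rfl

/-- The colouring of indices by twin classes. -/
def key (D : ReducedData k n) (p : Fin n) : Quotient D.sim × ℕ := (D.cls (D.blk p), D.pos p)

theorem key_eq_iff {p q : Fin n} : D.key p = D.key q ↔ D.Twin p q := by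
  rw [key, key, Prod.mk.injEq]
  exact and_congr_left fun _ => Quotient.eq

theorem isFrame (D : ReducedData k n) : IsFrame D.blk D.key := by
  refine ⟨D.blk_mono, fun p q h hk => (key_eq_iff.1 hk).eq h, fun p q p' hpq hk => ?_⟩
  have ht := key_eq_iff.1 hk
  obtain ⟨q', hq', hqq⟩ := D.exists_pos_eq q (i := D.blk p') (hpq ▸ ht.1)
  refine ⟨q', hq', key_eq_iff.2 ⟨?_, hqq⟩, fun hlt => ?_⟩
  · rw [hq', ← hpq]; exact D.sim.symm ht.1
  · rw [← pos_lt_pos_iff hq', hqq, ← ht.2]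
    exact (pos_lt_pos_iff hpq.symm).2 hlt

end Refine

variable {k : Type*} [Field k] {n : ℕ} {D : ReducedData k n}
  {Λ Λ' : Subalgebra k (Matrix (Fin n) (Fin n) k)} {M M' : Matrix (Fin n) (Fin n) k}
  {l r : Fin D.t}

/-- Twins share their part and their colour, so a block-diagonal matrix of the refined frame is
block-diagonal with equal blocks on equivalent strips for the old data. -/
theorem Presents.mem_of_refine (hD : D.Presents Λ) {L K : Type*} {sub : Fin n → L} {key : Fin n → K}
    (hsub : ∀ p q, D.Twin p q → sub p = sub q) (hkey : ∀ p q, D.Twin p q → key p = key q)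
    {X : Matrix (Fin n) (Fin n) k} (h0 : ∀ p q, D.refine sub p ≠ D.refine sub q → X p q = 0)
    (h1 : ∀ p q p' q', D.refine sub p = D.refine sub q → D.refine sub p' = D.refine sub q' →
      key p = key p' → key q = key q' → X p q = X p' q') : X ∈ Λ ∧ D.IsBlockDiag X := by
  have hbd : D.IsBlockDiag X := fun p q hpq => h0 p q fun h => hpq (refine_eq_iff.1 h).1
  refine ⟨hD.mem_of_blockDiag hbd fun p q p' q' hpq hpq' hp hq => ?_, hbd⟩
  by_cases hs : sub p = sub q
  · exact h1 p q p' q' (refine_eq_iff.2 ⟨hpq, hs⟩)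
      (refine_eq_iff.2 ⟨hpq', by rw [← hsub p p' hp, ← hsub q q' hq, hs]⟩) (hkey p p' hp)
      (hkey q q' hq)
  · rw [h0 p q fun h => hs (refine_eq_iff.1 h).2, h0 p' q' fun h => hs ?_]
    rw [hsub p p' hp, hsub q q' hq, (refine_eq_iff.1 h).2]

theorem Presents.apply_eq_posBlock (hD : D.Presents Λ) {X : Matrix (Fin n) (Fin n) k} (hX : X ∈ Λ)
    {p q : Fin n} (hpq : D.blk p = D.blk q) {i : Fin D.t} (hi : D.sim (D.blk p) i) :
    X p q = D.posBlock X i i (D.pos p) (D.pos q) := by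
  rw [← hD.posBlock_eq hX hi (D.pos_lt_size p) (hpq ▸ D.pos_lt_size q), posBlock_pos X rfl hpq.symm]

/-- The algebra of the next step of the algorithm. -/
def IsNext (D : ReducedData k n) (Λ Λ' : Subalgebra k (Matrix (Fin n) (Fin n) k))
    (M' : Matrix (Fin n) (Fin n) k) (l r : Fin D.t) : Prop :=
  ∀ X, X ∈ Λ' ↔ X ∈ Λ ∧ D.block (X * M') l r = D.block (M' * X) l r

/-- A block-diagonal matrix makes no additions, so only its diagonal blocks at `l` and `r` enter the
condition that defines Λ'. -/
theorem IsNext.mem_of_blockDiag (h : D.IsNext Λ Λ' M' l r) {X : Matrix (Fin n) (Fin n) k}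
    (hX : X ∈ Λ) (hb : D.IsBlockDiag X) (he : ∀ a < D.size l, ∀ b < D.size r,
      ∑ c ∈ Finset.range (D.size l), D.posBlock X l l a c * D.posBlock M' l r c b =
        ∑ c ∈ Finset.range (D.size r), D.posBlock M' l r a c * D.posBlock X r r c b) : X ∈ Λ' := by
  refine (h X).2 ⟨hX, block_eq_iff.2 fun p q hp hq => ?_⟩
  have hpl : D.pos p < D.size l := hp ▸ D.pos_lt_size p
  have hqr : D.pos q < D.size r := hq ▸ D.pos_lt_size q
  rw [← posBlock_pos (X * M') hp hq, ← posBlock_pos (M' * X) hp hq, hb.posBlock_mul _ hpl hqr,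
    hb.posBlock_mul_right _ hpl hqr]
  exact he _ hpl _ hqr

/-- When no addition is possible, (*) removes the off-diagonal part of every matrix of Λ', and the
same relation between diagonal blocks is left. -/
theorem IsNext.posBlock_eq (h : D.IsNext Λ Λ' M' l r) (hD : D.Presents Λ)
    (hNA : D.NoAddition M' l r) {X : Matrix (Fin n) (Fin n) k} (hX : X ∈ Λ') :
    ∀ a < D.size l, ∀ b < D.size r,
      ∑ c ∈ Finset.range (D.size l), D.posBlock X l l a c * D.posBlock M' l r c b =
        ∑ c ∈ Finset.range (D.size r), D.posBlock M' l r a c * D.posBlock X r r c b :=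
  hNA.posBlock_eq hD (fun _ _ _ => rfl) (fun _ _ _ => rfl) ((h X).1 hX).1
    (block_eq_iff.1 ((h X).1 hX).2)

theorem IsNext.le (h : D.IsNext Λ Λ' M' l r) : Λ' ≤ Λ := fun X hX => ((h X).1 hX).1

/-- The next algebra is reduced if the block becomes zero by an addition. -/
theorem IsNext.isReducedAlgebra_of_zero (h : D.IsNext Λ Λ' M' l r) (hD : D.Presents Λ)
    (h0 : D.block M' l r = 0) : IsReducedAlgebra Λ' := by
  -- A zero block imposes nothing on block-diagonal matrices, so the frame of `D` needs no
  -- refinement; Λ' differs only in its off-diagonal equations.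
  refine D.isFrame.isReducedAlgebra ⟨fun S hS p q hpq => hD.tri (h.le hS) hpq, ?_, ?_⟩
  · intro S hS p q p' q' hpq hpq' hp hq
    exact hD.eq_of_twin (h.le hS) hpq hpq' (key_eq_iff.1 hp) (key_eq_iff.1 hq).2
  · intro S hS0 hS1
    have hb : D.IsBlockDiag S := hS0
    have hw : ∀ a < D.size l, ∀ b < D.size r, D.posBlock M' l r a b = 0 := by
      intro a ha b hb
      obtain ⟨p, hp, rfl⟩ := exists_pos ha
      obtain ⟨q, hq, rfl⟩ := exists_pos hb
      rw [posBlock_pos M' hp hq]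
      exact congrFun (congrFun h0 ⟨p, hp⟩) ⟨q, hq⟩
    refine h.mem_of_blockDiag (hD.mem_of_blockDiag hS0 fun p q p' q' h1 h2 h3 h4 =>
      hS1 p q p' q' h1 h2 (key_eq_iff.2 h3) (key_eq_iff.2 h4)) hb fun a ha b hb => ?_
    rw [Finset.sum_eq_zero, Finset.sum_eq_zero]
    · intro c hc
      rw [hw a ha c (Finset.mem_range.1 hc), zero_mul]
    · intro c hc
      rw [hw c (Finset.mem_range.1 hc) b hb, mul_zero]

end ReducedData

theorem sum_mul_corner {k : Type*} [Field k] {s d c b : ℕ} (hb : b < c + d) (hd : d ≤ s)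
    (g : ℕ → k) : ∑ e ∈ Finset.range s, g e * (if e < d ∧ b = c + e then 1 else 0) =
      if c ≤ b then g (b - c) else 0 := by
  split_ifs with h
  · rw [Finset.sum_eq_single (b - c), if_pos ⟨by omega, by omega⟩, mul_one]
    · intro e _ he
      rw [if_neg fun x => he (by omega), mul_zero]
    · intro he
      exact absurd (Finset.mem_range.2 (by omega)) he
  · exact Finset.sum_eq_zero fun e _ => by rw [if_neg fun x => h (by omega), mul_zero]

theorem sum_corner_mul {k : Type*} [Field k] {d c : ℕ} (a : ℕ) (g : ℕ → k) :
    ∑ e ∈ Finset.range (c + d), (if a < d ∧ e = c + a then 1 else 0) * g e =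
      if a < d then g (c + a) else 0 := by
  split_ifs with h
  · rw [Finset.sum_eq_single (c + a), if_pos ⟨h, rfl⟩, one_mul]
    · intro e _ he
      rw [if_neg fun x => he x.2, zero_mul]
    · intro he
      exact absurd (Finset.mem_range.2 (by omega)) he
  · exact Finset.sum_eq_zero fun e _ => by rw [if_neg fun x => h x.1, zero_mul]

namespace ReducedData

/-! ### The next algebra after a rank form. -/

section CornerFrame

variable {k : Type*} {n : ℕ} {D : ReducedData k n} {l r : Fin D.t} {c d : ℕ} {p q : Fin n}

open Classical in
/-- The refinement of the strips equivalent to `l` into `d` and `size l - d` indices, and of those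
equivalent to `r` into `c` and `size r - c` indices. -/
noncomputable def cornerSub (D : ReducedData k n) (l r : Fin D.t) (d c : ℕ) (p : Fin n) : ℕ :=
  if D.sim (D.blk p) l then (if D.pos p < d then 0 else 1)
  else if D.sim (D.blk p) r then (if D.pos p < c then 0 else 1) else 0

open Classical in
/-- The colouring that identifies the second part of the strip `r` with the first part of `l`. -/
noncomputable def cornerKey (D : ReducedData k n) (l r : Fin D.t) (c : ℕ) (p : Fin n) :
    Quotient D.sim × ℕ :=
  if D.sim (D.blk p) r ∧ c ≤ D.pos p then (D.cls l, D.pos p - c) else D.key p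

theorem cornerSub_of_left (h : D.sim (D.blk p) l) :
    D.cornerSub l r d c p = if D.pos p < d then 0 else 1 := if_pos h

theorem cornerSub_of_right (hlr : ¬ D.sim l r) (h : D.sim (D.blk p) r) :
    D.cornerSub l r d c p = if D.pos p < c then 0 else 1 :=
  (if_neg fun x => hlr (D.sim.trans (D.sim.symm x) h)).trans (if_pos h)

theorem Twin.sim_iff (h : D.Twin p q) (i : Fin D.t) : D.sim (D.blk p) i ↔ D.sim (D.blk q) i :=
  ⟨D.sim.trans (D.sim.symm h.1), D.sim.trans h.1⟩

theorem Twin.cornerSub_eq (h : D.Twin p q) : D.cornerSub l r d c p = D.cornerSub l r d c q := by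
  rw [cornerSub, cornerSub, propext (h.sim_iff l), propext (h.sim_iff r), h.2]

theorem Twin.cornerKey_eq (h : D.Twin p q) : D.cornerKey l r c p = D.cornerKey l r c q := by
  rw [cornerKey, cornerKey, propext (h.sim_iff r), h.2, key_eq_iff.2 h]

theorem cornerSub_mono (h : D.blk p = D.blk q) (hpq : D.pos p < D.pos q) :
    D.cornerSub l r d c p ≤ D.cornerSub l r d c q := by
  rw [cornerSub, cornerSub, h]
  split_ifs <;> omega

theorem cornerKey_of_pos (h : D.sim (D.blk p) r ∧ c ≤ D.pos p) :
    D.cornerKey l r c p = (D.cls l, D.pos p - c) := if_pos h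

theorem cornerKey_of_neg (h : ¬ (D.sim (D.blk p) r ∧ c ≤ D.pos p)) :
    D.cornerKey l r c p = (D.cls (D.blk p), D.pos p) := if_neg h

theorem cornerKey_of_left (hlr : ¬ D.sim l r) (h : D.sim (D.blk p) l) :
    D.cornerKey l r c p = (D.cls l, D.pos p) := by
  rw [cornerKey_of_neg fun x => hlr (D.sim.trans (D.sim.symm h) x.1)]
  exact Prod.ext (Quotient.sound h) rfl

/-- The indices of the second part of the strips equivalent to `r` are a union of parts. -/
theorem tail_iff_of_cornerSub_eq (hlr : ¬ D.sim l r) (hb : D.blk p = D.blk q)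
    (hs : D.cornerSub l r d c p = D.cornerSub l r d c q) :
    D.sim (D.blk p) r ∧ c ≤ D.pos p ↔ D.sim (D.blk q) r ∧ c ≤ D.pos q := by
  rw [hb]
  refine and_congr_right fun h => ?_
  rw [cornerSub_of_right hlr h, cornerSub_of_right hlr (hb.symm ▸ h)] at hs
  split_ifs at hs <;> omega

/-- Equal colours come from twins or from a corresponding pair of the two identified parts. -/
theorem cornerKey_cases (h : D.cornerKey l r c p = D.cornerKey l r c q) :
    D.Twin p q ∨
    ((D.sim (D.blk p) r ∧ c ≤ D.pos p) ∧ D.sim (D.blk q) l ∧ D.pos p = c + D.pos q) ∨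
    ((D.sim (D.blk q) r ∧ c ≤ D.pos q) ∧ D.sim (D.blk p) l ∧ D.pos q = c + D.pos p) := by
  by_cases hp : D.sim (D.blk p) r ∧ c ≤ D.pos p <;> by_cases hq : D.sim (D.blk q) r ∧ c ≤ D.pos q
  · rw [cornerKey_of_pos hp, cornerKey_of_pos hq, Prod.mk.injEq] at h
    exact Or.inl ⟨D.sim.trans hp.1 (D.sim.symm hq.1), by omega⟩
  · rw [cornerKey_of_pos hp, cornerKey_of_neg hq, Prod.mk.injEq] at h
    exact Or.inr (Or.inl ⟨hp, D.sim.symm (Quotient.exact h.1), by omega⟩)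
  · rw [cornerKey_of_neg hp, cornerKey_of_pos hq, Prod.mk.injEq] at h
    exact Or.inr (Or.inr ⟨hq, Quotient.exact h.1, by omega⟩)
  · rw [cornerKey_of_neg hp, cornerKey_of_neg hq, Prod.mk.injEq] at h
    exact Or.inl ⟨Quotient.exact h.1, h.2⟩

/-- From X_ll [0 I; 0 0] = [0 I; 0 0] X_rr one gets X_ll = [A *; 0 B] and X_rr = [E *; 0 A] with `A`
of size `d`. So `l` splits into `d` and the rest, `r` into `c` and `d`, and the last part of `r` is
matched with the first part of `l` by the shift of positions by `c`. -/
theorem isFrame_corner (hlr : ¬ D.sim l r) (hr : D.size r = c + d) (hl : d ≤ D.size l) :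
    IsFrame (D.refine (D.cornerSub l r d c)) (D.cornerKey l r c) := by
  refine ⟨refine_mono fun p q => cornerSub_mono, fun p q h hk => ?_, fun p q p' hpq hk => ?_⟩
  · rw [refine_eq_iff] at h
    rcases cornerKey_cases hk with ht | ⟨h1, h2, _⟩ | ⟨h1, h2, _⟩
    · exact ht.eq h.1
    · exact absurd (D.sim.trans (D.sim.symm (h.1 ▸ h2)) h1.1) hlr
    · exact absurd (D.sim.trans (D.sim.symm (h.1 ▸ h2)) h1.1) hlr
  · rw [refine_eq_iff] at hpq
    obtain ⟨hb, hs⟩ := hpq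
    have hqs := D.pos_lt_size q
    have hps := D.pos_lt_size p
    have hps' := D.pos_lt_size p'
    have ht := tail_iff_of_cornerSub_eq hlr hb hs
    rcases cornerKey_cases hk with h | ⟨h1, h2, h3⟩ | ⟨h1, h2, h3⟩
    · obtain ⟨q', hq', hqq⟩ := D.exists_pos_eq q (i := D.blk p') (hb ▸ h.1)
      have htw : D.Twin q' q := ⟨by rw [hq', ← hb]; exact D.sim.symm h.1, hqq⟩
      refine ⟨q', refine_eq_iff.2 ⟨hq', ?_⟩, htw.cornerKey_eq, fun hlt => ?_⟩
      · rw [htw.cornerSub_eq, ← hs, h.cornerSub_eq]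
      · rw [← pos_lt_pos_iff hq', hqq, ← h.2]
        exact (pos_lt_pos_iff hb.symm).2 hlt
    · have hq := ht.1 h1
      rw [size_eq_of_sim hq.1, hr] at hqs
      rw [size_eq_of_sim h1.1, hr] at hps
      obtain ⟨q', hq', hqq⟩ := exists_pos (i := D.blk p') (a := D.pos q - c)
        (by rw [size_eq_of_sim h2]; omega)
      have hl' : D.sim (D.blk q') l := hq'.symm ▸ h2
      refine ⟨q', refine_eq_iff.2 ⟨hq', ?_⟩, ?_, fun hlt => ?_⟩
      · rw [cornerSub_of_left h2, cornerSub_of_left hl', if_pos (by omega), if_pos (by omega)]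
      · rw [cornerKey_of_left hlr hl', cornerKey_of_pos hq, hqq]
      · have := (pos_lt_pos_iff hb.symm).2 hlt
        rw [← pos_lt_pos_iff hq']
        omega
    · rw [size_eq_of_sim h1.1, hr] at hps'
      have hl' : D.sim (D.blk q) l := by rwa [← hb]
      rw [cornerSub_of_left h2, cornerSub_of_left hl', if_pos (by omega)] at hs
      have hqd : D.pos q < d := by
        split_ifs at hs
        assumption
      obtain ⟨q', hq', hqq⟩ := exists_pos (i := D.blk p') (a := c + D.pos q)
        (by rw [size_eq_of_sim h1.1]; omega)
      have hr' : D.sim (D.blk q') r := hq'.symm ▸ h1.1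
      refine ⟨q', refine_eq_iff.2 ⟨hq', ?_⟩, ?_, fun hlt => ?_⟩
      · rw [cornerSub_of_right hlr h1.1, cornerSub_of_right hlr hr', if_neg (by omega),
          if_neg (by omega)]
      · rw [cornerKey_of_left hlr hl', cornerKey_of_pos ⟨hr', by omega⟩, hqq,
          Nat.add_sub_cancel_left]
      · have := (pos_lt_pos_iff hb.symm).2 hlt
        rw [← pos_lt_pos_iff hq']
        omega

end CornerFrame

variable {k : Type*} [Field k] {n : ℕ} {D : ReducedData k n}
  {Λ Λ' : Subalgebra k (Matrix (Fin n) (Fin n) k)} {M' : Matrix (Fin n) (Fin n) k}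
  {l r : Fin D.t}

/-- The next algebra is reduced if the block takes the form `[0 I; 0 0]`. -/
theorem IsNext.isReducedAlgebra_of_corner (h : D.IsNext Λ Λ' M' l r) (hD : D.Presents Λ)
    (hNA : D.NoAddition M' l r) (hlr : ¬ D.sim l r) (hC : D.IsCornerBlock M' l r) :
    IsReducedAlgebra Λ' := by
  obtain ⟨d, hl, hdr, hw'⟩ := hC
  obtain ⟨c, hr⟩ : ∃ c, D.size r = c + d := ⟨D.size r - d, by omega⟩
  have hw : ∀ a < D.size l, ∀ b < D.size r, D.posBlock M' l r a b =
      if a < d ∧ b = c + a then 1 else 0 := by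
    intro a ha b hb
    obtain ⟨p, hp, rfl⟩ := exists_pos ha
    obtain ⟨q, hq, rfl⟩ := exists_pos hb
    rw [posBlock_pos M' hp hq, hw' p q hp hq, hr, Nat.add_sub_cancel]
  have hcol : ∀ X : Matrix (Fin n) (Fin n) k, ∀ a < D.size l, ∀ b < D.size r,
      (∑ e ∈ Finset.range (D.size l), D.posBlock X l l a e * D.posBlock M' l r e b =
        if c ≤ b then D.posBlock X l l a (b - c) else 0) ∧
      ∑ e ∈ Finset.range (D.size r), D.posBlock M' l r a e * D.posBlock X r r e b =
        if a < d then D.posBlock X r r (c + a) b else 0 := by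
    intro X a ha b hb
    rw [← sum_mul_corner (hr ▸ hb) hl, ← sum_corner_mul a fun e => D.posBlock X r r e b, ← hr]
    refine ⟨Finset.sum_congr rfl fun e he => ?_, Finset.sum_congr rfl fun e he => ?_⟩
    · rw [hw e (Finset.mem_range.1 he) b hb]
    · rw [hw a ha e (Finset.mem_range.1 he)]
  -- The relation X_ll [0 I; 0 0] = [0 I; 0 0] X_rr entry by entry.
  have heq : ∀ X ∈ Λ', ∀ a < D.size l, ∀ b < D.size r,
      (if c ≤ b then D.posBlock X l l a (b - c) else 0) =
        if a < d then D.posBlock X r r (c + a) b else 0 := by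
    intro X hX a ha b hb
    rw [← (hcol X a ha b hb).1, ← (hcol X a ha b hb).2]
    exact h.posBlock_eq hD hNA hX a ha b hb
  have htail : ∀ X ∈ Λ', ∀ p q, D.blk p = D.blk q → (D.sim (D.blk p) r ∧ c ≤ D.pos p) →
      c ≤ D.pos q → X p q = D.posBlock X l l (D.pos p - c) (D.pos q - c) := by
    intro X hX p q hpq hp hq
    have hps := D.pos_lt_size p
    have hqs := D.pos_lt_size q
    rw [size_eq_of_sim hp.1, hr] at hps
    rw [← hpq, size_eq_of_sim hp.1] at hqs
    have := heq X hX (D.pos p - c) (by omega) (D.pos q) hqs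
    rw [if_pos hq, if_pos (by omega), Nat.add_sub_cancel' hp.2] at this
    rw [hD.apply_eq_posBlock (h.le hX) hpq hp.1, this]
  refine (isFrame_corner hlr hr hl).isReducedAlgebra ⟨fun S hS p q hpq => ?_, ?_, ?_⟩
  · rcases refine_lt_iff.1 hpq with hb | ⟨hb, hs⟩
    · exact hD.tri (h.le hS) hb
    · have hps := D.pos_lt_size p
      have hqs := D.pos_lt_size q
      by_cases h1 : D.sim (D.blk p) l
      · rw [cornerSub_of_left h1, cornerSub_of_left (hb ▸ h1)] at hs
        have hpd : d ≤ D.pos p := by split_ifs at hs <;> omega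
        have hqd : D.pos q < d := by split_ifs at hs <;> omega
        rw [size_eq_of_sim h1] at hps
        -- The row is past `d`, where the right side is 0, while the left side is the wanted entry
        -- of X_ll.
        have := heq S hS (D.pos p) hps (c + D.pos q) (by omega)
        rw [if_pos (by omega), if_neg (by omega), Nat.add_sub_cancel_left] at this
        rw [hD.apply_eq_posBlock (h.le hS) hb.symm h1, this]
      · by_cases h2 : D.sim (D.blk p) r
        · rw [cornerSub_of_right hlr h2, cornerSub_of_right hlr (hb ▸ h2)] at hs
          have hpd : c ≤ D.pos p := by split_ifs at hs <;> omega
          have hqd : D.pos q < c := by split_ifs at hs <;> omega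
          rw [size_eq_of_sim h2, hr] at hps
          have := heq S hS (D.pos p - c) (by omega) (D.pos q) (by omega)
          rw [if_neg (by omega), if_pos (by omega), Nat.add_sub_cancel' hpd] at this
          rw [hD.apply_eq_posBlock (h.le hS) hb.symm h2, ← this]
        · rw [cornerSub, cornerSub, hb, if_neg h1, if_neg h2, if_neg h1, if_neg h2] at hs
          exact absurd hs (lt_irrefl _)
  · intro S hS p q p' q' hpq hpq' hp hq
    rw [refine_eq_iff] at hpq hpq'
    have ht := tail_iff_of_cornerSub_eq hlr hpq.1 hpq.2
    have ht' := tail_iff_of_cornerSub_eq hlr hpq'.1 hpq'.2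
    have hmix : ∀ p q p' q', D.blk p = D.blk q → D.blk p' = D.blk q' →
        D.cornerKey l r c q = D.cornerKey l r c q' → (D.sim (D.blk q) r ∧ c ≤ D.pos q) →
        (D.sim (D.blk p) r ∧ c ≤ D.pos p) → D.sim (D.blk p') l → D.pos p = c + D.pos p' →
        S p q = S p' q' := by
      intro p q p' q' hpq hpq' hk hq hp hp' hpp
      rw [cornerKey_of_pos hq, cornerKey_of_left hlr (hpq' ▸ hp'), Prod.mk.injEq] at hk
      rw [htail S hS p q hpq hp hq.2, hD.apply_eq_posBlock (h.le hS) hpq' hp', hk.2, hpp,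
        Nat.add_sub_cancel_left]
    rcases cornerKey_cases hp with hT | ⟨h1, h2, h3⟩ | ⟨h1, h2, h3⟩
    · rcases cornerKey_cases hq with hT' | ⟨h1, h2, _⟩ | ⟨h1, h2, _⟩
      · exact hD.eq_of_twin (h.le hS) hpq.1 hpq'.1 hT hT'.2
      · rw [← hpq.1] at h1
        rw [← hpq'.1] at h2
        exact absurd (D.sim.trans (D.sim.symm h2) (D.sim.trans (D.sim.symm hT.1) h1.1)) hlr
      · rw [← hpq'.1] at h1
        rw [← hpq.1] at h2
        exact absurd (D.sim.trans (D.sim.symm h2) (D.sim.trans hT.1 h1.1)) hlr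
    · exact hmix p q p' q' hpq.1 hpq'.1 hq (ht.1 h1) h1 h2 h3
    · exact (hmix p' q' p q hpq'.1 hpq.1 hq.symm (ht'.1 h1) h1 h2 h3).symm
  · intro S hS0 hS1
    obtain ⟨hS, hbd⟩ := hD.mem_of_refine (fun p q hT => hT.cornerSub_eq)
      (fun p q hT => hT.cornerKey_eq) hS0 hS1
    refine h.mem_of_blockDiag hS hbd fun a ha b hb => ?_
    rw [(hcol S a ha b hb).1, (hcol S a ha b hb).2]
    obtain ⟨p, hp, rfl⟩ := exists_pos ha
    obtain ⟨q', hq', rfl⟩ := exists_pos hb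
    have hpl : D.sim (D.blk p) l := hp ▸ D.sim.refl _
    have hqr : D.sim (D.blk q') r := hq' ▸ D.sim.refl _
    -- The first region compares the two matched parts, the two mixed ones contain entries between
    -- different parts of one strip, and in the last both sides are 0.
    by_cases h1 : c ≤ D.pos q' <;> by_cases h2 : D.pos p < d
    · rw [if_pos h1, if_pos h2]
      obtain ⟨q, hq, hqq⟩ := exists_pos (i := l) (a := D.pos q' - c) (by omega)
      obtain ⟨p', hp', hpp⟩ := exists_pos (i := r) (a := c + D.pos p) (by omega)
      have hql : D.sim (D.blk q) l := hq ▸ D.sim.refl _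
      have hpr : D.sim (D.blk p') r := hp' ▸ D.sim.refl _
      rw [← hqq, ← hpp, posBlock_pos S hp hq, posBlock_pos S hp' hq']
      refine hS1 p q p' q' (refine_eq_iff.2 ⟨hp.trans hq.symm, ?_⟩)
        (refine_eq_iff.2 ⟨hp'.trans hq'.symm, ?_⟩) ?_ ?_
      · rw [cornerSub_of_left hpl, cornerSub_of_left hql, if_pos h2, if_pos (by omega)]
      · rw [cornerSub_of_right hlr hpr, cornerSub_of_right hlr hqr, if_neg (by omega),
          if_neg (by omega)]
      · rw [cornerKey_of_left hlr hpl, cornerKey_of_pos ⟨hpr, by omega⟩, hpp,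
          Nat.add_sub_cancel_left]
      · rw [cornerKey_of_left hlr hql, cornerKey_of_pos ⟨hqr, h1⟩, hqq]
    · rw [if_pos h1, if_neg h2]
      obtain ⟨q, hq, hqq⟩ := exists_pos (i := l) (a := D.pos q' - c) (by omega)
      rw [← hqq, posBlock_pos S hp hq]
      refine hS0 p q fun hx => ?_
      have := (refine_eq_iff.1 hx).2
      rw [cornerSub_of_left hpl, cornerSub_of_left (hq ▸ D.sim.refl _), if_neg h2,
        if_pos (by omega)] at this
      exact one_ne_zero this
    · rw [if_neg h1, if_pos h2]
      obtain ⟨p', hp', hpp⟩ := exists_pos (i := r) (a := c + D.pos p) (by omega)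
      rw [← hpp, posBlock_pos S hp' hq']
      refine (hS0 p' q' fun hx => ?_).symm
      have := (refine_eq_iff.1 hx).2
      rw [cornerSub_of_right hlr (hp' ▸ D.sim.refl _), cornerSub_of_right hlr hqr,
        if_neg (by omega), if_pos (by omega)] at this
      exact one_ne_zero this
    · rw [if_neg h1, if_neg h2]

end ReducedData

/-! ### The next algebra after a Weyr form. -/

section WeyrParts

variable {k : Type*}

/-- The part of a Weyr matrix that contains a given row: rows are in the same part if they have the
same eigenvalue, the same level, and Jordan chains of the same length. -/
def weyrPart (ℓ : k → ℕ → ℕ) (ev : ℕ → k) (lv ix : ℕ → ℕ) (a : ℕ) : k ×ₗ ℕ ×ₗ ℕᵒᵈ :=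
  toLex (ev a, toLex (lv a, OrderDual.toDual (ℓ (ev a) (ix a))))

variable {s : ℕ} {μ : k → ℕ → ℕ} {ev : ℕ → k} {lv ix : ℕ → ℕ} {ℓ : k → ℕ → ℕ} {a b : ℕ}

theorem weyrPart_eq_iff : weyrPart ℓ ev lv ix a = weyrPart ℓ ev lv ix b ↔
    ev a = ev b ∧ lv a = lv b ∧ ℓ (ev a) (ix a) = ℓ (ev b) (ix b) := by
  rw [weyrPart, weyrPart, toLex_inj, Prod.mk.injEq, toLex_inj, Prod.mk.injEq, OrderDual.toDual_inj]

variable [LinearOrder k]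

theorem weyrPart_lt_iff : weyrPart ℓ ev lv ix a < weyrPart ℓ ev lv ix b ↔
    ev a < ev b ∨ ev a = ev b ∧ (lv a < lv b ∨
      lv a = lv b ∧ ℓ (ev b) (ix b) < ℓ (ev a) (ix a)) := by
  rw [weyrPart, weyrPart, Prod.Lex.toLex_lt_toLex, Prod.Lex.toLex_lt_toLex,
    OrderDual.toDual_lt_toDual]

namespace IsWeyrLabelling

variable (h : IsWeyrLabelling s μ ev lv ix) (hℓ : ∀ c i j, i < μ c j ↔ j < ℓ c i)

include h hℓ

/-- Inside a level the places list the chains by decreasing length, because each level contains an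
initial segment of places; hence the parts are intervals of rows in the right order. -/
theorem weyrPart_le (hab : a < b) (hb : b < s) :
    weyrPart ℓ ev lv ix a ≤ weyrPart ℓ ev lv ix b := by
  rw [le_iff_lt_or_eq, weyrPart_lt_iff, weyrPart_eq_iff]
  rcases h.lt a b hab hb with h1 | ⟨h1, h2 | ⟨h2, h3⟩⟩
  · exact Or.inl (Or.inl h1)
  · exact Or.inl (Or.inr ⟨h1, Or.inl h2⟩)
  · have : ℓ (ev b) (ix b) ≤ ℓ (ev a) (ix a) := by
      rw [← h1]
      by_contra hlt
      exact lt_irrefl _ ((hℓ _ _ _).1 (h3.trans ((hℓ _ _ _).2 (not_le.1 hlt))))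
    rcases this.lt_or_eq with h4 | h4
    · exact Or.inl (Or.inr ⟨h1, Or.inr ⟨h2, h4⟩⟩)
    · exact Or.inr ⟨h1, h2, h4.symm⟩

/-- A part at one level corresponds to the part at another level formed by the same chains: these
have equal length, so they all reach that level, and their order there is the same. -/
theorem exists_row_transport {a' : ℕ} (ha : a < s) (ha' : a' < s)
    (hab : weyrPart ℓ ev lv ix a = weyrPart ℓ ev lv ix b) (he : ev a = ev a') (hi : ix a = ix a') :
    ∃ b' < s, weyrPart ℓ ev lv ix b' = weyrPart ℓ ev lv ix a' ∧ ev b' = ev b ∧ ix b' = ix b ∧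
      (b < a → b' < a') := by
  obtain ⟨h1, h2, h3⟩ := weyrPart_eq_iff.1 hab
  have hex : ix b < μ (ev b) (lv a') := by
    rw [hℓ, ← h3, he, hi, ← hℓ]
    exact h.mem ha'
  obtain ⟨b', hb', e1, e2, e3⟩ := (h.mem_iff _ _ _).1 hex
  refine ⟨b', hb', weyrPart_eq_iff.2 ⟨?_, e2, ?_⟩, e1, e3, fun hlt => ?_⟩
  · rw [e1, ← h1, he]
  · rw [e1, e3, ← h3, he, hi]
  · have hix : ix b' < ix a' := by
      rw [e3, ← hi]
      rcases h.lt b a hlt ha with h4 | ⟨-, h4 | ⟨-, h4⟩⟩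
      · exact absurd h1 h4.ne'
      · omega
      · exact h4
    by_contra hle
    rcases (not_lt.1 hle).lt_or_eq with h4 | h4
    · rcases h.lt a' b' h4 hb' with h5 | ⟨-, h5 | ⟨-, h5⟩⟩
      · exact absurd (he.symm.trans (h1.trans e1.symm)) h5.ne
      · omega
      · omega
    · rw [h4] at hix
      exact lt_irrefl _ hix

/-- A matrix that is constant on the pairs of corresponding rows of its parts commutes with the
Weyr matrix. -/
theorem intertwines_of_parts [Field k] {T : ℕ → ℕ → k}
    (h0 : ∀ a < s, ∀ b < s, weyrPart ℓ ev lv ix a ≠ weyrPart ℓ ev lv ix b → T a b = 0)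
    (h1 : ∀ a < s, ∀ b < s, ∀ a' < s, ∀ b' < s, weyrPart ℓ ev lv ix a = weyrPart ℓ ev lv ix b →
      weyrPart ℓ ev lv ix a' = weyrPart ℓ ev lv ix b' → ev a = ev a' → ix a = ix a' →
      ev b = ev b' → ix b = ix b' → T a b = T a' b') :
    Intertwines s s ev ev lv ix lv ix T := by
  intro a ha b hb
  rw [sum_weyrEntry_mul ev lv ix (fun c => T c b) ha, sum_mul_weyrEntry ev lv ix (T a) hb]
  have hdiag : ev a * T a b = T a b * ev b := by
    by_cases hp : weyrPart ℓ ev lv ix a = weyrPart ℓ ev lv ix b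
    · rw [(weyrPart_eq_iff.1 hp).1, mul_comm]
    · rw [h0 a ha b hb hp, mul_zero, zero_mul]
  rw [hdiag]
  congr 1
  -- Only chains of equal length and consecutive levels can give nonzero terms. Then the two terms
  -- are entries between the same pair of chains, one level apart; in all other cases both vanish.
  by_cases hc : ev a = ev b ∧ lv a + 1 = lv b ∧ ℓ (ev a) (ix a) = ℓ (ev b) (ix b)
  · obtain ⟨c1, c2, c3⟩ := hc
    have hbl := (hℓ _ _ _).1 (h.mem hb)
    obtain ⟨a', ha', p1, p2, p3⟩ := (h.mem_iff (ev a) (lv a + 1) (ix a)).1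
      ((hℓ _ _ _).2 (by rw [c2, c3]; exact hbl))
    obtain ⟨b', hb', q1, q2, q3⟩ := (h.mem_iff (ev b) (lv b - 1) (ix b)).1
      ((hℓ _ _ _).2 (by omega))
    rw [if_neg (by omega)]
    have e1 := h.labelSum_apply (fun c => T c b) ha'
    have e2 := h.labelSum_apply (T a) hb'
    rw [p1, p2, p3] at e1
    rw [q1, q2, q3] at e2
    rw [e1, e2]
    refine h1 a' ha' b hb a ha b' hb' (weyrPart_eq_iff.2 ⟨p1.trans c1, p2.trans c2, ?_⟩)
      (weyrPart_eq_iff.2 ⟨c1.trans q1.symm, by omega, ?_⟩) p1 p3 q1.symm q3.symm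
    · rw [p1, p3, c3]
    · rw [q1, q3, c3]
  · have hl : labelSum s ev lv ix (fun c => T c b) (ev a) (lv a + 1) (ix a) = 0 := by
      by_cases hx : ix a < μ (ev a) (lv a + 1)
      · obtain ⟨a', ha', p1, p2, p3⟩ := (h.mem_iff _ _ _).1 hx
        have e1 := h.labelSum_apply (fun c => T c b) ha'
        rw [p1, p2, p3] at e1
        rw [e1]
        refine h0 a' ha' b hb fun hp => hc ?_
        rw [weyrPart_eq_iff, p1, p2, p3] at hp
        exact hp
      · exact h.labelSum_eq_zero _ hx
    rw [hl]
    split_ifs with hz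
    · rfl
    · have hx : ix b < μ (ev b) (lv b - 1) :=
        (hℓ _ _ _).2 (lt_of_le_of_lt (Nat.sub_le _ _) ((hℓ _ _ _).1 (h.mem hb)))
      obtain ⟨b', hb', q1, q2, q3⟩ := (h.mem_iff _ _ _).1 hx
      have e2 := h.labelSum_apply (T a) hb'
      rw [q1, q2, q3] at e2
      rw [e2]
      refine (h0 a ha b' hb' fun hp => hc ?_).symm
      rw [weyrPart_eq_iff, q1, q2, q3] at hp
      exact ⟨hp.1, by omega, hp.2.2⟩

end IsWeyrLabelling

end WeyrParts

namespace ReducedData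

section StripFrame

variable {k : Type*} {n : ℕ} {D : ReducedData k n} {l : Fin D.t} {L K : Type*} {p q : Fin n}

open Classical in
/-- The refinement of the strips equivalent to `l` by a function of positions. -/
noncomputable def stripSub (D : ReducedData k n) (l : Fin D.t) (φ : ℕ → L) (p : Fin n) : L :=
  if D.sim (D.blk p) l then φ (D.pos p) else φ 0

open Classical in
/-- The colouring of the strips equivalent to `l` by a function of positions. -/
noncomputable def stripKey (D : ReducedData k n) (l : Fin D.t) (ψ : ℕ → K) (p : Fin n) :
    (Quotient D.sim × ℕ) ⊕ K :=
  if D.sim (D.blk p) l then Sum.inr (ψ (D.pos p)) else Sum.inl (D.key p)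

variable {φ : ℕ → L} {ψ : ℕ → K}

theorem stripSub_of_sim (h : D.sim (D.blk p) l) : D.stripSub l φ p = φ (D.pos p) := if_pos h

theorem stripSub_of_not_sim (h : ¬ D.sim (D.blk p) l) : D.stripSub l φ p = φ 0 := if_neg h

theorem stripKey_of_sim (h : D.sim (D.blk p) l) : D.stripKey l ψ p = Sum.inr (ψ (D.pos p)) :=
  if_pos h

theorem stripKey_of_not_sim (h : ¬ D.sim (D.blk p) l) : D.stripKey l ψ p = Sum.inl (D.key p) :=
  if_neg h

theorem Twin.stripSub_eq (h : D.Twin p q) : D.stripSub l φ p = D.stripSub l φ q := by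
  rw [stripSub, stripSub, propext (h.sim_iff l), h.2]

theorem Twin.stripKey_eq (h : D.Twin p q) : D.stripKey l ψ p = D.stripKey l ψ q := by
  rw [stripKey, stripKey, propext (h.sim_iff l), h.2, key_eq_iff.2 h]

theorem stripKey_cases (h : D.stripKey l ψ p = D.stripKey l ψ q) :
    (D.sim (D.blk p) l ∧ D.sim (D.blk q) l ∧ ψ (D.pos p) = ψ (D.pos q)) ∨
      (¬ D.sim (D.blk p) l ∧ ¬ D.sim (D.blk q) l ∧ D.Twin p q) := by
  by_cases hp : D.sim (D.blk p) l <;> by_cases hq : D.sim (D.blk q) l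
  · rw [stripKey_of_sim hp, stripKey_of_sim hq] at h
    exact Or.inl ⟨hp, hq, Sum.inr.inj h⟩
  · rw [stripKey_of_sim hp, stripKey_of_not_sim hq] at h
    cases h
  · rw [stripKey_of_not_sim hp, stripKey_of_sim hq] at h
    cases h
  · rw [stripKey_of_not_sim hp, stripKey_of_not_sim hq] at h
    exact Or.inr ⟨hp, hq, key_eq_iff.1 (Sum.inl.inj h)⟩

theorem pos_lt_of_sim (h : D.sim (D.blk p) l) : D.pos p < D.size l :=
  size_eq_of_sim h ▸ D.pos_lt_size p

/-- The assumptions are the axioms of a frame for the positions of the single strip `l`; its whole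
class is refined alike, and strips of other classes keep their twins as colours. -/
theorem isFrame_strip [LinearOrder L]
    (hmono : ∀ a b, a < b → b < D.size l → φ a ≤ φ b)
    (hinj : ∀ a < D.size l, ∀ b < D.size l, φ a = φ b → ψ a = ψ b → a = b)
    (htr : ∀ a < D.size l, ∀ b < D.size l, ∀ a' < D.size l, φ a = φ b → ψ a = ψ a' →
      ∃ b' < D.size l, φ b' = φ a' ∧ ψ b' = ψ b ∧ (b < a → b' < a')) :
    IsFrame (D.refine (D.stripSub l φ)) (D.stripKey l ψ) := by
  refine ⟨refine_mono fun p q hb hpq => ?_, fun p q h hk => ?_, fun p q p' hpq hk => ?_⟩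
  · by_cases hq : D.sim (D.blk q) l
    · have hp : D.sim (D.blk p) l := hb.symm ▸ hq
      rw [stripSub_of_sim hp, stripSub_of_sim hq]
      exact hmono _ _ hpq (pos_lt_of_sim hq)
    · have hp : ¬ D.sim (D.blk p) l := hb.symm ▸ hq
      rw [stripSub_of_not_sim hp, stripSub_of_not_sim hq]
  · rw [refine_eq_iff] at h
    rcases stripKey_cases hk with ⟨hp, hq, hψ⟩ | ⟨-, -, ht⟩
    · refine eq_of_pos_eq h.1 (hinj _ (pos_lt_of_sim hp) _ (pos_lt_of_sim hq) ?_ hψ)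
      rw [← stripSub_of_sim (φ := φ) hp, ← stripSub_of_sim (φ := φ) hq, h.2]
    · exact ht.eq h.1
  · rw [refine_eq_iff] at hpq
    obtain ⟨hb, hs⟩ := hpq
    rcases stripKey_cases hk with ⟨hp, hp', hψ⟩ | ⟨hp, hp', ht⟩
    · have hq : D.sim (D.blk q) l := by rwa [← hb]
      rw [stripSub_of_sim hp, stripSub_of_sim hq] at hs
      obtain ⟨b', hb', e1, e2, e3⟩ := htr _ (pos_lt_of_sim hp) _ (pos_lt_of_sim hq) _
        (pos_lt_of_sim hp') hs hψ
      obtain ⟨q', hq', rfl⟩ := exists_pos (i := D.blk p') (by rwa [size_eq_of_sim hp'])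
      have hl' : D.sim (D.blk q') l := hq'.symm ▸ hp'
      refine ⟨q', refine_eq_iff.2 ⟨hq', ?_⟩, ?_, fun hlt => ?_⟩
      · rw [stripSub_of_sim hl', stripSub_of_sim hp', e1]
      · rw [stripKey_of_sim hl', stripKey_of_sim hq, e2]
      · exact (pos_lt_pos_iff hq').1 (e3 ((pos_lt_pos_iff hb.symm).2 hlt))
    · obtain ⟨q', hq', hqq⟩ := D.exists_pos_eq q (i := D.blk p') (hb ▸ ht.1)
      have htw : D.Twin q' q := ⟨by rw [hq', ← hb]; exact D.sim.symm ht.1, hqq⟩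
      refine ⟨q', refine_eq_iff.2 ⟨hq', ?_⟩, htw.stripKey_eq, fun hlt => ?_⟩
      · rw [htw.stripSub_eq, ← hs, ht.stripSub_eq]
      · rw [← pos_lt_pos_iff hq', hqq, ← ht.2]
        exact (pos_lt_pos_iff hb.symm).2 hlt

end StripFrame

variable {k : Type*} [Field k] [LinearOrder k] {n : ℕ} {D : ReducedData k n}
  {Λ Λ' : Subalgebra k (Matrix (Fin n) (Fin n) k)} {M' : Matrix (Fin n) (Fin n) k}
  {l r : Fin D.t}

/-- The next algebra is reduced if the block becomes a Weyr matrix. -/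
theorem IsNext.isReducedAlgebra_of_weyr (h : D.IsNext Λ Λ' M' l r) (hD : D.Presents Λ)
    (hNA : D.NoAddition M' l r) (hlr : D.sim l r) (hW : IsWeyr (D.block M' l r)) :
    IsReducedAlgebra Λ' := by
  obtain ⟨μ, ev, lv, ix, hw, hM⟩ := (isWeyr_block_iff hlr M').1 hW
  obtain ⟨ℓ, hℓ⟩ := hw.exists_len
  have hs := size_eq_of_sim hlr
  have hcol : ∀ X ∈ Λ, ∀ a < D.size l, ∀ b < D.size l,
      (∑ c ∈ Finset.range (D.size l), D.posBlock X l l a c * D.posBlock M' l r c b =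
        ∑ c ∈ Finset.range (D.size l), D.posBlock X l l a c * weyrEntry ev lv ix c b) ∧
      ∑ c ∈ Finset.range (D.size r), D.posBlock M' l r a c * D.posBlock X r r c b =
        ∑ c ∈ Finset.range (D.size l), weyrEntry ev lv ix a c * D.posBlock X l l c b := by
    intro X hX a ha b hb
    rw [← hs]
    refine ⟨Finset.sum_congr rfl fun c hc => ?_, Finset.sum_congr rfl fun c hc => ?_⟩
    · rw [hM c (Finset.mem_range.1 hc) b hb]
    · rw [hM a ha c (Finset.mem_range.1 hc), hD.posBlock_eq hX hlr (Finset.mem_range.1 hc) hb]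
  -- The diagonal block of `X` at `l`, equal to that at `r`, commutes with the Weyr matrix.
  have hT : ∀ X ∈ Λ', IsWeyrLabelling.Intertwines (D.size l) (D.size l) ev ev lv ix lv ix
      (D.posBlock X l l) := by
    intro X hX a ha b hb
    rw [← (hcol X (h.le hX) a ha b hb).1, ← (hcol X (h.le hX) a ha b hb).2]
    exact (h.posBlock_eq hD hNA hX a ha b (hs ▸ hb)).symm
  -- Strips are cut into Weyr parts, and the colour of a row is its Jordan chain, so parts formed by
  -- the same chains at different levels are matched.
  have hF : IsFrame (D.refine (D.stripSub l (weyrPart ℓ ev lv ix)))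
      (D.stripKey l fun a => (ev a, ix a)) := by
    refine isFrame_strip (fun a b hab hb => hw.weyrPart_le hℓ hab hb) ?_ ?_
    · intro a ha b hb hab hψ
      exact hw.inj ha hb (weyrPart_eq_iff.1 hab).1 (weyrPart_eq_iff.1 hab).2.1
        (Prod.mk.inj hψ).2
    · intro a ha b hb a' ha' hab hψ
      obtain ⟨b', hb', e1, e2, e3, e4⟩ := hw.exists_row_transport hℓ ha ha' hab
        (Prod.mk.inj hψ).1 (Prod.mk.inj hψ).2
      exact ⟨b', hb', e1, Prod.ext e2 e3, e4⟩
  refine hF.isReducedAlgebra ⟨fun S hS p q hpq => ?_, ?_, ?_⟩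
  · rcases refine_lt_iff.1 hpq with hb | ⟨hb, hlt⟩
    · exact hD.tri (h.le hS) hb
    · by_cases hp : D.sim (D.blk p) l
      · have hq : D.sim (D.blk q) l := by rwa [hb]
        rw [stripSub_of_sim hp, stripSub_of_sim hq, weyrPart_lt_iff] at hlt
        rw [hD.apply_eq_posBlock (h.le hS) hb.symm hp]
        rcases hlt with h1 | ⟨h1, h2 | ⟨h2, h3⟩⟩
        · exact (hT S hS).eq_zero_of_ev_ne hw hw (pos_lt_of_sim hp) (pos_lt_of_sim hq) h1.ne'
        · exact (hT S hS).eq_zero_of_lv_lt hw hw (pos_lt_of_sim hp) (pos_lt_of_sim hq) h2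
        · exact (hT S hS).eq_zero_of_len_lt hw hw hℓ hℓ (pos_lt_of_sim hp) (pos_lt_of_sim hq)
            h2.symm h3
      · have hq : ¬ D.sim (D.blk q) l := by rwa [hb]
        rw [stripSub_of_not_sim hp, stripSub_of_not_sim hq] at hlt
        exact absurd hlt (lt_irrefl _)
  · intro S hS p q p' q' hpq hpq' hkp hkq
    rw [refine_eq_iff] at hpq hpq'
    obtain ⟨hb, hs⟩ := hpq
    obtain ⟨hb', hs'⟩ := hpq'
    rcases stripKey_cases hkp with ⟨hp, hp', hψ⟩ | ⟨hp, hp', ht⟩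
    · rcases stripKey_cases hkq with ⟨hq, hq', hψ'⟩ | ⟨hq, -, -⟩
      · rw [stripSub_of_sim hp, stripSub_of_sim hq] at hs
        rw [stripSub_of_sim hp', stripSub_of_sim hq'] at hs'
        rw [hD.apply_eq_posBlock (h.le hS) hb hp, hD.apply_eq_posBlock (h.le hS) hb' hp']
        exact (hT S hS).eq_of_lv_eq hw hw (pos_lt_of_sim hp) (pos_lt_of_sim hq)
          (pos_lt_of_sim hp') (pos_lt_of_sim hq') (weyrPart_eq_iff.1 hs).2.1
          (weyrPart_eq_iff.1 hs').2.1 (Prod.mk.inj hψ).1 (Prod.mk.inj hψ).2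
          (Prod.mk.inj hψ').1 (Prod.mk.inj hψ').2
      · exact absurd (hb ▸ hp) hq
    · rcases stripKey_cases hkq with ⟨hq, -, -⟩ | ⟨-, -, ht'⟩
      · exact absurd (hb.symm ▸ hq) hp
      · exact hD.eq_of_twin (h.le hS) hb hb' ht ht'.2
  · intro S hS0 hS1
    obtain ⟨hS, hbd⟩ := hD.mem_of_refine (fun p q ht => ht.stripSub_eq)
      (fun p q ht => ht.stripKey_eq) hS0 hS1
    refine h.mem_of_blockDiag hS hbd fun a ha b hb => ?_
    rw [← hs] at hb
    rw [(hcol S hS a ha b hb).1, (hcol S hS a ha b hb).2]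
    refine (hw.intertwines_of_parts hℓ ?_ ?_ a ha b hb).symm
    · intro a ha b hb hab
      obtain ⟨p, hp, rfl⟩ := exists_pos ha
      obtain ⟨q, hq, rfl⟩ := exists_pos hb
      rw [posBlock_pos S hp hq]
      refine hS0 p q fun hx => hab ?_
      rw [refine_eq_iff, stripSub_of_sim (hp ▸ D.sim.refl _),
        stripSub_of_sim (hq ▸ D.sim.refl _)] at hx
      exact hx.2
    · intro a ha b hb a' ha' b' hb' hab hab' h1 h2 h3 h4
      obtain ⟨p, hp, rfl⟩ := exists_pos ha
      obtain ⟨q, hq, rfl⟩ := exists_pos hb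
      obtain ⟨p', hp', rfl⟩ := exists_pos ha'
      obtain ⟨q', hq', rfl⟩ := exists_pos hb'
      have hsim : ∀ {u}, D.blk u = l → D.sim (D.blk u) l := fun hu => hu ▸ D.sim.refl _
      rw [posBlock_pos S hp hq, posBlock_pos S hp' hq']
      refine hS1 p q p' q' (refine_eq_iff.2 ⟨hp.trans hq.symm, ?_⟩)
        (refine_eq_iff.2 ⟨hp'.trans hq'.symm, ?_⟩) ?_ ?_
      · rw [stripSub_of_sim (hsim hp), stripSub_of_sim (hsim hq), hab]
      · rw [stripSub_of_sim (hsim hp'), stripSub_of_sim (hsim hq'), hab']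
      · rw [stripKey_of_sim (hsim hp), stripKey_of_sim (hsim hp'), h1, h2]
      · rw [stripKey_of_sim (hsim hq), stripKey_of_sim (hsim hq'), h3, h4]

end ReducedData

/-! ### Λ-similarity is an equivalence relation. -/

section Similarity

variable {k : Type*} [Field k] {n : ℕ} {Λ : Subalgebra k (Matrix (Fin n) (Fin n) k)}
  {M N P : Matrix (Fin n) (Fin n) k}

theorem Matrix.isUnit_inv {S : Matrix (Fin n) (Fin n) k} (hS : IsUnit S) : IsUnit S⁻¹ :=
  Matrix.isUnit_nonsing_inv_iff.2 hS

theorem Matrix.nonsing_inv_mul_of_isUnit {S : Matrix (Fin n) (Fin n) k} (hS : IsUnit S) :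
    S⁻¹ * S = 1 := Matrix.nonsing_inv_mul _ ((Matrix.isUnit_iff_isUnit_det _).1 hS)

theorem Matrix.mul_nonsing_inv_of_isUnit {S : Matrix (Fin n) (Fin n) k} (hS : IsUnit S) :
    S * S⁻¹ = 1 := Matrix.mul_nonsing_inv _ ((Matrix.isUnit_iff_isUnit_det _).1 hS)

theorem Matrix.inv_inv_of_isUnit {S : Matrix (Fin n) (Fin n) k} (hS : IsUnit S) : S⁻¹⁻¹ = S :=
  Matrix.nonsing_inv_nonsing_inv _ ((Matrix.isUnit_iff_isUnit_det _).1 hS)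

theorem LambdaSimilar.refl (M : Matrix (Fin n) (Fin n) k) : LambdaSimilar Λ M M :=
  ⟨1, Λ.one_mem, isUnit_one, by simp⟩

theorem LambdaSimilar.symm (h : LambdaSimilar Λ M N) : LambdaSimilar Λ N M := by
  obtain ⟨S, hS, hu, rfl⟩ := h
  refine ⟨S⁻¹, Λ.matrix_inv_mem hS hu, Matrix.isUnit_inv hu, ?_⟩
  rw [Matrix.inv_inv_of_isUnit hu, ReducedData.mul_conj hu, mul_assoc,
    Matrix.mul_nonsing_inv_of_isUnit hu, mul_one]

theorem LambdaSimilar.trans (h : LambdaSimilar Λ M N) (h' : LambdaSimilar Λ N P) :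
    LambdaSimilar Λ M P := by
  obtain ⟨S, hS, hu, rfl⟩ := h
  obtain ⟨T, hT, hu', rfl⟩ := h'
  refine ⟨S * T, Λ.mul_mem hS hT, hu.mul hu', ?_⟩
  rw [Matrix.mul_inv_rev]
  simp only [mul_assoc]

theorem LambdaSimilar.mono {Λ' : Subalgebra k (Matrix (Fin n) (Fin n) k)} (hΛ : Λ' ≤ Λ)
    (h : LambdaSimilar Λ' M N) : LambdaSimilar Λ M N := by
  obtain ⟨S, hS, hu, rfl⟩ := h
  exact ⟨S, hΛ hS, hu, rfl⟩

end Similarity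

/-! ### Independence of the chosen data. -/

namespace ReducedData

section Agree

variable {k : Type*} {n : ℕ}

/-- Two partitions into strips have the same nonempty strips and the same twins. -/
structure Agree (D D' : ReducedData k n) : Prop where
  lt_iff : ∀ p q, D.blk p < D.blk q ↔ D'.blk p < D'.blk q
  twin_iff : ∀ p q, D.Twin p q ↔ D'.Twin p q

namespace Agree

variable {D D' : ReducedData k n} (h : D.Agree D') {p q : Fin n}

include h

theorem eq_iff (p q : Fin n) : D.blk p = D.blk q ↔ D'.blk p = D'.blk q := by
  have h1 := h.lt_iff p q
  have h2 := h.lt_iff q p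
  constructor
  · intro e
    exact le_antisymm (not_lt.1 fun x => (h2.2 x).ne e.symm) (not_lt.1 fun x => (h1.2 x).ne e)
  · intro e
    exact le_antisymm (not_lt.1 fun x => (h2.1 x).ne e.symm) (not_lt.1 fun x => (h1.1 x).ne e)

theorem size_eq (p : Fin n) : D.size (D.blk p) = D'.size (D'.blk p) := by
  rw [size, size]
  exact congrArg _ (Finset.filter_congr fun q _ => h.eq_iff q p)

theorem pos_eq (p : Fin n) : D.pos p = D'.pos p := by
  rw [pos, pos]
  exact congrArg _ (Finset.filter_congr fun q _ => and_congr_left fun _ => h.eq_iff q p)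

theorem symm : D'.Agree D := ⟨fun p q => (h.lt_iff p q).symm, fun p q => (h.twin_iff p q).symm⟩

/-- Equivalence of nonempty strips is visible in the twins: `p` has a twin in every strip equivalent
to its own. Empty strips leave no trace in the algebra, so strips are named here by indices. -/
theorem sim_of_sim (hs : D.sim (D.blk p) (D.blk q)) : D'.sim (D'.blk p) (D'.blk q) := by
  obtain ⟨q', hq', hqq⟩ := D.exists_pos_eq p hs
  have := ((h.twin_iff p q').1 ⟨hq'.symm ▸ hs, hqq.symm⟩).1
  rwa [← (h.eq_iff q' q).1 hq']

theorem sim_iff : D.sim (D.blk p) (D.blk q) ↔ D'.sim (D'.blk p) (D'.blk q) :=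
  ⟨h.sim_of_sim, h.symm.sim_of_sim⟩

theorem earlier_iff (p₀ q₀ : Fin n) :
    D.Earlier (D.blk p₀) (D.blk q₀) p q ↔ D'.Earlier (D'.blk p₀) (D'.blk q₀) p q := by
  rw [Earlier, Earlier, h.lt_iff, h.eq_iff, h.lt_iff]

theorem upto_iff (p₀ q₀ : Fin n) :
    D.Upto (D.blk p₀) (D.blk q₀) p q ↔ D'.Upto (D'.blk p₀) (D'.blk q₀) p q := by
  rw [ReducedData.upto_iff, ReducedData.upto_iff, h.earlier_iff, h.eq_iff, h.eq_iff]

theorem block_eq_iff (p₀ q₀ : Fin n) {A B : Matrix (Fin n) (Fin n) k} :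
    D.block A (D.blk p₀) (D.blk q₀) = D.block B (D.blk p₀) (D.blk q₀) ↔
      D'.block A (D'.blk p₀) (D'.blk q₀) = D'.block B (D'.blk p₀) (D'.blk q₀) := by
  simp only [ReducedData.block_eq_iff, h.eq_iff]

theorem posBlock_eq [Field k] (p₀ q₀ : Fin n) (A : Matrix (Fin n) (Fin n) k) :
    D.posBlock A (D.blk p₀) (D.blk q₀) = D'.posBlock A (D'.blk p₀) (D'.blk q₀) := by
  funext a b
  rw [posBlock, posBlock]
  refine Finset.sum_congr rfl fun p _ => Finset.sum_congr rfl fun q _ => ?_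
  simp only [h.eq_iff, h.pos_eq]

theorem isCornerBlock [Field k] (p₀ q₀ : Fin n) {A : Matrix (Fin n) (Fin n) k}
    (hA : D.IsCornerBlock A (D.blk p₀) (D.blk q₀)) :
    D'.IsCornerBlock A (D'.blk p₀) (D'.blk q₀) := by
  obtain ⟨d, h1, h2, h3⟩ := hA
  rw [h.size_eq] at h1 h2
  refine ⟨d, h1, h2, fun p q hp hq => ?_⟩
  rw [h3 p q ((h.eq_iff _ _).2 hp) ((h.eq_iff _ _).2 hq), h.pos_eq, h.pos_eq, h.size_eq]

theorem isWeyr [Field k] [LinearOrder k] (p₀ q₀ : Fin n) (hs : D.sim (D.blk p₀) (D.blk q₀))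
    {A : Matrix (Fin n) (Fin n) k} (hA : IsWeyr (D.block A (D.blk p₀) (D.blk q₀))) :
    IsWeyr (D'.block A (D'.blk p₀) (D'.blk q₀)) := by
  rw [isWeyr_block_iff (h.sim_iff.1 hs), ← h.size_eq, ← h.posBlock_eq]
  exact (isWeyr_block_iff hs A).1 hA

end Agree

end Agree

variable {k : Type*} [Field k] {n : ℕ} {D D' : ReducedData k n}
  {Λ Λ' : Subalgebra k (Matrix (Fin n) (Fin n) k)} {M M' N' : Matrix (Fin n) (Fin n) k}
  {l r : Fin D.t}

/-- If `p` and `q` share a strip of `D`, then Λ contains a matrix with entry 1 at (p, q), and this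
matrix must be upper block-triangular for D' as well. -/
theorem Presents.blk_le_of_blk_eq (hD : D.Presents Λ) (hD' : D'.Presents Λ) {p q : Fin n}
    (h : D.blk p = D.blk q) : D'.blk p ≤ D'.blk q := by
  classical
  by_contra hlt
  have := hD'.tri (hD.unit_mem p q) (not_le.1 hlt)
  rw [unit_apply h, if_pos ⟨h, Twin.refl p, Twin.refl q⟩] at this
  exact one_ne_zero this

theorem Presents.blk_lt_of_blk_lt (hD : D.Presents Λ) (hD' : D'.Presents Λ) {p q : Fin n}
    (h : D.blk p < D.blk q) : D'.blk p < D'.blk q := by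
  have hpq : p ≤ q := not_lt.1 fun x => not_le.2 h (D.blk_mono x.le)
  refine (D'.blk_mono hpq).lt_of_ne fun e => h.ne ?_
  exact le_antisymm (D.blk_mono hpq) (hD'.blk_le_of_blk_eq hD e.symm)

/-- The idempotent of the D'-twin class of `q` must have equal diagonal entries at twins of `D`. -/
theorem Presents.twin_of_twin (hD : D.Presents Λ) (hD' : D'.Presents Λ) {p q : Fin n}
    (h : D.Twin p q) : D'.Twin p q := by
  classical
  have := hD.eq_of_twin (hD'.unit_mem q q) rfl rfl h h.2
  by_contra hn
  rw [unit_apply rfl, unit_apply rfl, if_neg fun x => hn x.2.1,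
    if_pos ⟨rfl, Twin.refl q, Twin.refl q⟩] at this
  exact zero_ne_one this

/-- The strips and the twins are determined by the algebra. -/
theorem Presents.agree (hD : D.Presents Λ) (hD' : D'.Presents Λ) : D.Agree D' :=
  ⟨fun _ _ => ⟨hD.blk_lt_of_blk_lt hD', hD'.blk_lt_of_blk_lt hD⟩,
    fun _ _ => ⟨hD.twin_of_twin hD', hD'.twin_of_twin hD⟩⟩

/-- The three possible forms of a step of the algorithm. -/
def IsReduction [LinearOrder k] (D : ReducedData k n) (M M' S : Matrix (Fin n) (Fin n) k)
    (l r : Fin D.t) : Prop :=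
  (¬ D.NoAddition M l r ∧ (∀ p q, D.blk p = D.blk q → S p q = if p = q then 1 else 0) ∧
      D.block M' l r = 0) ∨
    (D.NoAddition M l r ∧ ¬ D.sim l r ∧ D.IsCornerBlock M' l r) ∨
    (D.NoAddition M l r ∧ D.sim l r ∧ IsWeyr (D.block M' l r))

/-- A step of the algorithm carried out with given data. -/
def StepAt [LinearOrder k] (D : ReducedData k n)
    (Λ Λ' : Subalgebra k (Matrix (Fin n) (Fin n) k)) (M M' : Matrix (Fin n) (Fin n) k)
    (l r : Fin D.t) : Prop :=
  D.FirstNonstable Λ M l r ∧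
    (∃ S ∈ Λ, IsUnit S ∧ M' = S⁻¹ * M * S ∧ D.IsReduction M M' S l r) ∧ D.IsNext Λ Λ' M' l r

/-- An empty block is always stable. The place found names the block in a way that makes sense for
any other data. -/
theorem Presents.exists_place [Infinite k] (hD : D.Presents Λ) (h : D.FirstNonstable Λ M l r) :
    ∃ p q, D.blk p = l ∧ D.blk q = r := by
  obtain ⟨hE, hU⟩ := hD.firstNonstable_iff.1 h
  by_contra hn
  push Not at hn
  refine hU fun X hX p q hpq => ?_
  rcases ReducedData.upto_iff.1 hpq with h | h
  · exact hE X hX p q h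
  · exact absurd h.2 (hn p q h.1)

theorem Agree.firstNonstable [Infinite k] (h : D.Agree D') (hD : D.Presents Λ)
    (hD' : D'.Presents Λ) (p₀ q₀ : Fin n) (hF : D.FirstNonstable Λ M (D.blk p₀) (D.blk q₀)) :
    D'.FirstNonstable Λ M (D'.blk p₀) (D'.blk q₀) := by
  rw [hD.firstNonstable_iff] at hF
  rw [hD'.firstNonstable_iff]
  simpa only [CommOn, h.earlier_iff, h.upto_iff] using hF

theorem Agree.noAddition_iff [Infinite k] (h : D.Agree D') (hD : D.Presents Λ)
    (hD' : D'.Presents Λ) (p₀ q₀ : Fin n) (hF : D.FirstNonstable Λ M (D.blk p₀) (D.blk q₀)) :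
    D.NoAddition M (D.blk p₀) (D.blk q₀) ↔ D'.NoAddition M (D'.blk p₀) (D'.blk q₀) := by
  rw [hD.noAddition_iff (hD.firstNonstable_iff.1 hF).1,
    hD'.noAddition_iff (hD'.firstNonstable_iff.1 (h.firstNonstable hD hD' p₀ q₀ hF)).1]
  simp only [h.eq_iff]

/-- A step can be carried out with any data of the algebra. -/
theorem StepAt.transfer [LinearOrder k] [Infinite k] (h : D.StepAt Λ Λ' M M' l r)
    (hD : D.Presents Λ) (hD' : D'.Presents Λ) : ∃ l' r', D'.StepAt Λ Λ' M M' l' r' := by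
  obtain ⟨hF, ⟨S, hS, hu, rfl, hc⟩, hN⟩ := h
  obtain ⟨p₀, q₀, rfl, rfl⟩ := hD.exists_place hF
  have hA := hD.agree hD'
  refine ⟨D'.blk p₀, D'.blk q₀, hA.firstNonstable hD hD' p₀ q₀ hF, ⟨S, hS, hu, rfl, ?_⟩,
    fun X => ?_⟩
  · rcases hc with ⟨h1, h2, h3⟩ | ⟨h1, h2, h3⟩ | ⟨h1, h2, h3⟩
    · refine Or.inl ⟨fun x => h1 ((hA.noAddition_iff hD hD' p₀ q₀ hF).2 x), fun p q hpq =>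
        h2 p q ((hA.eq_iff p q).2 hpq), ?_⟩
      exact (hA.block_eq_iff (B := 0) p₀ q₀).1 h3
    · exact Or.inr (Or.inl ⟨(hA.noAddition_iff hD hD' p₀ q₀ hF).1 h1,
        fun x => h2 (hA.sim_iff.2 x), hA.isCornerBlock p₀ q₀ h3⟩)
    · exact Or.inr (Or.inr ⟨(hA.noAddition_iff hD hD' p₀ q₀ hF).1 h1, hA.sim_iff.1 h2,
        hA.isWeyr p₀ q₀ h2 h3⟩)
  · rw [hN X, hA.block_eq_iff]

end ReducedData

open ReducedData in
theorem BelitskiiStep.exists_stepAt {k : Type*} [Field k] [LinearOrder k] {n : ℕ}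
    {s s' : Matrix (Fin n) (Fin n) k × Subalgebra k (Matrix (Fin n) (Fin n) k)}
    (h : BelitskiiStep s s') :
    ∃ D : ReducedData k n, D.Presents s.2 ∧ ∃ l r, D.StepAt s.2 s'.2 s.1 s'.1 l r := h

/-! ### Uniqueness of a single step. -/

namespace ReducedData

variable {k : Type*} [Field k] {n : ℕ} {D : ReducedData k n}
  {Λ Λ' Λ'' : Subalgebra k (Matrix (Fin n) (Fin n) k)} {M N M' N' T : Matrix (Fin n) (Fin n) k}
  {l r : Fin D.t}

theorem Presents.posBlock_mul_eq_one (hD : D.Presents Λ) {X Y : Matrix (Fin n) (Fin n) k}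
    (hX : X ∈ Λ) (hY : Y ∈ Λ) (hXY : X * Y = 1) (i : Fin D.t) {a b : ℕ} (ha : a < D.size i)
    (hb : b < D.size i) : ∑ c ∈ Finset.range (D.size i), D.posBlock X i i a c *
      D.posBlock Y i i c b = if a = b then 1 else 0 := by
  obtain ⟨p, rfl, rfl⟩ := exists_pos ha
  obtain ⟨q, hq, rfl⟩ := exists_pos hb
  have h1 := congrFun (congrFun hXY p) q
  rw [hD.sum_upper_left hX Y rfl, Finset.sum_eq_zero (s := Finset.univ.filter fun s =>
    D.blk p < D.blk s), add_zero, sum_strip_mul, hq, Matrix.one_apply] at h1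
  · rw [h1]
    exact if_congr ⟨fun h => h ▸ rfl, fun h => eq_of_pos_eq hq.symm h⟩ rfl rfl
  · intro s hs
    rw [hD.tri hY (hq.symm ▸ (Finset.mem_filter.1 hs).2), mul_zero]

/-- The size of the identity block is monotone along transformations. -/
theorem NoAddition.corner_le (hNA : D.NoAddition M l r) (hD : D.Presents Λ)
    (hM' : ∀ p q, D.Earlier l r p q → M' p q = M p q)
    (hN' : ∀ p q, D.Earlier l r p q → N' p q = M p q) (hT : T ∈ Λ) (hu : IsUnit T)
    (hTN : T * N' = M' * T) {d d' : ℕ} (hdl : d ≤ D.size l)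
    (hdr' : d' ≤ D.size r) (hdl' : d' ≤ D.size l)
    (hM : ∀ p q : Fin n, D.blk p = l → D.blk q = r →
      M' p q = if D.pos p < d ∧ D.pos q = D.size r - d + D.pos p then 1 else 0)
    (hN : ∀ p q : Fin n, D.blk p = l → D.blk q = r →
      N' p q = if D.pos p < d' ∧ D.pos q = D.size r - d' + D.pos p then 1 else 0) : d' ≤ d := by
  have hU := Λ.matrix_inv_mem hT hu
  rw [← Finset.card_range d, ← Finset.card_range d']
  refine card_le_card_of_support (s := D.size l) (s' := D.size l) (T := D.posBlock T l l)
    (U := D.posBlock T⁻¹ l l) (fun b hb b' hb' => hD.posBlock_mul_eq_one hU hT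
      (Matrix.nonsing_inv_mul_of_isUnit hu) l hb hb') (Finset.range_subset_range.2 hdl)
    (Finset.range_subset_range.2 hdl') fun b hb a ha hna => ?_
  rw [Finset.mem_range] at hb hna
  obtain ⟨c', hc'⟩ : ∃ c', D.size r = c' + d' := ⟨D.size r - d', by omega⟩
  have hbr : c' + b < D.size r := by omega
  -- Column c' + b of T_ll N'_lr is column `b` of T_ll, and the rows of M'_lr T_rr from `d` on are
  -- zero. So the first d' columns of the invertible T_ll are supported on the first `d` rows.
  have h := hNA.posBlock_eq hD hN' hM' hT (fun p q _ _ => by rw [hTN]) a ha (c' + b) hbr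
  have e1 : ∑ c ∈ Finset.range (D.size l), D.posBlock T l l a c * D.posBlock N' l r c (c' + b) =
      ∑ c ∈ Finset.range (D.size l),
        D.posBlock T l l a c * (if c < d' ∧ c' + b = c' + c then 1 else 0) := by
    refine Finset.sum_congr rfl fun c hc => ?_
    obtain ⟨p, hp, rfl⟩ := exists_pos (Finset.mem_range.1 hc)
    obtain ⟨q, hq, hqb⟩ := exists_pos hbr
    rw [← hqb, posBlock_pos N' hp hq, hN p q hp hq, hc', Nat.add_sub_cancel]
  have e2 : ∑ c ∈ Finset.range (D.size r), D.posBlock M' l r a c * D.posBlock T r r c (c' + b) =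
      0 := by
    refine Finset.sum_eq_zero fun c hc => ?_
    obtain ⟨p, hp, rfl⟩ := exists_pos ha
    obtain ⟨q, hq, rfl⟩ := exists_pos (Finset.mem_range.1 hc)
    rw [posBlock_pos M' hp hq, hM p q hp hq, if_neg fun x => hna x.1, zero_mul]
  rw [e1, e2, sum_mul_corner (by omega) hdl', if_pos (by omega), Nat.add_sub_cancel_left] at h
  exact h

theorem NoAddition.corner_eq (hNA : D.NoAddition M l r) (hD : D.Presents Λ)
    (hM' : ∀ p q, D.Earlier l r p q → M' p q = M p q)
    (hN' : ∀ p q, D.Earlier l r p q → N' p q = M p q) (hT : T ∈ Λ) (hu : IsUnit T)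
    (hTN : T * N' = M' * T) (hM : D.IsCornerBlock M' l r) (hN : D.IsCornerBlock N' l r) :
    D.block N' l r = D.block M' l r := by
  obtain ⟨d, hdl, hdr, hM⟩ := hM
  obtain ⟨d', hdl', hdr', hN⟩ := hN
  have h1 : T⁻¹ * M' = N' * T⁻¹ := by
    calc T⁻¹ * M' = T⁻¹ * (M' * T) * T⁻¹ := by
          rw [mul_assoc, mul_assoc, Matrix.mul_nonsing_inv_of_isUnit hu, mul_one]
      _ = N' * T⁻¹ := by
          rw [← hTN, ← mul_assoc, Matrix.nonsing_inv_mul_of_isUnit hu, one_mul]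
  have hd : d = d' := le_antisymm
    (hNA.corner_le hD hN' hM' (Λ.matrix_inv_mem hT hu) (Matrix.isUnit_inv hu) h1 hdl' hdr hdl hN
      hM)
    (hNA.corner_le hD hM' hN' hT hu hTN hdl hdr' hdl' hM hN)
  subst hd
  exact ReducedData.block_eq_iff.2 fun p q hp hq => by rw [hM p q hp hq, hN p q hp hq]

/-- The diagonal blocks at `l` of `T` and T⁻¹ are mutually inverse and, in the absence of additions,
intertwine the two Weyr blocks; similar Weyr matrices are equal. -/
theorem NoAddition.weyr_eq [LinearOrder k] (hNA : D.NoAddition M l r) (hD : D.Presents Λ)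
    (hM' : ∀ p q, D.Earlier l r p q → M' p q = M p q)
    (hN' : ∀ p q, D.Earlier l r p q → N' p q = M p q) (hT : T ∈ Λ) (hu : IsUnit T)
    (hTN : T * N' = M' * T) (hlr : D.sim l r) (hM : IsWeyr (D.block M' l r))
    (hN : IsWeyr (D.block N' l r)) : D.block N' l r = D.block M' l r := by
  obtain ⟨μ, ev, lv, ix, hw, hM⟩ := (isWeyr_block_iff hlr M').1 hM
  obtain ⟨μ', ev', lv', ix', hw', hN⟩ := (isWeyr_block_iff hlr N').1 hN
  have hs := size_eq_of_sim hlr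
  have h1 : T⁻¹ * M' = N' * T⁻¹ := by
    calc T⁻¹ * M' = T⁻¹ * (M' * T) * T⁻¹ := by
          rw [mul_assoc, mul_assoc, Matrix.mul_nonsing_inv_of_isUnit hu, mul_one]
      _ = N' * T⁻¹ := by
          rw [← hTN, ← mul_assoc, Matrix.nonsing_inv_mul_of_isUnit hu, one_mul]
  have hU := Λ.matrix_inv_mem hT hu
  have key : ∀ {A B X : Matrix (Fin n) (Fin n) k} {ev ev' : ℕ → k} {lv lv' ix ix' : ℕ → ℕ},
      (∀ p q, D.Earlier l r p q → A p q = M p q) → (∀ p q, D.Earlier l r p q → B p q = M p q) →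
      X ∈ Λ → X * A = B * X →
      (∀ a < D.size l, ∀ b < D.size l, D.posBlock B l r a b = weyrEntry ev lv ix a b) →
      (∀ a < D.size l, ∀ b < D.size l, D.posBlock A l r a b = weyrEntry ev' lv' ix' a b) →
      IsWeyrLabelling.Intertwines (D.size l) (D.size l) ev ev' lv ix lv' ix'
        (D.posBlock X l l) := by
    intro A B X ev ev' lv lv' ix ix' hA hB hX hXA hBw hAw a ha b hb
    have := hNA.posBlock_eq hD hA hB hX (fun p q _ _ => by rw [hXA]) a ha b (hs ▸ hb)
    rw [← hs] at this
    refine Eq.trans (Finset.sum_congr rfl fun c hc => ?_)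
      (this.symm.trans (Finset.sum_congr rfl fun c hc => ?_))
    · rw [hBw a ha c (Finset.mem_range.1 hc), hD.posBlock_eq hX hlr (Finset.mem_range.1 hc) hb]
    · rw [hAw c (Finset.mem_range.1 hc) b hb]
  have := IsWeyrLabelling.weyrEntry_eq hw hw' (key hN' hM' hT hTN hM hN) (key hM' hN' hU h1 hN hM)
    (fun b hb b' hb' => hD.posBlock_mul_eq_one hU hT (Matrix.nonsing_inv_mul_of_isUnit hu) l hb hb')
    (fun b hb b' hb' => hD.posBlock_mul_eq_one hT hU (Matrix.mul_nonsing_inv_of_isUnit hu) l hb hb')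
  refine ReducedData.block_eq_iff.2 fun p q hp hq => ?_
  have hpl : D.pos p < D.size l := hp ▸ D.pos_lt_size p
  have hql : D.pos q < D.size l := by rw [hs, ← hq]; exact D.pos_lt_size q
  rw [← posBlock_pos N' hp hq, ← posBlock_pos M' hp hq, hM _ hpl _ hql, hN _ hpl _ hql,
    this _ hpl _ hql]

theorem FirstNonstable.unique {l' r' : Fin D.t} (h : D.FirstNonstable Λ M l r)
    (h' : D.FirstNonstable Λ M l' r') : l = l' ∧ r = r' := by
  have key : ∀ {a b a' b' : Fin D.t}, D.FirstNonstable Λ M a b → D.FirstNonstable Λ M a' b' →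
      ¬ D.Before a b a' b' := fun h h' hb => h.1 (h'.2 _ _ hb)
  have h1 := key h h'
  have h2 := key h' h
  unfold Before at h1 h2
  push Not at h1 h2
  have hl : l = l' := le_antisymm h1.1 h2.1
  exact ⟨hl, le_antisymm (h2.2 hl.symm) (h1.2 hl)⟩

theorem IsNext.mem_iff (h : D.IsNext Λ Λ' M' l r) (hE : CommOn Λ M' (D.Earlier l r))
    {X : Matrix (Fin n) (Fin n) k} :
    X ∈ Λ' ↔ X ∈ Λ ∧ ∀ p q, D.Upto l r p q → (X * M') p q = (M' * X) p q := by
  rw [h X, hE.mem_next_iff]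

section Step

variable [Infinite k]

theorem Presents.commOn_of_conj (hD : D.Presents Λ) {Q : Fin n → Fin n → Prop} (hQ : D.IsLower Q)
    {S : Matrix (Fin n) (Fin n) k} (hS : S ∈ Λ) (hu : IsUnit S)
    (h : CommOn Λ (S⁻¹ * M * S) Q) : CommOn Λ M Q := by
  have := h.conj hD hQ (Λ.matrix_inv_mem hS hu) (Matrix.isUnit_inv hu)
  rwa [Matrix.inv_inv_of_isUnit hu, mul_conj hu, mul_assoc, Matrix.mul_nonsing_inv_of_isUnit hu,
    mul_one] at this

theorem FirstNonstable.conj (h : D.FirstNonstable Λ M l r) (hD : D.Presents Λ)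
    {S : Matrix (Fin n) (Fin n) k} (hS : S ∈ Λ) (hu : IsUnit S) :
    D.FirstNonstable Λ (S⁻¹ * M * S) l r := by
  rw [hD.firstNonstable_iff] at h ⊢
  exact ⟨h.1.conj hD (isLower_earlier l r) hS hu,
    fun x => h.2 (hD.commOn_of_conj (isLower_upto l r) hS hu x)⟩

theorem FirstNonstable.conj_apply (h : D.FirstNonstable Λ M l r) (hD : D.Presents Λ)
    {S : Matrix (Fin n) (Fin n) k} (hS : S ∈ Λ) (hu : IsUnit S) :
    ∀ p q, D.Earlier l r p q → (S⁻¹ * M * S) p q = M p q :=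
  (hD.commOn_iff (isLower_earlier l r) M).1 (hD.firstNonstable_iff.1 h).1 S hS hu

variable [LinearOrder k]

/-- The algebra becomes smaller at each step. -/
theorem StepAt.lt (h : D.StepAt Λ Λ' M M' l r) (hD : D.Presents Λ) : Λ' < Λ := by
  obtain ⟨hF, ⟨S, hS, hu, rfl, -⟩, hN⟩ := h
  have hF' := hD.firstNonstable_iff.1 (hF.conj hD hS hu)
  -- If Λ' were all of Λ, the block (l, r) of M' would be stable; but M' is similar to `M` and has
  -- the same first nonstable block.
  exact lt_of_le_not_ge hN.le fun hle => hF'.2 fun X hX =>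
    ((hN.mem_iff hF'.1).1 (hle hX)).2

theorem StepAt.isReducedAlgebra (h : D.StepAt Λ Λ' M M' l r) (hD : D.Presents Λ) :
    IsReducedAlgebra Λ' := by
  obtain ⟨hF, ⟨S, hS, hu, rfl, hc⟩, hN⟩ := h
  have hE := hF.conj_apply hD hS hu
  rcases hc with ⟨-, -, h3⟩ | ⟨h1, h2, h3⟩ | ⟨h1, h2, h3⟩
  · exact hN.isReducedAlgebra_of_zero hD h3
  · exact hN.isReducedAlgebra_of_corner hD (noAddition_congr hE h1) h2 h3
  · exact hN.isReducedAlgebra_of_weyr hD (noAddition_congr hE h1) h2 h3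

/-- Steps that start from similar matrices lead to the same algebra and to matrices that are similar
with respect to it. -/
theorem StepAt.similar {l' r' : Fin D.t} (h : D.StepAt Λ Λ' M M' l r)
    (h' : D.StepAt Λ Λ'' N N' l' r') (hD : D.Presents Λ) (hMN : LambdaSimilar Λ M N) :
    Λ'' = Λ' ∧ LambdaSimilar Λ' M' N' := by
  obtain ⟨R, hR, huR, rfl⟩ := hMN
  obtain ⟨hF, ⟨S, hS, hu, hM', hc⟩, hX⟩ := h
  obtain ⟨hF', ⟨S', hS', hu', hN', hc'⟩, hX'⟩ := h'
  have hFR := hF.conj hD hR huR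
  obtain ⟨rfl, rfl⟩ := hFR.unique hF'
  -- M' and N' are Λ-similar through `M` and `N`; it remains to see that this `T` lies in Λ'.
  obtain ⟨T, hT, huT, hTN⟩ : LambdaSimilar Λ M' N' :=
    LambdaSimilar.trans (LambdaSimilar.symm ⟨S, hS, hu, hM'.symm⟩)
      (LambdaSimilar.trans ⟨R, hR, huR, rfl⟩ ⟨S', hS', hu', hN'.symm⟩)
  have hTN' : T * N' = M' * T := by rw [← hTN, mul_conj huT]
  have eR := hF.conj_apply hD hR huR
  have eM : ∀ p q, D.Earlier l r p q → M' p q = M p q := hM' ▸ hF.conj_apply hD hS hu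
  have eN : ∀ p q, D.Earlier l r p q → N' p q = M p q := fun p q hpq => by
    rw [hN', hFR.conj_apply hD hS' hu' p q hpq, eR p q hpq]
  have hNA : D.NoAddition (R⁻¹ * M * R) l r ↔ D.NoAddition M l r :=
    ⟨noAddition_congr fun p q hpq => (eR p q hpq).symm, noAddition_congr eR⟩
  have hblock : D.block N' l r = D.block M' l r := by
    rw [IsReduction, hNA] at hc'
    rcases hc with ⟨h1, h2, h3⟩ | ⟨h1, h2, h3⟩ | ⟨h1, h2, h3⟩ <;>
      rcases hc' with ⟨h1', h2', h3'⟩ | ⟨h1', h2', h3'⟩ | ⟨h1', h2', h3'⟩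
    · rw [h3, h3']
    · exact absurd h1' h1
    · exact absurd h1' h1
    · exact absurd h1 h1'
    · exact h1.corner_eq hD eM eN hT huT hTN' h3 h3'
    · exact absurd h2' h2
    · exact absurd h1 h1'
    · exact absurd h2 h2'
    · exact h1.weyr_eq hD eM eN hT huT hTN' h2 h3 h3'
  -- Earlier entries are stable and the normal form is unique, so M' and N' agree up to and
  -- including the block.
  have hU : ∀ p q, D.Upto l r p q → N' p q = M' p q := by
    intro p q hpq
    rcases ReducedData.upto_iff.1 hpq with hpq | hpq
    · rw [eN p q hpq, eM p q hpq]
    · exact ReducedData.block_eq_iff.1 hblock p q hpq.1 hpq.2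
  have hEM : CommOn Λ M' (D.Earlier l r) :=
    hM' ▸ (hD.firstNonstable_iff.1 (hF.conj hD hS hu)).1
  have hEN : CommOn Λ N' (D.Earlier l r) :=
    hN' ▸ (hD.firstNonstable_iff.1 (hFR.conj hD hS' hu')).1
  have hl := isLower_upto (D := D) l r
  constructor
  · ext X
    -- The condition that defines the next algebra involves M' only at places up to (l, r).
    rw [hX.mem_iff hEM, hX'.mem_iff hEN]
    refine and_congr_right fun hXΛ => forall_congr' fun p => forall_congr' fun q =>
      forall_congr' fun hpq => ?_
    rw [hD.mul_apply_congr hl hXΛ hU hpq, hD.apply_mul_congr hl hXΛ hU hpq]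
  · refine ⟨T, (hX.mem_iff hEM).2 ⟨hT, fun p q hpq => ?_⟩, huT, hTN⟩
    rw [← hTN', hD.mul_apply_congr hl hT hU hpq]

end Step

end ReducedData

/-! ### Termination and uniqueness of the output. -/

section Algorithm

variable {k : Type*} [Field k] {n : ℕ} {Λ : Subalgebra k (Matrix (Fin n) (Fin n) k)}
  {s s' : Matrix (Fin n) (Fin n) k × Subalgebra k (Matrix (Fin n) (Fin n) k)}
  {M N C D : Matrix (Fin n) (Fin n) k}

theorem BelitskiiStops.eq_of_similar (hs : BelitskiiStops (M, Λ)) (h : LambdaSimilar Λ M N) :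
    N = M := by
  obtain ⟨S, hS, hu, rfl⟩ := h
  exact hs S hS hu

variable [LinearOrder k]

theorem BelitskiiStep.not_stops (h : BelitskiiStep s s') : ¬ BelitskiiStops s := by
  obtain ⟨D, -, l, r, hF, -⟩ := h
  intro hs
  refine hF.1 fun S hS hu => ?_
  rw [hs S hS hu]

theorem BelitskiiStep.lambdaSimilar (h : BelitskiiStep s s') : LambdaSimilar s.2 s.1 s'.1 := by
  obtain ⟨D, -, l, r, -, ⟨S, hS, hu, h', -⟩, -⟩ := h
  exact ⟨S, hS, hu, h'.symm⟩

theorem BelitskiiStep.lt [Infinite k] (h : BelitskiiStep s s') : s'.2 < s.2 := by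
  obtain ⟨D, hD, l, r, h⟩ := h.exists_stepAt
  exact h.lt hD

theorem BelitskiiStep.finrank_lt [Infinite k] (h : BelitskiiStep s s') :
    Module.finrank k s'.2 < Module.finrank k s.2 :=
  Submodule.finrank_lt_finrank_of_lt (s := Subalgebra.toSubmodule s'.2)
    (t := Subalgebra.toSubmodule s.2) (OrderEmbedding.strictMono _ h.lt)

theorem BelitskiiStep.isReducedAlgebra [Infinite k] (h : BelitskiiStep s s') :
    IsReducedAlgebra s'.2 := by
  obtain ⟨D, hD, l, r, h⟩ := h.exists_stepAt
  exact h.isReducedAlgebra hD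

theorem IsReducedAlgebra.stops_or_step [IsAlgClosed k] (h : IsReducedAlgebra s.2) :
    BelitskiiStops s ∨ ∃ s', BelitskiiStep s s' := by
  obtain ⟨D, hD⟩ := h
  exact or_iff_not_imp_left.2 fun hs => hD.exists_step hs

variable [Infinite k]

theorem IsReducedAlgebra.of_reflTransGen (hΛ : IsReducedAlgebra s.2)
    (h : Relation.ReflTransGen BelitskiiStep s s') : IsReducedAlgebra s'.2 := by
  rcases h.cases_tail with rfl | ⟨s₁, -, h⟩
  · exact hΛ
  · exact h.isReducedAlgebra

theorem lambdaSimilar_of_reflTransGen (h : Relation.ReflTransGen BelitskiiStep s s') :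
    s'.2 ≤ s.2 ∧ LambdaSimilar s.2 s.1 s'.1 := by
  induction h with
  | refl => exact ⟨le_rfl, LambdaSimilar.refl _⟩
  | tail _ h ih => exact ⟨h.lt.le.trans ih.1, ih.2.trans (h.lambdaSimilar.mono ih.1)⟩

theorem IsBelitskiiOutput.lambdaSimilar (h : IsBelitskiiOutput Λ M C) : LambdaSimilar Λ M C := by
  obtain ⟨Λ', h, -⟩ := h
  exact (lambdaSimilar_of_reflTransGen h).2

theorem not_exists_infinite_belitskiiStep
    (f : ℕ → Matrix (Fin n) (Fin n) k × Subalgebra k (Matrix (Fin n) (Fin n) k)) :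
    ¬ ∀ i, BelitskiiStep (f i) (f (i + 1)) := fun h =>
  not_strictAnti_of_wellFoundedLT (fun i => Module.finrank k (f i).2)
    (strictAnti_nat_of_succ_lt fun i => (h i).finrank_lt)

theorem IsReducedAlgebra.exists_output [IsAlgClosed k] (hΛ : IsReducedAlgebra Λ)
    (M : Matrix (Fin n) (Fin n) k) : ∃ C, IsBelitskiiOutput Λ M C := by
  induction hd : Module.finrank k Λ using Nat.strong_induction_on generalizing Λ M with
  | _ d ih =>
    rcases hΛ.stops_or_step (s := (M, Λ)) with hs | ⟨s', hs⟩
    · exact ⟨M, Λ, Relation.ReflTransGen.refl, hs⟩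
    · obtain ⟨C, Λ', h, hC⟩ := ih _ (hd ▸ hs.finrank_lt) hs.isReducedAlgebra s'.1 rfl
      exact ⟨C, Λ', Relation.ReflTransGen.head hs h, hC⟩

/-- The two steps may use different data of Λ; the second is first rewritten with the data of the
first. -/
theorem BelitskiiStep.similar {s₁ s₂ : Matrix (Fin n) (Fin n) k ×
    Subalgebra k (Matrix (Fin n) (Fin n) k)} (h₁ : BelitskiiStep (M, Λ) s₁)
    (h₂ : BelitskiiStep (N, Λ) s₂) (h : LambdaSimilar Λ M N) :
    s₂.2 = s₁.2 ∧ LambdaSimilar s₁.2 s₁.1 s₂.1 := by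
  obtain ⟨D, hD, l, r, h₁⟩ := h₁.exists_stepAt
  obtain ⟨D', hD', l', r', h₂⟩ := h₂.exists_stepAt
  obtain ⟨l', r', h₂⟩ := h₂.transfer hD' hD
  exact h₁.similar h₂ hD h

/-- Similar matrices have the same canonical forms. -/
theorem IsBelitskiiOutput.eq_of_similar (hC : IsBelitskiiOutput Λ M C)
    (hD : IsBelitskiiOutput Λ N D) (h : LambdaSimilar Λ M N) : C = D := by
  induction hd : Module.finrank k Λ using Nat.strong_induction_on generalizing Λ M N with
  | _ d ih =>
    obtain ⟨Λ₁, hC, hCs⟩ := hC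
    obtain ⟨Λ₂, hD, hDs⟩ := hD
    rcases hC.cases_head with he | ⟨s₁, h₁, hC⟩
    -- If one run stops at once, its similarity class is a single matrix, so both runs start from
    -- the same pair and neither makes a step.
    · obtain ⟨rfl, rfl⟩ := Prod.mk.inj he
      obtain rfl := hCs.eq_of_similar h
      rcases hD.cases_head with he' | ⟨s₂, h₂, -⟩
      · exact (Prod.mk.inj he').1
      · exact absurd hCs h₂.not_stops
    · rcases hD.cases_head with he' | ⟨s₂, h₂, hD⟩
      · obtain ⟨rfl, rfl⟩ := Prod.mk.inj he'
        obtain rfl := hDs.eq_of_similar h.symm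
        exact absurd hDs h₁.not_stops
      · obtain ⟨e, hs⟩ := h₁.similar h₂ h
        refine ih _ (hd ▸ h₁.finrank_lt) ⟨Λ₁, hC, hCs⟩ ⟨Λ₂, ?_, hDs⟩ hs rfl
        rwa [← e]

end Algorithm

/-- Let `k` be an algebraically closed field with a fixed linear order of its elements (used only
to order eigenvalues in Weyr matrices), and let `Λ` be a reduced matrix algebra.
Belitskii's algorithm never gets stuck and never runs forever, and its output `M^∞` does not
depend on the choices made; `M ∼_Λ M^∞` for every `M`; `M ∼_Λ N` if and only if `M^∞ = N^∞`;
so each class of `Λ`-similar matrices contains exactly one canonical matrix. -/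
theorem theorem1p3 {k : Type*} [Field k] [IsAlgClosed k] [LinearOrder k] {n : ℕ}
    (Λ : Subalgebra k (Matrix (Fin n) (Fin n) k)) (hΛ : IsReducedAlgebra Λ) :
    (∀ M, ∀ s, Relation.ReflTransGen BelitskiiStep (M, Λ) s →
      BelitskiiStops s ∨ ∃ s', BelitskiiStep s s') ∧
    (∀ M, ¬ ∃ f : ℕ → Matrix (Fin n) (Fin n) k × Subalgebra k (Matrix (Fin n) (Fin n) k),
      f 0 = (M, Λ) ∧ ∀ i, BelitskiiStep (f i) (f (i + 1))) ∧
    (∀ M, ∃! C, IsBelitskiiOutput Λ M C) ∧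
    (∀ M C, IsBelitskiiOutput Λ M C → LambdaSimilar Λ M C) ∧
    (∀ M N C D, IsBelitskiiOutput Λ M C → IsBelitskiiOutput Λ N D →
      (LambdaSimilar Λ M N ↔ C = D)) ∧
    (∀ M, ∃! C, LambdaSimilar Λ M C ∧ ∃ N, IsBelitskiiOutput Λ N C) := by
  have : Infinite k := IsAlgClosed.instInfinite
  refine ⟨fun M s h => (hΛ.of_reflTransGen h).stops_or_step,
    fun M ⟨f, _, hf⟩ => not_exists_infinite_belitskiiStep f hf, fun M => ?_,
    fun M C h => h.lambdaSimilar, fun M N C D hC hD => ⟨hC.eq_of_similar hD, ?_⟩, fun M => ?_⟩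
  · obtain ⟨C, hC⟩ := hΛ.exists_output M
    exact ⟨C, hC, fun D hD => hD.eq_of_similar hC (LambdaSimilar.refl M)⟩
  · rintro rfl
    exact hC.lambdaSimilar.trans hD.lambdaSimilar.symm
  · obtain ⟨C, hC⟩ := hΛ.exists_output M
    refine ⟨C, ⟨hC.lambdaSimilar, M, hC⟩, ?_⟩
    rintro D ⟨hD, N, hN⟩
    exact hN.eq_of_similar hC (hN.lambdaSimilar.trans hD.symm)
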